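/- Let $C$ be an elliptic curve over $\mathbb{C}$ with identity $e$, $G=\mathbb{T}^2$ and $\chi=C\times C$. **Subgroups and subvarieties.** For a closed subgroup $K\le G$ let $K^*$ be its character group and $\mathfrak{X}(K)=\mathrm{Hom}(K^*,C)\subseteq \mathrm{Hom}(G^*,C)=\chi$; let $\overline{\mathfrak X}(K)=\mathfrak{X}(K)\setminus\bigcup_{K'}\mathfrak{X}(K')$, the union being over the proper closed subgroups $K'<K$ of finite index. Let $H_i$ run through the connected closed subgroups of codimension $1$ of $G$. Each is the kernel of a unique character $z_i(x,y)=x^{\lambda_i}y^{\mu_i}$ with $\lambda_i,\mu_i$ coprime and $\mu_i>0$ or $(\lambda_i,\mu_i)=(1,0)$; put $H_i^j=\ker z_i^j$ for $j\ge 1$, $\pi_i(P,P')=\lambda_iP+\mu_iP'$ and $D_{ij}=\overline{\mathfrak X}(H_i^j)$. For a finite subgroup $F\le G$ let $n_i=n_i(F)\ge1$ be the integer with $\langle F,H_i\rangle=H_i^{n_i}$. Choose for every $F$ two directions $A=A(F)\ne B=B(F)$ with $F=H_A^{n_A}\cap H_B^{n_B}$. **Rings.** Let $\mathcal{K}$ be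 the ring of rational functions on $\chi$ whose poles lie on a finite union of the $D_{ij}$; let $\mathcal{O}_{D_{ij}}\subseteq\mathcal{K}$ be the subring of functions regular at $D_{ij}$ (poles only along other $D_{i'j'}$), $m_{ij}$ its ideal of functions vanishing on $D_{ij}$; let $\mathcal{O}_F\subseteq\mathcal{K}$ be the subring of functions regular along $D_{i,n_i(F)}$ for all $i$, and $m_F$ its ideal of functions vanishing on $\overline{\mathfrak X}(F)$. **Cousin differential.** Let $H^1_{D_{ij}}=\mathcal{K}/\mathcal{O}_{D_{ij}}$ and $H^2_F=\big(\bigoplus_{i}\mathcal{K}/\mathcal{O}_{D_{i,n_i(F)}}\big)/\mathcal{K}$, the terms of codimension one and two of the Cousin complex of the structure sheaf. For a module $M$ let $\overline M$ be its $2$-periodic version ($M$ in each even degree, $0$ in odd degrees), and put $T_i=\bigoplus_{j\ge1}\overline{H^1_{D_{ij}}}$, $N=\bigoplus_F\overline{H^2_F}$. The component $d_1^i:T_i\to N$ of the Cousin differential is given in each degree by the maps $\mathcal{K}/\mathcal{O}_{D_{i,n_i(F)}}\to H^2_F$ induced by the inclusion of the $i$-th summand: the component at $F$ of $d_1^i(x)$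 is the image of the component of $x$ at $j=n_i(F)$. **Completed coordinates.** Let $t$ be a rational function on $C$ that vanishes to first order at $e$ and whose poles are points of finite order. Let $\mathcal F(t_1,t_2)\in\mathbb{C}[[t_1,t_2]]$ be the formal group law of $C$ with respect to $t$ (the expansion of $t(P+P')$ in $t_1=t(P)$, $t_2=t(P')$ at $(e,e)$) and $f(t)=\sum_{k\ge1}\alpha_kt^k$, $\alpha_1=1$, its logarithm: $f(\mathcal F(t_1,t_2))=f(t_1)+f(t_2)$. Put $t_{ij}=t\circ (j\pi_i)$ and $\hat t_{ij}=f(t_{ij})=\sum_{k\ge 1}\alpha_kt_{ij}^k$, an element of $(\mathcal{O}_{D_{ij}})^\wedge_{m_{ij}}$; for $j=n_i(F)$ it is also an element of $(\mathcal{O}_F)^\wedge_{m_F}$. **Actions.** Let $\mathcal{O}_{\mathcal F/H_i}=\prod_{j\ge1}H^*(B(G/H_i^j);\mathbb{Q})$ and $\mathcal{O}_{\mathcal F}=\prod_FH^*(B(G/F);\mathbb{Q})$. Writing $e(z)$ for the Euler class of a character $z$, one has $H^*(B(G/H_i^j);\mathbb{Q})=\mathbb{Q}[e(z_i^j)]$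 and $H^*(B(G/F);\mathbb{Q})=\mathbb{Q}[e(z_A^{n_A}),e(z_B^{n_B})]$. The first acts on $\overline{H^1_{D_{ij}}}$, with $e(z_i^j)$ acting as $\hat t_{ij}$ in degree $-2$; the second acts on $\overline{H^2_F}$, with $e(z_A^{n_A})$, $e(z_B^{n_B})$ acting as $\hat t_{A,n_A}$, $\hat t_{B,n_B}$ in degree $-2$. So $\mathcal{O}_{\mathcal F/H_i}$ acts on $T_i$ and $\mathcal{O}_{\mathcal F}$ acts on $N$. Let $\mathcal{O}_{\mathcal F/H_i}$ act on $N$ along the inflation map $\mathcal{O}_{\mathcal F/H_i}\to\mathcal{O}_{\mathcal F}$, whose component at $F$ is the projection to the factor $j=n_i(F)$ followed by the inflation map $H^*(B(G/H_i^{n_i}))\to H^*(B(G/F))$. **Statement.** 1. Every element of $H^1_{D_{ij}}$ is annihilated by a power of $m_{ij}$, and every element of $H^2_F$ by a power of $m_F$; so these modules are modules over the completed rings and the actions above are defined. 2. For every $i$ the map $d_1^i$ is well defined (it takes values in the direct sum $N$) and is a map of $\mathcal{O}_{\mathcal F/H_i}$-modules $T_i\to N$. 3. For every finite subgroup $F$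 and every $i$ there are unique integers $r,s$ with $z_i^{n_i}=(z_A^{n_A})^r(z_B^{n_B})^s$, and for them $$\hat t_{i,n_i}=r\cdot\hat t_{A,n_A}+s\cdot\hat t_{B,n_B}\quad\text{in }(\mathcal{O}_F)^\wedge_{m_F}.$$ -/

import Mathlib

noncomputable section

namespace EllCousin

/-! ### The elliptic curve and regular functions on it and on its square -/

section Geometry

open WeierstrassCurve

/-- The complex points of the elliptic curve `C`. -/
abbrev Pt (W : WeierstrassCurve ℂ) : Type := WeierstrassCurve.Affine.Point W

/-- Homogeneous coordinates `[X : Y : Z]` of a point of `C ⊆ ℙ²`. -/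
def homCoord {W : WeierstrassCurve ℂ} : Pt W → Fin 3 → ℂ
  | .zero => ![0, 1, 0]
  | .some x y _ => ![x, y, 1]

/-- `p` is homogeneous of degree `d`. -/
def IsHomog (p : MvPolynomial (Fin 3) ℂ) (d : ℕ) : Prop :=
  ∀ (u : ℂ) (x : Fin 3 → ℂ), MvPolynomial.eval (u • x) p = u ^ d * MvPolynomial.eval x p

/-- `p` is homogeneous of degree `d` in the first three variables and of degree `e` in the last
three. -/
def IsBihomog (p : MvPolynomial (Fin 3 ⊕ Fin 3) ℂ) (d e : ℕ) : Prop :=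
  ∀ (u v : ℂ) (x y : Fin 3 → ℂ),
    MvPolynomial.eval (Sum.elim (u • x) (v • y)) p =
      u ^ d * v ^ e * MvPolynomial.eval (Sum.elim x y) p

variable {W : WeierstrassCurve ℂ}

/-- The value of `p` at the chosen homogeneous coordinates of `P`. -/
def evalC (P : Pt W) (p : MvPolynomial (Fin 3) ℂ) : ℂ := MvPolynomial.eval (homCoord P) p

/-- The value of `p` at the chosen homogeneous coordinates of the point `Q` of `C × C`. -/
def evalX (Q : Pt W × Pt W) (p : MvPolynomial (Fin 3 ⊕ Fin 3) ℂ) : ℂ :=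
  MvPolynomial.eval (Sum.elim (homCoord Q.1) (homCoord Q.2)) p

/-- `f` is a regular function in a Zariski neighbourhood of the point `P` of `C`. -/
def RegularAtC (f : Pt W → ℂ) (P : Pt W) : Prop :=
  ∃ (d : ℕ) (a b : MvPolynomial (Fin 3) ℂ), IsHomog a d ∧ IsHomog b d ∧ evalC P b ≠ 0 ∧
    ∀ P' : Pt W, evalC P' b ≠ 0 → f P' = evalC P' a / evalC P' b

/-- `f` is a regular function in a Zariski neighbourhood of the point `Q` of `C × C`. -/
def RegularAt (f : Pt W × Pt W → ℂ) (Q : Pt W × Pt W) : Prop :=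
  ∃ (d e : ℕ) (a b : MvPolynomial (Fin 3 ⊕ Fin 3) ℂ), IsBihomog a d e ∧ IsBihomog b d e ∧
    evalX Q b ≠ 0 ∧ ∀ Q' : Pt W × Pt W, evalX Q' b ≠ 0 → f Q' = evalX Q' a / evalX Q' b

theorem IsBihomog.add {p q : MvPolynomial (Fin 3 ⊕ Fin 3) ℂ} {d e : ℕ}
    (hp : IsBihomog p d e) (hq : IsBihomog q d e) : IsBihomog (p + q) d e := by
  intro u v x y; simp only [map_add, hp u v x y, hq u v x y]; ring

theorem IsBihomog.mul {p q : MvPolynomial (Fin 3 ⊕ Fin 3) ℂ} {d e d' e' : ℕ}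
    (hp : IsBihomog p d e) (hq : IsBihomog q d' e') : IsBihomog (p * q) (d + d') (e + e') := by
  intro u v x y; simp only [map_mul, hp u v x y, hq u v x y]; ring

theorem IsHomog.add {p q : MvPolynomial (Fin 3) ℂ} {d : ℕ}
    (hp : IsHomog p d) (hq : IsHomog q d) : IsHomog (p + q) d := by
  intro u x; simp only [map_add, hp u x, hq u x]; ring

theorem IsHomog.mul {p q : MvPolynomial (Fin 3) ℂ} {d d' : ℕ}
    (hp : IsHomog p d) (hq : IsHomog q d') : IsHomog (p * q) (d + d') := by
  intro u x; simp only [map_mul, hp u x, hq u x]; ring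

theorem regularAtC_const (c : ℂ) (P : Pt W) : RegularAtC (fun _ => c) P :=
  ⟨0, MvPolynomial.C c, 1, by intro u x; simp, by intro u x; simp, by simp [evalC],
    by intro P' _; simp [evalC]⟩

theorem RegularAtC.add {f g : Pt W → ℂ} {P : Pt W} (hf : RegularAtC f P) (hg : RegularAtC g P) :
    RegularAtC (f + g) P := by
  obtain ⟨d, a, b, ha, hb, h0, h⟩ := hf
  obtain ⟨d', a', b', ha', hb', h0', h'⟩ := hg
  refine ⟨d + d', a * b' + b * a', b * b', (ha.mul hb').add (hb.mul ha'), hb.mul hb',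
    by simpa [evalC] using And.intro h0 h0', fun P' hP' => ?_⟩
  have h1 : evalC P' b ≠ 0 ∧ evalC P' b' ≠ 0 := by simpa [evalC] using hP'
  rw [Pi.add_apply, h P' h1.1, h' P' h1.2, div_add_div _ _ h1.1 h1.2]
  simp [evalC]

theorem RegularAtC.mul {f g : Pt W → ℂ} {P : Pt W} (hf : RegularAtC f P) (hg : RegularAtC g P) :
    RegularAtC (f * g) P := by
  obtain ⟨d, a, b, ha, hb, h0, h⟩ := hf
  obtain ⟨d', a', b', ha', hb', h0', h'⟩ := hg
  refine ⟨d + d', a * a', b * b', ha.mul ha', hb.mul hb',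
    by simpa [evalC] using And.intro h0 h0', fun P' hP' => ?_⟩
  have h1 : evalC P' b ≠ 0 ∧ evalC P' b' ≠ 0 := by simpa [evalC] using hP'
  rw [Pi.mul_apply, h P' h1.1, h' P' h1.2, div_mul_div_comm]
  simp [evalC]

theorem regularAt_const (c : ℂ) (Q : Pt W × Pt W) : RegularAt (fun _ => c) Q :=
  ⟨0, 0, MvPolynomial.C c, 1, by intro u v x y; simp, by intro u v x y; simp, by simp [evalX],
    by intro Q' _; simp [evalX]⟩

theorem RegularAt.add {f g : Pt W × Pt W → ℂ} {Q : Pt W × Pt W}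
    (hf : RegularAt f Q) (hg : RegularAt g Q) : RegularAt (f + g) Q := by
  obtain ⟨d, e, a, b, ha, hb, h0, h⟩ := hf
  obtain ⟨d', e', a', b', ha', hb', h0', h'⟩ := hg
  refine ⟨d + d', e + e', a * b' + b * a', b * b', (ha.mul hb').add (hb.mul ha'), hb.mul hb',
    by simpa [evalX] using And.intro h0 h0', fun Q' hQ' => ?_⟩
  have h1 : evalX Q' b ≠ 0 ∧ evalX Q' b' ≠ 0 := by simpa [evalX] using hQ'
  rw [Pi.add_apply, h Q' h1.1, h' Q' h1.2, div_add_div _ _ h1.1 h1.2]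
  simp [evalX]

theorem RegularAt.mul {f g : Pt W × Pt W → ℂ} {Q : Pt W × Pt W}
    (hf : RegularAt f Q) (hg : RegularAt g Q) : RegularAt (f * g) Q := by
  obtain ⟨d, e, a, b, ha, hb, h0, h⟩ := hf
  obtain ⟨d', e', a', b', ha', hb', h0', h'⟩ := hg
  refine ⟨d + d', e + e', a * a', b * b', ha.mul ha', hb.mul hb',
    by simpa [evalX] using And.intro h0 h0', fun Q' hQ' => ?_⟩
  have h1 : evalX Q' b ≠ 0 ∧ evalX Q' b' ≠ 0 := by simpa [evalX] using hQ'
  rw [Pi.mul_apply, h Q' h1.1, h' Q' h1.2, div_mul_div_comm]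
  simp [evalX]

/-! ### The group law is a morphism -/

/-- `φ` is near `Q` given by homogeneous coordinates that are bihomogeneous polynomials. -/
def MorphAt (φ : Pt W × Pt W → Pt W) (Q : Pt W × Pt W) : Prop :=
  ∃ (d e : ℕ) (X : Fin 3 → MvPolynomial (Fin 3 ⊕ Fin 3) ℂ) (d' e' : ℕ)
    (c : MvPolynomial (Fin 3 ⊕ Fin 3) ℂ), (∀ k, IsBihomog (X k) d e) ∧ IsBihomog c d' e' ∧
    evalX Q c ≠ 0 ∧ ∀ Q' : Pt W × Pt W, evalX Q' c ≠ 0 →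
      ∃ u : ℂ, u ≠ 0 ∧ (fun k => evalX Q' (X k)) = u • homCoord (φ Q')

theorem MorphAt.comp_regular {φ : Pt W × Pt W → Pt W} {Q : Pt W × Pt W} (hφ : MorphAt φ Q)
    {t : Pt W → ℂ} (ht : RegularAtC t (φ Q)) : RegularAt (fun Q' => t (φ Q')) Q := by
  obtain ⟨d, e, X, d', e', c, hX, hc, hcQ, h⟩ := hφ
  obtain ⟨n, a, b, ha, hb, hbQ, hab⟩ := ht
  have key : ∀ (p : MvPolynomial (Fin 3) ℂ) (z : Fin 3 ⊕ Fin 3 → ℂ),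
      MvPolynomial.eval z (MvPolynomial.aeval X p) =
        MvPolynomial.eval (fun k => MvPolynomial.eval z (X k)) p := by
    intro p z
    induction p using MvPolynomial.induction_on with
    | C a => simp
    | add p q hp hq => simp only [map_add, hp, hq]
    | mul_X p k hp => simp only [map_mul, hp, MvPolynomial.aeval_X, MvPolynomial.eval_X]
  have hhom : ∀ p : MvPolynomial (Fin 3) ℂ, IsHomog p n →
      IsBihomog (MvPolynomial.aeval X p) (d * n) (e * n) := by
    intro p hp u v x y
    rw [key, key]
    have : (fun k => MvPolynomial.eval (Sum.elim (u • x) (v • y)) (X k)) =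
        (u ^ d * v ^ e) • (fun k => MvPolynomial.eval (Sum.elim x y) (X k)) := by
      funext k; simp [hX k u v x y]
    rw [this, hp]; ring
  have hev : ∀ (p : MvPolynomial (Fin 3) ℂ), IsHomog p n → ∀ Q', evalX Q' c ≠ 0 →
      ∃ u : ℂ, u ≠ 0 ∧ (∀ p, IsHomog p n → evalX Q' (MvPolynomial.aeval X p) =
        u * evalC (φ Q') p) := by
    intro _ _ Q' hQ'
    obtain ⟨u, hu, hu'⟩ := h Q' hQ'
    refine ⟨u ^ n, pow_ne_zero _ hu, fun p hp => ?_⟩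
    have : evalX Q' (MvPolynomial.aeval X p) =
        MvPolynomial.eval (fun k => evalX Q' (X k)) p := key p _
    rw [this, hu', hp]; rfl
  refine ⟨_, _, MvPolynomial.aeval X a * c, MvPolynomial.aeval X b * c, (hhom a ha).mul hc,
    (hhom b hb).mul hc, ?_, ?_⟩
  · obtain ⟨u, hu, hp⟩ := hev a ha Q hcQ
    have : evalX Q (MvPolynomial.aeval X b * c) = (u * evalC (φ Q) b) * evalX Q c := by
      rw [← hp b hb]; simp [evalX]
    rw [this]; exact mul_ne_zero (mul_ne_zero hu hbQ) hcQ
  · intro Q' hQ'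
    have h2 : evalX Q' (MvPolynomial.aeval X b * c) =
      evalX Q' (MvPolynomial.aeval X b) * evalX Q' c := by simp [evalX]
    have h1 : evalX Q' (MvPolynomial.aeval X a * c) =
      evalX Q' (MvPolynomial.aeval X a) * evalX Q' c := by simp [evalX]
    have hc' : evalX Q' c ≠ 0 := fun h0 => hQ' (by rw [h2, h0, mul_zero])
    obtain ⟨u, hu, hp⟩ := hev a ha Q' hc'
    have hb' : evalC (φ Q') b ≠ 0 := fun h0 => hQ' (by rw [h2, hp b hb, h0]; simp)
    change t (φ Q') = _
    rw [hab _ hb', h1, h2, hp a ha, hp b hb]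
    field_simp

theorem morphAt_const (T : Pt W) (Q : Pt W × Pt W) : MorphAt (fun _ => T) Q :=
  ⟨0, 0, fun k => MvPolynomial.C (homCoord T k), 0, 0, 1, by intro k u v x y; simp,
    by intro u v x y; simp, by simp [evalX], fun Q' _ => ⟨1, one_ne_zero, by
      funext k; simp [evalX]⟩⟩

theorem morphAt_fst (Q : Pt W × Pt W) : MorphAt (W := W) Prod.fst Q :=
  ⟨1, 0, fun k => MvPolynomial.X (Sum.inl k), 0, 0, 1, by intro k u v x y; simp,
    by intro u v x y; simp, by simp [evalX], fun Q' _ => ⟨1, one_ne_zero, by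
      funext k; simp [evalX]⟩⟩

theorem morphAt_snd (Q : Pt W × Pt W) : MorphAt (W := W) Prod.snd Q :=
  ⟨0, 1, fun k => MvPolynomial.X (Sum.inr k), 0, 0, 1, by intro k u v x y; simp,
    by intro u v x y; simp, by simp [evalX], fun Q' _ => ⟨1, one_ne_zero, by
      funext k; simp [evalX]⟩⟩

theorem homCoord_nonsingular (P : Pt W) :
    Projective.Nonsingular W (homCoord P) := by
  rcases P with _ | ⟨x, y, h⟩
  · exact Projective.nonsingular_zero
  · exact (Projective.nonsingular_some x y).mpr h

theorem toAffine_homCoord (P : Pt W) :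
    Projective.Point.toAffine W (homCoord P) = P := by
  rcases P with _ | ⟨x, y, h⟩
  · exact Projective.Point.toAffine_zero
  · exact Projective.Point.toAffine_some ((Projective.nonsingular_some x y).mpr h)

theorem eq_smul_homCoord {R : Fin 3 → ℂ} (hR : Projective.Nonsingular W R) :
    ∃ u : ℂ, u ≠ 0 ∧ R = u • homCoord (Projective.Point.toAffine W R) := by
  by_cases hz : R 2 = 0
  · rw [Projective.Point.toAffine_of_Z_eq_zero hz]
    obtain ⟨u, hu⟩ := Projective.equiv_zero_of_Z_eq_zero hR hz
    exact ⟨u, u.ne_zero, hu.symm⟩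
  · rw [Projective.Point.toAffine_of_Z_ne_zero hR hz]
    obtain ⟨u, hu⟩ := Projective.equiv_some_of_Z_ne_zero hz
    exact ⟨u, u.ne_zero, hu.symm⟩

theorem addXYZ_homCoord {P Q : Pt W} (h : P ≠ Q) :
    ∃ u : ℂ, u ≠ 0 ∧ Projective.addXYZ W (homCoord P) (homCoord Q) = u • homCoord (P + Q) := by
  have hne : ¬ MulAction.orbitRel ℂˣ (Fin 3 → ℂ) (homCoord P) (homCoord Q) := fun h' => h <| by
    rw [← toAffine_homCoord P, ← toAffine_homCoord Q]
    exact Projective.Point.toAffine_of_equiv h'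
  have hP := homCoord_nonsingular P
  have hQ := homCoord_nonsingular Q
  have h1 := Projective.Point.toAffine_add hP hQ
  rw [toAffine_homCoord, toAffine_homCoord] at h1
  obtain ⟨u, hu, hu'⟩ := eq_smul_homCoord (Projective.nonsingular_add hP hQ)
  refine ⟨u, hu, ?_⟩
  rw [← h1, ← hu', Projective.add_of_not_equiv hne]

theorem homCoord_minor {P Q : Pt W} (h : P ≠ Q) :
    ∃ k l, homCoord P k * homCoord Q l - homCoord P l * homCoord Q k ≠ 0 := by
  by_contra! hc
  apply h
  rcases P with _ | ⟨x, y, hP⟩ <;> rcases Q with _ | ⟨x', y', hQ⟩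
  · rfl
  · have := hc 1 2; simp [homCoord] at this
  · have := hc 1 2; simp [homCoord] at this
  · have h0 := hc 0 2
    have h1 := hc 1 2
    simp only [homCoord, Matrix.cons_val] at h0 h1
    have e1 : x = x' := by linear_combination h0
    have e2 : y = y' := by linear_combination h1
    subst e1 e2; rfl

theorem MorphAt.add_of_ne {φ ψ : Pt W × Pt W → Pt W} {Q : Pt W × Pt W}
    (hφ : MorphAt φ Q) (hψ : MorphAt ψ Q) (hne : φ Q ≠ ψ Q) :
    MorphAt (fun Q' => φ Q' + ψ Q') Q := by
  obtain ⟨d, e, X, m, n, c, hX, hc, hcQ, h⟩ := hφ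
  obtain ⟨d', e', Y, m', n', c', hY, hc', hcQ', h'⟩ := hψ
  obtain ⟨k, l, hkl⟩ := homCoord_minor hne
  have hev : ∀ z : Fin 3 ⊕ Fin 3 → ℂ, ∀ i, MvPolynomial.eval z
      (Projective.addXYZ (W.map MvPolynomial.C) X Y i) =
      Projective.addXYZ W (fun k => MvPolynomial.eval z (X k))
        (fun k => MvPolynomial.eval z (Y k)) i := by
    intro z i
    have := Projective.map_addXYZ (W' := W.map MvPolynomial.C) (MvPolynomial.eval z) X Y
    have hW : (W.map MvPolynomial.C).map (MvPolynomial.eval z) = W := by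
      rw [WeierstrassCurve.map_map]
      have : (MvPolynomial.eval z).comp MvPolynomial.C = RingHom.id ℂ := by ext; simp
      rw [this, WeierstrassCurve.map_id]
    change Projective.addXYZ ((W.map MvPolynomial.C).map (MvPolynomial.eval z)) _ _ = _ at this
    rw [hW] at this
    exact (congrFun this i).symm
  refine ⟨2 * (d + d'), 2 * (e + e'), Projective.addXYZ (W.map MvPolynomial.C) X Y, _, _,
    (c * c') * (X k * Y l + MvPolynomial.C (-1) * (X l * Y k)), ?_, (hc.mul hc').mul
      (((hX k).mul (hY l)).add ?_), ?_, ?_⟩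
  · intro i u v x y
    rw [hev, hev]
    have e1 : (fun k => MvPolynomial.eval (Sum.elim (u • x) (v • y)) (X k)) =
        (u ^ d * v ^ e) • (fun k => MvPolynomial.eval (Sum.elim x y) (X k)) := by
      funext k; simp [hX k u v x y]
    have e2 : (fun k => MvPolynomial.eval (Sum.elim (u • x) (v • y)) (Y k)) =
        (u ^ d' * v ^ e') • (fun k => MvPolynomial.eval (Sum.elim x y) (Y k)) := by
      funext k; simp [hY k u v x y]
    rw [e1, e2, Projective.addXYZ_smul]
    simp only [Pi.smul_apply, smul_eq_mul]
    ring
  · intro u v x y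
    have := (hX l).mul (hY k) u v x y
    simp only [map_mul, MvPolynomial.eval_C] at this ⊢
    rw [this]; ring
  · obtain ⟨u, hu, hu'⟩ := h Q hcQ
    obtain ⟨v, hv, hv'⟩ := h' Q hcQ'
    have e1 : ∀ i, MvPolynomial.eval (Sum.elim (homCoord Q.1) (homCoord Q.2)) (X i) =
      u * homCoord (φ Q) i := fun i => congrFun hu' i
    have e2 : ∀ i, MvPolynomial.eval (Sum.elim (homCoord Q.1) (homCoord Q.2)) (Y i) =
      v * homCoord (ψ Q) i := fun i => congrFun hv' i
    have : evalX Q ((c * c') * (X k * Y l + MvPolynomial.C (-1) * (X l * Y k))) =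
        (evalX Q c * evalX Q c') * ((u * v) *
          (homCoord (φ Q) k * homCoord (ψ Q) l - homCoord (φ Q) l * homCoord (ψ Q) k)) := by
      simp only [evalX, map_mul, map_add, e1, e2, MvPolynomial.eval_C]; ring
    rw [this]
    exact mul_ne_zero (mul_ne_zero hcQ hcQ') (mul_ne_zero (mul_ne_zero hu hv) hkl)
  · intro Q' hQ'
    have hc0 : evalX Q' c ≠ 0 := fun h0 => hQ' (by
      simp only [evalX, map_mul] at h0 ⊢; rw [h0]; ring)
    have hc0' : evalX Q' c' ≠ 0 := fun h0 => hQ' (by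
      simp only [evalX, map_mul] at h0 ⊢; rw [h0]; ring)
    obtain ⟨u, hu, hu'⟩ := h Q' hc0
    obtain ⟨v, hv, hv'⟩ := h' Q' hc0'
    have e1 : ∀ i, MvPolynomial.eval (Sum.elim (homCoord Q'.1) (homCoord Q'.2)) (X i) =
      u * homCoord (φ Q') i := fun i => congrFun hu' i
    have e2 : ∀ i, MvPolynomial.eval (Sum.elim (homCoord Q'.1) (homCoord Q'.2)) (Y i) =
      v * homCoord (ψ Q') i := fun i => congrFun hv' i
    have hne' : φ Q' ≠ ψ Q' := by
      intro h0
      apply hQ'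
      simp only [evalX, map_mul, map_add, e1, e2, MvPolynomial.eval_C, h0]; ring
    obtain ⟨w, hw, hw'⟩ := addXYZ_homCoord hne'
    refine ⟨(u * v) ^ 2 * w, mul_ne_zero (pow_ne_zero _ (mul_ne_zero hu hv)) hw, ?_⟩
    have : (fun i => evalX Q' (Projective.addXYZ (W.map MvPolynomial.C) X Y i)) =
        Projective.addXYZ W (u • homCoord (φ Q')) (v • homCoord (ψ Q')) := by
      funext i
      rw [← hu', ← hv']
      exact hev _ i
    rw [this, Projective.addXYZ_smul, hw', smul_smul]


theorem MorphAt.neg {φ : Pt W × Pt W → Pt W} {Q : Pt W × Pt W}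
    (hφ : MorphAt φ Q) : MorphAt (fun Q' => -φ Q') Q := by
  obtain ⟨d, e, X, m, n, c, hX, hc, hcQ, h⟩ := hφ
  let Y : Fin 3 → MvPolynomial (Fin 3 ⊕ Fin 3) ℂ :=
    ![X 0, MvPolynomial.C (-1) * X 1 + MvPolynomial.C (-W.a₁) * X 0 +
      MvPolynomial.C (-W.a₃) * X 2, X 2]
  refine ⟨d, e, Y, m, n, c, ?_, hc, hcQ, fun Q' hQ' => ?_⟩
  · intro k u v x y
    have h0 := hX 0 u v x y
    have h1 := hX 1 u v x y
    have h2 := hX 2 u v x y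
    fin_cases k
    · exact h0
    · simp only [Y, Fin.mk_one, Matrix.cons_val, map_add, map_mul, MvPolynomial.eval_C, h0, h1, h2]
      ring
    · exact h2
  · obtain ⟨u, hu, hu'⟩ := h Q' hQ'
    have e1 : ∀ i, evalX Q' (X i) = u * homCoord (φ Q') i := fun i => congrFun hu' i
    have hy : evalX Q' (Y 1) = -evalX Q' (X 1) - W.a₁ * evalX Q' (X 0) -
        W.a₃ * evalX Q' (X 2) := by
      simp only [Y, evalX, Matrix.cons_val, map_add, map_mul, MvPolynomial.eval_C]; ring
    change ∃ u : ℂ, u ≠ 0 ∧ (fun k => evalX Q' (Y k)) = u • homCoord (-φ Q')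
    generalize φ Q' = P at *
    rcases P with _ | ⟨x, y, hxy⟩
    · refine ⟨-u, neg_ne_zero.mpr hu, ?_⟩
      funext k
      fin_cases k
      · change evalX Q' (X 0) = -u * 0; rw [e1 0]; change u * 0 = -u * 0; ring
      · change evalX Q' (Y 1) = -u * 1; rw [hy, e1 0, e1 1, e1 2]
        change -(u * 1) - W.a₁ * (u * 0) - W.a₃ * (u * 0) = -u * 1; ring
      · change evalX Q' (X 2) = -u * 0; rw [e1 2]; change u * 0 = -u * 0; ring
    · refine ⟨u, hu, ?_⟩
      funext k
      fin_cases k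
      · exact e1 0
      · change evalX Q' (Y 1) = u * (W.toAffine.negY x y); rw [hy, e1 0, e1 1, e1 2]
        change -(u * y) - W.a₁ * (u * x) - W.a₃ * (u * 1) = u * _
        simp only [Affine.negY]; ring
      · exact e1 2

/-- There are points of `C` avoiding `P`, `-P` and the `2`-torsion. -/
theorem exists_generic (P : Pt W) : ∃ T : Pt W, P ≠ T ∧ P ≠ -T ∧ T ≠ -T := by
  classical
  let p : Polynomial ℂ := Polynomial.C 4 * Polynomial.X ^ 3 + Polynomial.C W.b₂ * Polynomial.X ^ 2 +
    Polynomial.C (2 * W.b₄) * Polynomial.X + Polynomial.C W.b₆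
  have hp : p ≠ 0 := by
    intro h0
    have := congrArg (fun q => Polynomial.coeff q 3) h0
    simp [p] at this
  obtain ⟨x, hx⟩ := Infinite.exists_notMem_finset (p.roots.toFinset ∪ {homCoord P 0})
  simp only [Finset.mem_union, Multiset.mem_toFinset, Polynomial.mem_roots hp,
    Finset.mem_singleton, not_or] at hx
  have hpx : 4 * x ^ 3 + W.b₂ * x ^ 2 + 2 * W.b₄ * x + W.b₆ ≠ 0 := by
    have := hx.1
    simpa [p, Polynomial.IsRoot] using this
  obtain ⟨w, hw⟩ := IsAlgClosed.exists_pow_nat_eq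
    (4 * x ^ 3 + W.b₂ * x ^ 2 + 2 * W.b₄ * x + W.b₆) (n := 2) (by norm_num)
  have hw0 : w ≠ 0 := by rintro rfl; exact hpx (by rw [← hw]; norm_num)
  let y := (w - W.a₁ * x - W.a₃) / 2
  have hyw : 2 * y + W.a₁ * x + W.a₃ = w := by simp only [y]; ring
  have heq : W.toAffine.Equation x y := by
    rw [Affine.equation_iff]
    have : (2 * y + W.a₁ * x + W.a₃) ^ 2 = 4 * x ^ 3 + W.b₂ * x ^ 2 + 2 * W.b₄ * x + W.b₆ := by
      rw [hyw, hw]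
    simp only [WeierstrassCurve.b₂, WeierstrassCurve.b₄, WeierstrassCurve.b₆] at this
    linear_combination this / 4
  have hns : W.toAffine.Nonsingular x y := by
    rw [Affine.nonsingular_iff]
    refine ⟨heq, Or.inr ?_⟩
    intro h0
    apply hw0
    rw [← hyw]; linear_combination h0
  have h0 : ∀ P' : Pt W, homCoord P' 0 ≠ x → P' ≠ .some x y hns := by
    rintro P' h rfl; exact h rfl
  refine ⟨.some x y hns, h0 P (fun h => hx.2 h.symm), ?_, ?_⟩
  · rintro rfl
    exact hx.2 rfl
  · rw [Affine.Point.neg_some]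
    intro h
    rw [Affine.Point.some.injEq] at h
    apply hw0
    rw [← hyw]; have := h.2; simp only [Affine.negY] at this; linear_combination this

theorem MorphAt.add {φ ψ : Pt W × Pt W → Pt W} {Q : Pt W × Pt W}
    (hφ : MorphAt φ Q) (hψ : MorphAt ψ Q) : MorphAt (fun Q' => φ Q' + ψ Q') Q := by
  by_cases hne : φ Q = ψ Q
  · obtain ⟨T, h1, h2, h3⟩ := exists_generic (φ Q)
    have a1 := hφ.add_of_ne (morphAt_const T Q) h1
    have a2 := hψ.add_of_ne (morphAt_const (-T) Q) (hne ▸ h2)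
    have := a1.add_of_ne a2 (by
      intro h
      simp only [hne] at h
      exact h3 (add_left_cancel h))
    have e : (fun Q' => φ Q' + T + (ψ Q' + -T)) = fun Q' => φ Q' + ψ Q' := by
      funext Q'; abel
    rwa [e] at this
  · exact hφ.add_of_ne hψ hne

theorem MorphAt.zsmul {φ : Pt W × Pt W → Pt W} {Q : Pt W × Pt W} (hφ : MorphAt φ Q) (a : ℤ) :
    MorphAt (fun Q' => a • φ Q') Q := by
  induction a using Int.induction_on with
  | zero => simpa using morphAt_const 0 Q
  | succ n ih =>
    have e : (fun Q' => ((n : ℤ) + 1) • φ Q') = fun Q' => (n : ℤ) • φ Q' + φ Q' := by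
      funext Q'; rw [add_zsmul, one_zsmul]
    rw [e]; exact ih.add hφ
  | pred n ih =>
    have e : (fun Q' => (-(n : ℤ) - 1) • φ Q') = fun Q' => -(n : ℤ) • φ Q' + -φ Q' := by
      funext Q'; rw [sub_zsmul, one_zsmul]
    rw [e]; exact ih.add hφ.neg

theorem RegularAtC.comp_zsmul {t : Pt W → ℂ} (a b : ℤ) {Q : Pt W × Pt W}
    (ht : RegularAtC t (a • Q.1 + b • Q.2)) :
    RegularAt (fun Q' => t (a • Q'.1 + b • Q'.2)) Q :=
  (((morphAt_fst Q).zsmul a).add ((morphAt_snd Q).zsmul b)).comp_regular ht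

end Geometry

/-! ### The torus and its subgroups -/

section TorusSide

/-- The 2-torus `G`. -/
abbrev Torus : Type := Circle × Circle

/-- The character `(x, y) ↦ x ^ λ * y ^ μ` of the torus. -/
def chi (v : ℤ × ℤ) : Torus →* Circle where
  toFun z := z.1 ^ v.1 * z.2 ^ v.2
  map_one' := by simp
  map_mul' z w := by simp only [Prod.fst_mul, Prod.snd_mul, mul_zpow]; exact mul_mul_mul_comm _ _ _ _

theorem chi_apply (v : ℤ × ℤ) (z : Torus) : chi v z = z.1 ^ v.1 * z.2 ^ v.2 := rfl

theorem chi_add (v w : ℤ × ℤ) (z : Torus) : chi (v + w) z = chi v z * chi w z := by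
  simp only [chi_apply, Prod.fst_add, Prod.snd_add, zpow_add]; exact mul_mul_mul_comm _ _ _ _

theorem chi_smul (n : ℤ) (v : ℤ × ℤ) (z : Torus) : chi (n • v) z = chi v z ^ n := by
  simp only [chi_apply, Prod.smul_fst, Prod.smul_snd, smul_eq_mul, mul_zpow, mul_comm n, zpow_mul]

/-- The characters of the torus that are trivial on `K`: the character group of `G/K`. -/
def perp (K : Subgroup Torus) : Submodule ℤ (ℤ × ℤ) where
  carrier := {v | ∀ z ∈ K, chi v z = 1}
  zero_mem' := by intro z _; simp [chi_apply]
  add_mem' := by intro v w hv hw z hz; rw [chi_add, hv z hz, hw z hz, one_mul]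
  smul_mem' := by intro n v hv z hz; rw [chi_smul, hv z hz, one_zpow]

theorem perp_anti {K L : Subgroup Torus} (h : K ≤ L) : perp L ≤ perp K :=
  fun _ hv z hz => hv z (h hz)

/-- The index set of the directions: a connected closed subgroup of codimension one is the kernel
of exactly one character with exponents `(λ, μ)` such that `λ`, `μ` are coprime and
`μ > 0` or `(λ, μ) = (1, 0)`. -/
def Dir : Type := {v : ℤ × ℤ // IsCoprime v.1 v.2 ∧ (0 < v.2 ∨ v = (1, 0))}

/-- The exponents of the character `z_i`. -/
def Dir.vec (i : Dir) : ℤ × ℤ := i.1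

/-- The subgroup `H_i^j`, with identity component `H_i` and `j` components: the kernel of
`z_i ^ j`. -/
def Hsub (i : Dir) (j : ℕ+) : Subgroup Torus := (chi ((j : ℤ) • i.vec)).ker

theorem mem_Hsub {i : Dir} {j : ℕ+} {z : Torus} : z ∈ Hsub i j ↔ chi i.vec z ^ (j : ℕ) = 1 := by
  rw [Hsub, MonoidHom.mem_ker, chi_smul]; simp

/-- The finite subgroups of the torus. -/
def FinSub : Type := {F : Subgroup Torus // Finite F}

theorem FinSub.finite_map (F : FinSub) (i : Dir) : Finite (F.1.map (chi i.vec)) := by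
  have := F.2
  have : (F.1 : Set Torus).Finite := Set.toFinite _
  exact (this.image (chi i.vec)).to_subtype

/-- The number `n_i(F)`, see `FinSub.sup_Hsub`. -/
def nIdx (F : FinSub) (i : Dir) : ℕ+ :=
  ⟨Nat.card (F.1.map (chi i.vec)), by
    have := F.finite_map i
    exact Nat.card_pos⟩

theorem FinSub.le_Hsub (F : FinSub) (i : Dir) : F.1 ≤ Hsub i (nIdx F i) := by
  intro z hz
  rw [mem_Hsub]
  have h := pow_card_eq_one' (x := (⟨chi i.vec z, z, hz, rfl⟩ : F.1.map (chi i.vec)))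
  exact congrArg Subtype.val h

theorem finite_subgroup_circle (K : Subgroup Circle) [Finite K] (x : Circle)
    (hx : x ^ Nat.card K = 1) : x ∈ K := by
  classical
  have hpos : 0 < Nat.card K := Nat.card_pos
  have := Fintype.ofFinite K
  let s : Finset ℂ := Finset.univ.image (fun k : K => ((k : Circle) : ℂ))
  have hs : s.card = Nat.card K := by
    rw [Finset.card_image_of_injective, Finset.card_univ, Nat.card_eq_fintype_card]
    intro a b h
    exact Subtype.ext (Circle.ext h)
  have hsub : s ⊆ Polynomial.nthRootsFinset (Nat.card K) (1 : ℂ) := by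
    intro z hz
    obtain ⟨k, -, rfl⟩ := Finset.mem_image.mp hz
    rw [Polynomial.mem_nthRootsFinset hpos]
    have h : ((k : Circle) : ℂ) ^ Nat.card K = 1 := by
      rw [← Circle.coe_pow, ← Subgroup.coe_pow, pow_card_eq_one']; rfl
    exact h
  have heq : s = Polynomial.nthRootsFinset (Nat.card K) (1 : ℂ) := by
    apply Finset.eq_of_subset_of_card_le hsub
    rw [hs, Polynomial.nthRootsFinset]
    exact (Multiset.toFinset_card_le _).trans (Polynomial.card_nthRoots _ _)
  have hxs : (x : ℂ) ∈ s := by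
    rw [heq, Polynomial.mem_nthRootsFinset hpos]
    simpa using congrArg (fun z : Circle => (z : ℂ)) hx
  obtain ⟨k, -, hk⟩ := Finset.mem_image.mp hxs
  rw [← Circle.ext hk]
  exact k.2

/-- `F` and `H_i` generate `H_i ^ n_i(F)`. -/
theorem FinSub.sup_Hsub (F : FinSub) (i : Dir) : F.1 ⊔ Hsub i 1 = Hsub i (nIdx F i) := by
  apply le_antisymm
  · refine sup_le (F.le_Hsub i) fun z hz => ?_
    rw [mem_Hsub] at hz ⊢
    simp only [PNat.one_coe, pow_one] at hz
    rw [hz, one_pow]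
  · intro z hz
    have := F.finite_map i
    have h1 : chi i.vec z ∈ F.1.map (chi i.vec) := by
      apply finite_subgroup_circle
      exact mem_Hsub.mp hz
    obtain ⟨w, hw, hwz⟩ := h1
    have : z = w * (w⁻¹ * z) := by group
    rw [this]
    refine Subgroup.mul_mem_sup hw ?_
    rw [mem_Hsub]
    simp [hwz]

/-! ### Lattices of characters -/

/-- The point with angles `2πa`, `2πb`. -/
def angle (a b : ℝ) : Torus := (Circle.exp (2 * Real.pi * a), Circle.exp (2 * Real.pi * b))

theorem circle_exp_zpow (x : ℝ) (n : ℤ) : Circle.exp x ^ n = Circle.exp (n * x) := by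
  rw [← Circle.exp_zsmul]; simp

theorem chi_angle (v : ℤ × ℤ) (a b : ℝ) :
    chi v (angle a b) = Circle.exp (2 * Real.pi * (v.1 * a + v.2 * b)) := by
  rw [chi_apply, angle, circle_exp_zpow, circle_exp_zpow, ← Circle.exp_add]
  congr 1; ring

theorem circle_exp_eq_one_iff (x : ℝ) :
    Circle.exp (2 * Real.pi * x) = 1 ↔ ∃ n : ℤ, x = n := by
  rw [Circle.exp_eq_one]
  have h := Real.two_pi_pos.ne'
  constructor
  · rintro ⟨n, hn⟩
    exact ⟨n, mul_left_cancel₀ h (by rw [hn]; ring)⟩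
  · rintro ⟨n, rfl⟩
    exact ⟨n, by ring⟩

theorem perp_inf {v w : ℤ × ℤ} (hd : v.1 * w.2 - v.2 * w.1 ≠ 0) {u : ℤ × ℤ}
    (hu : u ∈ perp ((chi v).ker ⊓ (chi w).ker)) : ∃ k l : ℤ, u = k • v + l • w := by
  obtain ⟨e, he⟩ : ∃ e : ℝ, (v.1 * w.2 - v.2 * w.1 : ℝ) * e = 1 :=
    ⟨_, mul_inv_cancel₀ (by exact_mod_cast hd)⟩
  have key : ∀ a b : ℤ, ∃ n : ℤ, u.1 * ((a * w.2 - b * v.2) * e) +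
      u.2 * ((b * v.1 - a * w.1) * e) = n := by
    intro a b
    rw [← circle_exp_eq_one_iff, ← chi_angle]
    refine hu _ (Subgroup.mem_inf.mpr ⟨?_, ?_⟩)
    · rw [MonoidHom.mem_ker, chi_angle, circle_exp_eq_one_iff]
      exact ⟨a, by linear_combination a * he⟩
    · rw [MonoidHom.mem_ker, chi_angle, circle_exp_eq_one_iff]
      exact ⟨b, by linear_combination b * he⟩
  obtain ⟨k, hk⟩ := key 1 0
  obtain ⟨l, hl⟩ := key 0 1
  push_cast at hk hl
  refine ⟨k, l, ?_⟩
  have e1 : (u.1 : ℝ) = k * v.1 + l * w.1 := by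
    rw [← hk, ← hl]; linear_combination (-(u.1 : ℝ)) * he
  have e2 : (u.2 : ℝ) = k * v.2 + l * w.2 := by
    rw [← hk, ← hl]; linear_combination (-(u.2 : ℝ)) * he
  apply Prod.ext
  · simp only [Prod.fst_add, Prod.smul_fst, smul_eq_mul]; exact_mod_cast e1
  · simp only [Prod.snd_add, Prod.smul_snd, smul_eq_mul]; exact_mod_cast e2

theorem perp_ker {v : ℤ × ℤ} (hv : v ≠ 0) {u : ℤ × ℤ} (hu : u ∈ perp (chi v).ker) :
    ∃ k : ℤ, u = k • v := by
  have hd : (v.1 * v.1 + v.2 * v.2 : ℤ) ≠ 0 := by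
    intro h
    apply hv
    have h1 : v.1 = 0 := by nlinarith [mul_self_nonneg v.1, mul_self_nonneg v.2]
    have h2 : v.2 = 0 := by nlinarith [mul_self_nonneg v.1, mul_self_nonneg v.2]
    exact Prod.ext h1 h2
  obtain ⟨e, he⟩ : ∃ e : ℝ, (v.1 * v.1 + v.2 * v.2 : ℝ) * e = 1 :=
    ⟨_, mul_inv_cancel₀ (by exact_mod_cast hd)⟩
  have key : ∀ (a : ℤ) (s : ℝ), ∃ n : ℤ, u.1 * ((a * v.1 - s * v.2) * e) +
      u.2 * ((a * v.2 + s * v.1) * e) = n := by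
    intro a s
    rw [← circle_exp_eq_one_iff, ← chi_angle]
    refine hu _ ?_
    rw [MonoidHom.mem_ker, chi_angle, circle_exp_eq_one_iff]
    exact ⟨a, by linear_combination a * he⟩
  have hdet : (u.2 * v.1 - u.1 * v.2 : ℝ) = 0 := by
    by_contra h
    obtain ⟨f, hf⟩ : ∃ f : ℝ, (u.2 * v.1 - u.1 * v.2 : ℝ) * f = 1 := ⟨_, mul_inv_cancel₀ h⟩
    obtain ⟨n, hn⟩ := key 0 ((v.1 * v.1 + v.2 * v.2) * f / 2)
    push_cast at hn
    have : (2 * n : ℝ) = 1 := by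
      rw [← hn]
      linear_combination (f * (u.2 * v.1 - u.1 * v.2)) * he + hf
    have h2 : (2 * n : ℤ) = 1 := by exact_mod_cast this
    omega
  obtain ⟨k, hk⟩ := key 1 0
  push_cast at hk
  refine ⟨k, ?_⟩
  have e1 : (u.1 : ℝ) = k * v.1 := by
    rw [← hk]; linear_combination (-(u.1 : ℝ)) * he - e * v.2 * hdet
  have e2 : (u.2 : ℝ) = k * v.2 := by
    rw [← hk]; linear_combination (-(u.2 : ℝ)) * he + e * v.1 * hdet
  apply Prod.ext
  · simp only [Prod.smul_fst, smul_eq_mul]; exact_mod_cast e1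
  · simp only [Prod.smul_snd, smul_eq_mul]; exact_mod_cast e2

theorem Dir.vec_ne_zero (i : Dir) : i.vec ≠ 0 := by
  intro h
  have h1 := i.2.1
  change IsCoprime i.vec.1 i.vec.2 at h1
  rw [h] at h1
  exact not_isCoprime_zero_zero h1

theorem Dir.det_ne_zero {i k : Dir} (h : i ≠ k) :
    i.vec.1 * k.vec.2 - i.vec.2 * k.vec.1 ≠ 0 := by
  obtain ⟨⟨a, b⟩, hab, h1⟩ := i
  obtain ⟨⟨c, d⟩, hcd, h2⟩ := k
  intro hdet
  apply h
  simp only [Dir.vec] at *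
  have hdet' : a * d = b * c := by linarith
  rcases h1 with hb | h1 <;> rcases h2 with hd | h2
  · have hbd : b ∣ d := hab.symm.dvd_of_dvd_mul_left ⟨c, hdet'⟩
    have hdb : d ∣ b := hcd.symm.dvd_of_dvd_mul_right ⟨a, by linarith⟩
    have e : b = d := Int.dvd_antisymm hb.le hd.le hbd hdb
    subst e
    have : a = c := by
      apply mul_right_cancel₀ hb.ne'; linarith
    subst this; rfl
  · simp only [Prod.mk.injEq] at h2
    obtain ⟨rfl, rfl⟩ := h2; exfalso; linarith
  · simp only [Prod.mk.injEq] at h1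
    obtain ⟨rfl, rfl⟩ := h1; exfalso; linarith
  · exact Subtype.ext (h1.trans h2.symm)

/-- The character `z_i ^ j` is a basis of the character group of `G/H_i^j`. -/
def basisH (i : Dir) (j : ℕ+) : Module.Basis (Fin 1) ℤ (perp (Hsub i j)) :=
  Module.Basis.mk (v := fun _ => ⟨(j : ℤ) • i.vec, fun _ hz => hz⟩)
    (by
      rw [linearIndependent_unique_iff]
      intro h
      have h' := congrArg Subtype.val h
      have hj : (j : ℤ) ≠ 0 := by positivity
      exact (smul_ne_zero hj i.vec_ne_zero) h')
    (by
      rintro ⟨u, hu⟩ -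
      obtain ⟨k, rfl⟩ := perp_ker (smul_ne_zero (by positivity) i.vec_ne_zero) hu
      exact Submodule.smul_mem _ k (Submodule.subset_span (Set.mem_range_self (0 : Fin 1))))

/-- A choice, for every finite subgroup `F`, of two distinct directions `A`, `B` with
`F = H_A ^ n_A ∩ H_B ^ n_B`. -/
structure Splitting where
  A : FinSub → Dir
  B : FinSub → Dir
  ne : ∀ F, A F ≠ B F
  eq_inf : ∀ F : FinSub, F.1 = Hsub (A F) (nIdx F (A F)) ⊓ Hsub (B F) (nIdx F (B F))

theorem mem_perp_F (F : FinSub) (i : Dir) : ((nIdx F i : ℕ+) : ℤ) • i.vec ∈ perp F.1 :=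
  fun _ hz => F.le_Hsub i hz

theorem Splitting.det (σ : Splitting) (F : FinSub) :
    (((nIdx F (σ.A F) : ℕ+) : ℤ) • (σ.A F).vec).1 * (((nIdx F (σ.B F) : ℕ+) : ℤ) • (σ.B F).vec).2 -
    (((nIdx F (σ.A F) : ℕ+) : ℤ) • (σ.A F).vec).2 * (((nIdx F (σ.B F) : ℕ+) : ℤ) • (σ.B F).vec).1
      ≠ 0 := by
  have h : ((nIdx F (σ.A F) : ℕ+) : ℤ) * ((nIdx F (σ.B F) : ℕ+) : ℤ) *
    ((σ.A F).vec.1 * (σ.B F).vec.2 - (σ.A F).vec.2 * (σ.B F).vec.1) ≠ 0 :=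
    mul_ne_zero (by positivity) (Dir.det_ne_zero (σ.ne F))
  intro h0
  apply h
  simp only [Prod.smul_fst, Prod.smul_snd, smul_eq_mul] at h0
  linear_combination h0

/-- The characters `z_A ^ n_A`, `z_B ^ n_B` form a basis of the characters of `G/F`. -/
def basisF (σ : Splitting) (F : FinSub) : Module.Basis (Fin 2) ℤ (perp F.1) :=
  Module.Basis.mk (v := ![⟨_, mem_perp_F F (σ.A F)⟩, ⟨_, mem_perp_F F (σ.B F)⟩])
    (by
      rw [LinearIndependent.pair_iff]
      intro s t hst
      have h' := congrArg Subtype.val hst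
      have h1 := congrArg Prod.fst h'
      have h2 := congrArg Prod.snd h'
      have hd := σ.det F
      simp only [Submodule.coe_add, Submodule.coe_smul, Prod.fst_add, Prod.snd_add, Prod.smul_fst,
        Prod.smul_snd, smul_eq_mul, ZeroMemClass.coe_zero, Prod.fst_zero, Prod.snd_zero] at h1 h2 hd
      constructor
      · refine (mul_eq_zero.mp ?_).resolve_right hd
        linear_combination (((nIdx F (σ.B F) : ℕ+) : ℤ) * (σ.B F).vec.2) * h1 -
          (((nIdx F (σ.B F) : ℕ+) : ℤ) * (σ.B F).vec.1) * h2
      · refine (mul_eq_zero.mp ?_).resolve_right hd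
        linear_combination (((nIdx F (σ.A F) : ℕ+) : ℤ) * (σ.A F).vec.1) * h2 -
          (((nIdx F (σ.A F) : ℕ+) : ℤ) * (σ.A F).vec.2) * h1)
    (by
      rintro ⟨u, hu⟩ -
      have hu' := hu
      rw [σ.eq_inf F] at hu'
      obtain ⟨k, l, h⟩ := perp_inf (σ.det F) hu'
      have : (⟨u, hu⟩ : perp F.1) = k • (⟨_, mem_perp_F F (σ.A F)⟩ : perp F.1) +
          l • (⟨_, mem_perp_F F (σ.B F)⟩ : perp F.1) := Subtype.ext h
      rw [this]
      exact add_mem (Submodule.smul_mem _ k (Submodule.subset_span ⟨0, rfl⟩))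
        (Submodule.smul_mem _ l (Submodule.subset_span ⟨1, rfl⟩)))

end TorusSide

/-! ### The subvarieties attached to subgroups -/

section Subvarieties

/-- `𝔛(K) = Hom(K^*, C)` as a subset of `𝔛(G) = C × C`, where `K^* = ℤ² / K^⊥`. -/
def frakX (W : WeierstrassCurve ℂ) (K : Subgroup Torus) : Set (Pt W × Pt W) :=
  {Q | ∀ v ∈ perp K, v.1 • Q.1 + v.2 • Q.2 = 0}

/-- `𝔛(H)` without all `𝔛(K)`, where `K` runs through the proper closed subgroups of finite
index. -/
def Xbar (W : WeierstrassCurve ℂ) (H : Subgroup Torus) : Set (Pt W × Pt W) :=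
  frakX W H \ ⋃ K ∈ {K : Subgroup Torus | IsClosed (K : Set Torus) ∧ K < H ∧
    (K.subgroupOf H).FiniteIndex}, frakX W K

/-- The projection `π_i` of the direction `i`. -/
def proj {W : WeierstrassCurve ℂ} (i : Dir) (Q : Pt W × Pt W) : Pt W :=
  i.vec.1 • Q.1 + i.vec.2 • Q.2

/-- The divisor `D_ij`, for `s = (i, j)`. -/
def Dset (W : WeierstrassCurve ℂ) (s : Dir × ℕ+) : Set (Pt W × Pt W) := Xbar W (Hsub s.1 s.2)

/-- Finite unions of the divisors `D_ij`. -/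
def Dunion (W : WeierstrassCurve ℂ) (S : Finset (Dir × ℕ+)) : Set (Pt W × Pt W) :=
  ⋃ s ∈ S, Dset W s

variable {W : WeierstrassCurve ℂ}

theorem zsmul_vec (n : ℤ) (i : Dir) (Q : Pt W × Pt W) :
    (n • i.vec).1 • Q.1 + (n • i.vec).2 • Q.2 = n • proj i Q := by
  simp only [proj, Prod.smul_fst, Prod.smul_snd, smul_eq_mul, mul_zsmul, zsmul_add]

theorem circle_divisible (z : Circle) {n : ℕ} (hn : n ≠ 0) : ∃ w : Circle, w ^ n = z := by
  obtain ⟨x, hx⟩ := Circle.exp_surjective z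
  refine ⟨Circle.exp (x / n), ?_⟩
  rw [← Circle.exp_nsmul, ← hx]
  congr 1
  simp; field_simp

theorem Hsub_one_le {i : Dir} {m : ℕ+} {K : Subgroup Torus}
    (h : (K.subgroupOf (Hsub i m)).FiniteIndex) : Hsub i 1 ≤ K := by
  intro z hz
  rw [mem_Hsub] at hz
  simp only [PNat.one_coe, pow_one, chi_apply] at hz
  obtain ⟨u, v, huv⟩ : IsCoprime i.vec.1 i.vec.2 := i.2.1
  obtain ⟨c, hc⟩ := circle_divisible (z.1 ^ (-v) * z.2 ^ u) h.index_ne_zero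
  have hw : ∀ a b : ℤ, z.1 ^ (i.vec.1 * a + b) * z.2 ^ (i.vec.2 * a) = z.1 ^ b := by
    intro a b
    rw [zpow_add, zpow_mul, zpow_mul, mul_right_comm, ← mul_zpow, hz, one_zpow, one_mul]
  have hw' : ∀ a b : ℤ, z.1 ^ (i.vec.1 * a) * z.2 ^ (i.vec.2 * a + b) = z.2 ^ b := by
    intro a b
    rw [zpow_add, zpow_mul, zpow_mul, ← mul_assoc, ← mul_zpow, hz, one_zpow, one_mul]
  let y : Torus := (c ^ (-i.vec.2), c ^ i.vec.1)
  have hy : y ∈ Hsub i m := by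
    rw [mem_Hsub, chi_apply, ← zpow_mul, ← zpow_mul, ← zpow_add]
    have : -i.vec.2 * i.vec.1 + i.vec.1 * i.vec.2 = 0 := by ring
    rw [this, zpow_zero, one_pow]
  have hyz : y ^ (K.subgroupOf (Hsub i m)).index = z := by
    apply Prod.ext
    · change (c ^ (-i.vec.2)) ^ _ = _
      rw [← zpow_natCast, zpow_comm, zpow_natCast, hc, mul_zpow, ← zpow_mul, ← zpow_mul]
      have := hw (-u) 1
      rw [zpow_one] at this
      rw [← this]
      congr 2
      · linear_combination huv
      · ring
    · change (c ^ (i.vec.1)) ^ _ = _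
      rw [← zpow_natCast, zpow_comm, zpow_natCast, hc, mul_zpow, ← zpow_mul, ← zpow_mul]
      have := hw' (-v) 1
      rw [zpow_one] at this
      rw [← this]
      congr 2
      · ring
      · linear_combination huv
  have := Subgroup.pow_index_mem (K.subgroupOf (Hsub i m)) (⟨y, hy⟩ : Hsub i m)
  rw [Subgroup.mem_subgroupOf] at this
  rw [← hyz]
  exact this

theorem mem_Dset {i : Dir} {m : ℕ+} {Q : Pt W × Pt W} (h : addOrderOf (proj i Q) = m) :
    Q ∈ Dset W (i, m) := by
  constructor
  · intro v hv
    obtain ⟨k, rfl⟩ := perp_ker (smul_ne_zero (by positivity) i.vec_ne_zero) hv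
    rw [smul_smul, zsmul_vec, mul_comm, mul_zsmul]
    have : ((m : ℕ) : ℤ) • proj i Q = 0 := by
      rw [natCast_zsmul, ← h]; exact addOrderOf_nsmul_eq_zero _
    rw [zsmul_comm, this, zsmul_zero]
  · simp only [Set.mem_iUnion, Set.mem_ofPred_eq, not_exists]
    rintro K ⟨-, hlt, hfin⟩ hQ
    have hH := Hsub_one_le hfin
    let L := K.map (chi i.vec)
    have hL : ∀ x ∈ L, x ^ (m : ℕ) = 1 := by
      rintro _ ⟨z, hz, rfl⟩
      exact mem_Hsub.mp (hlt.le hz)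
    have hfinL : Finite L := by
      refine Set.Finite.to_subtype (Set.Finite.subset (Set.Finite.preimage
        (Circle.coe_injective.injOn) (Polynomial.nthRootsFinset (m : ℕ) (1 : ℂ)).finite_toSet)
        fun x hx => ?_)
      rw [Set.mem_preimage, Finset.mem_coe, Polynomial.mem_nthRootsFinset m.pos]
      exact congrArg (fun z : Circle => (z : ℂ)) (hL x hx)
    have hcyc : IsCyclic L := isCyclic_of_injective_ringHom ((Circle.coeHom).comp L.subtype)
      (Circle.coe_injective.comp Subtype.val_injective)
    obtain ⟨g, hg⟩ := hcyc.exists_generator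
    have h1 : Nat.card L ∣ (m : ℕ) := by
      rw [← orderOf_eq_card_of_forall_mem_zpowers hg, orderOf_dvd_iff_pow_eq_one]
      exact Subtype.ext (hL g g.2)
    have h2 : (m : ℕ) ∣ Nat.card L := by
      rw [← h, addOrderOf_dvd_iff_nsmul_eq_zero, ← natCast_zsmul, ← zsmul_vec]
      apply hQ
      intro z hz
      rw [chi_smul, zpow_natCast]
      exact congrArg Subtype.val (pow_card_eq_one' (x := (⟨chi i.vec z, z, hz, rfl⟩ : L)))
    have h3 := Nat.dvd_antisymm h1 h2
    apply hlt.not_ge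
    intro z hz
    obtain ⟨w, hw, hwz⟩ := finite_subgroup_circle L (chi i.vec z) (by
      rw [h3]; exact mem_Hsub.mp hz)
    have : z = w * (w⁻¹ * z) := by group
    rw [this]
    refine K.mul_mem hw (hH ?_)
    rw [mem_Hsub]
    simp [hwz]

theorem proj_eq_zero {i : Dir} {n : ℕ+} {H : Subgroup Torus} {Q : Pt W × Pt W}
    (hH : H ≤ Hsub i n) (hQ : Q ∈ Xbar W H) : (n : ℕ) • proj i Q = 0 := by
  have h := hQ.1 (((n : ℕ) : ℤ) • i.vec) (fun z hz => hH hz)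
  rw [zsmul_vec] at h
  rwa [← natCast_zsmul]

end Subvarieties

section Rings

variable {W : WeierstrassCurve ℂ}

/-! ### The ring of functions with poles along the divisors -/

/-- Functions that vanish outside a finite union of divisors `D_ij`. -/
def nullIdeal (W : WeierstrassCurve ℂ) : Ideal (Pt W × Pt W → ℂ) where
  carrier := {g | ∃ S, ∀ Q ∉ Dunion W S, g Q = 0}
  zero_mem' := ⟨∅, fun _ _ => rfl⟩
  add_mem' := by
    classical
    rintro g h ⟨S, hS⟩ ⟨T, hT⟩
    refine ⟨S ∪ T, fun Q hQ => ?_⟩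
    simp only [Dunion, Set.mem_iUnion, Finset.mem_union, not_exists] at hQ hS hT
    rw [Pi.add_apply, hS Q (fun s hs => hQ s (Or.inl hs)), hT Q (fun s hs => hQ s (Or.inr hs)),
      add_zero]
  smul_mem' := by
    rintro c g ⟨S, hS⟩
    exact ⟨S, fun Q hQ => by rw [smul_eq_mul, Pi.mul_apply, hS Q hQ, mul_zero]⟩

/-- Functions on `C × C`, two of them being identified if they agree outside a finite union of
divisors `D_ij`. -/
abbrev GermX (W : WeierstrassCurve ℂ) : Type := (Pt W × Pt W → ℂ) ⧸ nullIdeal W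

/-- `g` is a regular function outside the divisors in `S`. -/
def RegOff (g : Pt W × Pt W → ℂ) (S : Finset (Dir × ℕ+)) : Prop :=
  ∀ Q ∉ Dunion W S, RegularAt g Q

theorem Dunion_mono {S T : Finset (Dir × ℕ+)} (h : S ⊆ T) : Dunion W S ⊆ Dunion W T :=
  Set.biUnion_subset_biUnion_left h

theorem RegOff.mono {g : Pt W × Pt W → ℂ} {S T : Finset (Dir × ℕ+)} (hg : RegOff g S)
    (h : S ⊆ T) : RegOff g T := fun Q hQ => hg Q (fun h' => hQ (Dunion_mono h h'))

/-- The colimit of the rings of regular functions on the complements of the finite unions of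
divisors `D_s`, `s ∈ A`. -/
def sections (W : WeierstrassCurve ℂ) (A : Set (Dir × ℕ+)) : Subalgebra ℂ (GermX W) where
  carrier := {x | ∃ (g : Pt W × Pt W → ℂ) (S : Finset (Dir × ℕ+)), ↑S ⊆ A ∧ RegOff g S ∧
    Ideal.Quotient.mk (nullIdeal W) g = x}
  mul_mem' := by
    classical
    rintro _ _ ⟨g, S, hS, hg, rfl⟩ ⟨h, T, hT, hh, rfl⟩
    exact ⟨g * h, S ∪ T, by simp [hS, hT], fun Q hQ =>
      (hg.mono Finset.subset_union_left Q hQ).mul (hh.mono Finset.subset_union_right Q hQ),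
      map_mul _ _ _⟩
  add_mem' := by
    classical
    rintro _ _ ⟨g, S, hS, hg, rfl⟩ ⟨h, T, hT, hh, rfl⟩
    exact ⟨g + h, S ∪ T, by simp [hS, hT], fun Q hQ =>
      (hg.mono Finset.subset_union_left Q hQ).add (hh.mono Finset.subset_union_right Q hQ),
      map_add _ _ _⟩
  algebraMap_mem' := fun c => ⟨fun _ => c, ∅, by simp, fun Q _ => regularAt_const c Q, rfl⟩

theorem sections_mono {A B : Set (Dir × ℕ+)} (h : A ⊆ B) : sections W A ≤ sections W B := by
  rintro _ ⟨g, S, hS, hg, rfl⟩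
  exact ⟨g, S, hS.trans h, hg, rfl⟩

/-- The ring `𝒦` of the functions on `C × C` that are allowed poles only along divisors `D_ij`. -/
def KK (W : WeierstrassCurve ℂ) : Type := sections W Set.univ

instance : CommRing (KK W) := inferInstanceAs (CommRing (sections W Set.univ))

instance : Algebra ℂ (KK W) := inferInstanceAs (Algebra ℂ (sections W Set.univ))

/-- The inclusion of `𝒦` into the germs of functions. -/
def KK.val (W : WeierstrassCurve ℂ) : KK W →ₐ[ℂ] GermX W := (sections W Set.univ).val

/-- The subring of `𝒦` of those functions that are allowed poles only along the divisors
`D_s`, `s ∈ A`. -/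
def OO (W : WeierstrassCurve ℂ) (A : Set (Dir × ℕ+)) : Subalgebra ℂ (KK W) :=
  (sections W A).comap (KK.val W)

instance (A : Set (Dir × ℕ+)) : CommRing (OO W A) := Subalgebra.toCommRing _

instance (A : Set (Dir × ℕ+)) : Algebra ℂ (OO W A) := Subalgebra.algebra _

instance (A : Set (Dir × ℕ+)) : Module (OO W A) (KK W) :=
  Module.compHom (KK W) (OO W A).val.toRingHom

/-- The ideal of the functions that vanish along `Z`. -/
def vanIdeal (W : WeierstrassCurve ℂ) (A : Set (Dir × ℕ+)) (Z : Set (Pt W × Pt W)) :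
    Ideal (OO W A) where
  carrier := {x | ∃ (g : Pt W × Pt W → ℂ) (S : Finset (Dir × ℕ+)), ↑S ⊆ A ∧ RegOff g S ∧
    Ideal.Quotient.mk (nullIdeal W) g = KK.val W x ∧ ∀ Q ∈ Z, Q ∉ Dunion W S → g Q = 0}
  zero_mem' := ⟨0, ∅, by simp, fun Q _ => regularAt_const 0 Q, map_zero _, fun _ _ _ => rfl⟩
  add_mem' := by
    classical
    rintro x y ⟨g, S, hS, hg, hgx, hgZ⟩ ⟨h, T, hT, hh, hhy, hhZ⟩
    refine ⟨g + h, S ∪ T, by simp [hS, hT], fun Q hQ =>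
      (hg.mono Finset.subset_union_left Q hQ).add (hh.mono Finset.subset_union_right Q hQ), ?_, ?_⟩
    · rw [map_add, hgx, hhy]; rfl
    · intro Q hQ hQ'
      rw [Pi.add_apply, hgZ Q hQ fun h' => hQ' (Dunion_mono Finset.subset_union_left h'),
        hhZ Q hQ fun h' => hQ' (Dunion_mono Finset.subset_union_right h'), add_zero]
  smul_mem' := by
    classical
    rintro ⟨c, h, T, hT, hh, hhy⟩ x ⟨g, S, hS, hg, hgx, hgZ⟩
    refine ⟨h * g, S ∪ T, by simp [hS, hT], fun Q hQ =>
      (hh.mono Finset.subset_union_right Q hQ).mul (hg.mono Finset.subset_union_left Q hQ), ?_, ?_⟩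
    · rw [map_mul]; exact congrArg₂ (· * ·) hhy hgx
    · intro Q hQ hQ'
      rw [Pi.mul_apply, hgZ Q hQ fun h' => hQ' (Dunion_mono Finset.subset_union_left h'), mul_zero]

/-- All divisors but `D_ij`. -/
def offD (i : Dir) (j : ℕ+) : Set (Dir × ℕ+) := {s | s ≠ (i, j)}

/-- All divisors but those that contain the points of `Xbar F`. -/
def offF (F : FinSub) : Set (Dir × ℕ+) := {s | s.2 ≠ nIdx F s.1}

/-- The ring `𝒪_{D_ij}` of the functions regular at `D_ij`. -/
abbrev OD (W : WeierstrassCurve ℂ) (i : Dir) (j : ℕ+) : Subalgebra ℂ (KK W) := OO W (offD i j)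

/-- The ideal `m_ij` of the functions vanishing at `D_ij`. -/
def mD (W : WeierstrassCurve ℂ) (i : Dir) (j : ℕ+) : Ideal (OD W i j) :=
  vanIdeal W (offD i j) (Dset W (i, j))

/-- The ring `𝒪_F` of the functions regular at the points of `Xbar F`. -/
abbrev OF (W : WeierstrassCurve ℂ) (F : FinSub) : Subalgebra ℂ (KK W) := OO W (offF F)

/-- The ideal `m_F` of the functions vanishing at the points of `Xbar F`. -/
def mF (W : WeierstrassCurve ℂ) (F : FinSub) : Ideal (OF W F) :=
  vanIdeal W (offF F) (Xbar W F.1)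

/-! ### Coordinates -/

/-- Functions on `C` that are regular at `P`. -/
def RegC (W : WeierstrassCurve ℂ) (P : Pt W) : Subalgebra ℂ (Pt W → ℂ) where
  carrier := {g | RegularAtC g P}
  mul_mem' := RegularAtC.mul
  add_mem' := RegularAtC.add
  algebraMap_mem' := fun c => regularAtC_const c P

/-- `g` is regular at `P` and vanishes there to order at least `n`. -/
def VanishC (P : Pt W) (n : ℕ) (g : Pt W → ℂ) : Prop :=
  ∃ h ∈ (RingHom.ker ((Pi.evalRingHom (fun _ : Pt W => ℂ) P).comp
    (RegC W P).val.toRingHom)) ^ n, (h : Pt W → ℂ) = g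

/-- Functions on `C × C` that are regular at `Q`. -/
def RegX (W : WeierstrassCurve ℂ) (Q : Pt W × Pt W) : Subalgebra ℂ (Pt W × Pt W → ℂ) where
  carrier := {g | RegularAt g Q}
  mul_mem' := RegularAt.mul
  add_mem' := RegularAt.add
  algebraMap_mem' := fun c => regularAt_const c Q

/-- `g` is regular at `Q` and vanishes there to order at least `n`. -/
def VanishX (Q : Pt W × Pt W) (n : ℕ) (g : Pt W × Pt W → ℂ) : Prop :=
  ∃ h ∈ (RingHom.ker ((Pi.evalRingHom (fun _ : Pt W × Pt W => ℂ) Q).comp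
    (RegX W Q).val.toRingHom)) ^ n, (h : Pt W × Pt W → ℂ) = g

/-- `t` is a coordinate of `C` at the origin: it vanishes there to first order, and its poles
lie at points of finitely many finite orders. -/
structure IsCoordinate (W : WeierstrassCurve ℂ) (t : Pt W → ℂ) : Prop where
  regular : ∃ S : Finset ℕ+, 1 ∉ S ∧ ∀ P : Pt W, (∀ n ∈ S, addOrderOf P ≠ n) → RegularAtC t P
  zero : t 0 = 0
  first_order : ¬ VanishC 0 2 t

/-- `Fg` is the expansion of `t (P + R)` in `t P`, `t R` at the origin of `C × C`. -/
def IsFormalGroupLaw (W : WeierstrassCurve ℂ) (t : Pt W → ℂ) (Fg : MvPowerSeries (Fin 2) ℂ) :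
    Prop :=
  ∀ n : ℕ, VanishX (W := W) (0, 0) n fun Q => t (Q.1 + Q.2) -
    ∑ a ∈ Finset.range n, ∑ b ∈ Finset.range n,
      MvPowerSeries.coeff (Finsupp.single 0 a + Finsupp.single 1 b) Fg * t Q.1 ^ a * t Q.2 ^ b

/-- `f` is the logarithm of `Fg`. -/
structure IsLogarithm (Fg : MvPowerSeries (Fin 2) ℂ) (f : PowerSeries ℂ) : Prop where
  coeff_zero : PowerSeries.coeff 0 f = 0
  coeff_one : PowerSeries.coeff 1 f = 1
  add : f.subst Fg = f.subst (MvPowerSeries.X 0 : MvPowerSeries (Fin 2) ℂ) +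
    f.subst (MvPowerSeries.X 1 : MvPowerSeries (Fin 2) ℂ)

/-- The pullback of `t` along `π_i ^ j`. -/
def pull (t : Pt W → ℂ) (i : Dir) (j : ℕ+) (Q : Pt W × Pt W) : ℂ := t ((j : ℕ) • proj i Q)

theorem pull_regOff {t : Pt W → ℂ} (ht : IsCoordinate W t) (i : Dir) (j : ℕ+) :
    ∃ S : Finset (Dir × ℕ+), (∀ s ∈ S, s.1 = i ∧ s.2 ≠ j) ∧ RegOff (pull t i j) S := by
  classical
  obtain ⟨S, h1, hS⟩ := ht.regular
  let bad : Finset ℕ+ := S.biUnion fun n => (Finset.Icc 1 (n * j)).filter (· ≠ j)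
  refine ⟨bad.image fun m => (i, m), ?_, fun Q hQ => ?_⟩
  · intro s hs
    obtain ⟨m, hm, rfl⟩ := Finset.mem_image.mp hs
    obtain ⟨n, -, hm⟩ := Finset.mem_biUnion.mp hm
    exact ⟨rfl, (Finset.mem_filter.mp hm).2⟩
  · have hreg : RegularAtC t ((j : ℕ) • proj i Q) := by
      refine hS _ fun n hn hord => hQ ?_
      have h0 : 0 < addOrderOf (proj i Q) := by
        rw [addOrderOf_pos_iff, isOfFinAddOrder_iff_nsmul_eq_zero]
        refine ⟨n * j, by positivity, ?_⟩
        rw [mul_nsmul', ← hord, addOrderOf_nsmul_eq_zero]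
      let m : ℕ+ := ⟨addOrderOf (proj i Q), h0⟩
      have hm : (m : ℕ) ∣ (n * j : ℕ) := by
        change addOrderOf (proj i Q) ∣ _
        rw [addOrderOf_dvd_iff_nsmul_eq_zero, mul_nsmul', ← hord, addOrderOf_nsmul_eq_zero]
      have hmj : m ≠ j := by
        intro h
        have : (j : ℕ) • proj i Q = 0 := by
          rw [← h]; exact addOrderOf_nsmul_eq_zero _
        rw [this, addOrderOf_zero] at hord
        apply h1
        have : n = 1 := PNat.coe_injective hord.symm
        rwa [← this]
      simp only [Dunion, Set.mem_iUnion]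
      refine ⟨(i, m), Finset.mem_image.mpr ⟨m, Finset.mem_biUnion.mpr ⟨n, hn, ?_⟩, rfl⟩,
        mem_Dset rfl⟩
      rw [Finset.mem_filter, Finset.mem_Icc]
      exact ⟨⟨one_le, Nat.le_of_dvd (Nat.mul_pos n.pos j.pos) hm⟩, hmj⟩
    have e : pull t i j = fun Q' : Pt W × Pt W => t ((((j : ℕ) : ℤ) • i.vec).1 • Q'.1 +
        (((j : ℕ) : ℤ) • i.vec).2 • Q'.2) := by
      funext Q'
      rw [zsmul_vec, natCast_zsmul]; rfl
    rw [e]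
    refine RegularAtC.comp_zsmul _ _ ?_
    rwa [zsmul_vec, natCast_zsmul]

theorem pull_mem {t : Pt W → ℂ} (ht : IsCoordinate W t) (i : Dir) (j : ℕ+)
    {A : Set (Dir × ℕ+)} (hA : ∀ m, m ≠ j → (i, m) ∈ A) :
    Ideal.Quotient.mk (nullIdeal W) (pull t i j) ∈ sections W A := by
  obtain ⟨S, hS, hreg⟩ := pull_regOff ht i j
  refine ⟨_, S, fun s hs => ?_, hreg, rfl⟩
  obtain ⟨rfl, h2⟩ := hS s hs
  exact hA _ h2

/-- The coordinate `t_ij` as an element of `𝒦`. -/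
def tK {t : Pt W → ℂ} (ht : IsCoordinate W t) (i : Dir) (j : ℕ+) : KK W :=
  ⟨Ideal.Quotient.mk (nullIdeal W) (pull t i j), pull_mem ht i j fun _ _ => Set.mem_univ _⟩

/-- The coordinate `t_ij` as an element of `𝒪_{D_ij}`. -/
def tD {t : Pt W → ℂ} (ht : IsCoordinate W t) (i : Dir) (j : ℕ+) : OD W i j :=
  ⟨tK ht i j, pull_mem ht i j fun _ hm h => hm (congrArg Prod.snd h)⟩

/-- The coordinate `t_{i, n_i(F)}` as an element of `𝒪_F`. -/
def tF {t : Pt W → ℂ} (ht : IsCoordinate W t) (F : FinSub) (i : Dir) : OF W F :=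
  ⟨tK ht i (nIdx F i), pull_mem ht i _ fun _ hm => hm⟩

theorem tD_mem {t : Pt W → ℂ} (ht : IsCoordinate W t) (i : Dir) (j : ℕ+) :
    tD ht i j ∈ mD W i j := by
  obtain ⟨S, hS, hreg⟩ := pull_regOff ht i j
  refine ⟨_, S, fun s hs h => (hS s hs).2 (congrArg Prod.snd h), hreg, rfl, fun Q hQ _ => ?_⟩
  rw [pull, proj_eq_zero le_rfl hQ, ht.zero]

theorem tF_mem {t : Pt W → ℂ} (ht : IsCoordinate W t) (F : FinSub) (i : Dir) :
    tF ht F i ∈ mF W F := by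
  obtain ⟨S, hS, hreg⟩ := pull_regOff ht i (nIdx F i)
  refine ⟨_, S, fun s hs h => ?_, hreg, rfl, fun Q hQ _ => ?_⟩
  · obtain ⟨rfl, h2⟩ := hS s hs
    exact h2 h
  · rw [pull, proj_eq_zero (F.le_Hsub i) hQ, ht.zero]

end Rings

/-! ### Completions and 2-periodic modules -/

section Algebra

section Completion
variable {R : Type*} [CommRing R] (I : Ideal R)

/-- The elements of `M` annihilated by a power of `I`. -/
def torsionPart (M : Type*) [AddCommGroup M] [Module R M] : Submodule R M where
  carrier := {x | ∃ n : ℕ, ∀ r ∈ I ^ n, r • x = 0}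
  zero_mem' := ⟨0, fun _ _ => smul_zero _⟩
  add_mem' := by
    rintro x y ⟨n, hn⟩ ⟨m, hm⟩
    refine ⟨n + m, fun r hr => ?_⟩
    rw [smul_add, hn r (Ideal.pow_le_pow_right (Nat.le_add_right n m) hr),
      hm r (Ideal.pow_le_pow_right (Nat.le_add_left m n) hr), add_zero]
  smul_mem' := by
    rintro c x ⟨n, hn⟩
    exact ⟨n, fun r hr => by rw [smul_comm, hn r hr, smul_zero]⟩

variable {I} {M : Type*} [AddCommGroup M] [Module R M]

theorem exists_lift (ξ : AdicCompletion I R) (n : ℕ) :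
    ∃ r : R, Ideal.Quotient.mk (I ^ n) r = AdicCompletion.evalₐ I n ξ :=
  Ideal.Quotient.mk_surjective _

/-- The element `r • x`, where `I ^ n` annihilates `x` and `r ∈ R` agrees with `ξ` modulo `I ^ n`. -/
def hatSMul (ξ : AdicCompletion I R) (x : torsionPart I M) : torsionPart I M :=
  (exists_lift ξ x.2.choose).choose • x

theorem hatSMul_eq (ξ : AdicCompletion I R) (x : torsionPart I M) {n : ℕ} {r : R}
    (hn : ∀ s ∈ I ^ n, s • (x : M) = 0)
    (hr : Ideal.Quotient.mk (I ^ n) r = AdicCompletion.evalₐ I n ξ) : hatSMul ξ x = r • x := by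
  obtain ⟨f, rfl⟩ := AdicCompletion.mk_surjective I R ξ
  have h0 := x.2.choose_spec
  have hr0 := (exists_lift (AdicCompletion.mk I R f) x.2.choose).choose_spec
  rw [hatSMul]
  generalize (exists_lift (AdicCompletion.mk I R f) x.2.choose).choose = r0 at *
  generalize x.2.choose = n0 at *
  have key : ∀ (m : ℕ) (s : R), (∀ u ∈ I ^ m, u • (x : M) = 0) →
      Ideal.Quotient.mk (I ^ m) s = AdicCompletion.evalₐ I m (AdicCompletion.mk I R f) →
      s • (x : M) = f (n0 + n) • (x : M) ∨ ¬ m ≤ n0 + n := by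
    intro m s hm hs
    by_cases hmn : m ≤ n0 + n
    · left
      rw [AdicCompletion.evalₐ_mk, Ideal.Quotient.eq] at hs
      have h1 : f m - f (n0 + n) ∈ I ^ m := by
        have := SModEq.sub_mem.mp (f.2 hmn)
        rwa [smul_eq_mul, Ideal.mul_top] at this
      have := hm _ (add_mem hs h1)
      rwa [sub_add_sub_cancel, sub_smul, sub_eq_zero] at this
    · exact Or.inr hmn
  apply Subtype.ext
  rw [Submodule.coe_smul, Submodule.coe_smul,
    (key n0 r0 h0 hr0).resolve_right (by omega), (key n r hn hr).resolve_right (by omega)]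

instance : Module (AdicCompletion I R) (torsionPart I M) where
  smul := hatSMul
  one_smul x := by
    obtain ⟨n, hn⟩ := x.2
    exact (hatSMul_eq 1 x hn (r := 1) (by simp)).trans (one_smul _ _)
  mul_smul ξ η x := by
    obtain ⟨n, hn⟩ := x.2
    obtain ⟨r, hr⟩ := exists_lift ξ n
    obtain ⟨s, hs⟩ := exists_lift η n
    have h1 := hatSMul_eq (ξ * η) x hn (r := r * s) (by rw [map_mul, map_mul, hr, hs])
    have h2 := hatSMul_eq η x hn hs
    have hn' : ∀ u ∈ I ^ n, u • ((s • x : torsionPart I M) : M) = 0 := fun u hu => by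
      rw [Submodule.coe_smul, smul_comm, hn u hu, smul_zero]
    have h3 := hatSMul_eq ξ (s • x) hn' hr
    change hatSMul _ _ = hatSMul _ (hatSMul _ _)
    rw [h1, h2, h3, mul_smul]
  smul_zero ξ := by
    obtain ⟨r, hr⟩ := exists_lift ξ 0
    exact (hatSMul_eq ξ (0 : torsionPart I M) (n := 0) (fun _ _ => smul_zero _) hr).trans
      (smul_zero r)
  smul_add ξ x y := by
    obtain ⟨n, hn⟩ := x.2
    obtain ⟨m, hm⟩ := y.2
    have hn' : ∀ s ∈ I ^ (n + m), s • (x : M) = 0 := fun s hs =>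
      hn s (Ideal.pow_le_pow_right (Nat.le_add_right n m) hs)
    have hm' : ∀ s ∈ I ^ (n + m), s • (y : M) = 0 := fun s hs =>
      hm s (Ideal.pow_le_pow_right (Nat.le_add_left m n) hs)
    obtain ⟨r, hr⟩ := exists_lift ξ (n + m)
    change hatSMul _ _ = hatSMul _ _ + hatSMul _ _
    rw [hatSMul_eq ξ x hn' hr, hatSMul_eq ξ y hm' hr, hatSMul_eq ξ (x + y) (n := n + m) ?_ hr,
      smul_add]
    intro s hs
    rw [Submodule.coe_add, smul_add, hn' s hs, hm' s hs, add_zero]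
  add_smul ξ η x := by
    obtain ⟨n, hn⟩ := x.2
    obtain ⟨r, hr⟩ := exists_lift ξ n
    obtain ⟨s, hs⟩ := exists_lift η n
    change hatSMul _ _ = hatSMul _ _ + hatSMul _ _
    rw [hatSMul_eq ξ x hn hr, hatSMul_eq η x hn hs,
      hatSMul_eq (ξ + η) x hn (r := r + s) (by rw [map_add, map_add, hr, hs]), add_smul]
  zero_smul x := by
    obtain ⟨n, hn⟩ := x.2
    exact (hatSMul_eq 0 x hn (r := 0) (by simp)).trans (zero_smul _ _)

/-- The value of a power series at an element of `I`, in the completion. -/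
def evalHat [Algebra ℂ R] (f : PowerSeries ℂ) {t : R} (ht : t ∈ I) : AdicCompletion I R :=
  AdicCompletion.mk I R (AdicCompletion.AdicCauchySequence.mk I R
    (fun n => ∑ k ∈ Finset.range n, algebraMap ℂ R (PowerSeries.coeff k f) * t ^ k)
    (fun n => by
      rw [Finset.sum_range_succ, SModEq.sub_mem]
      simp only [sub_add_cancel_left, neg_mem_iff, smul_eq_mul, Ideal.mul_top]
      exact Ideal.mul_mem_left _ _ (Ideal.pow_mem_pow ht n)))

end Completion

section Periodic

/-- The 2-periodic version of `M`: the value at `k` is the component of degree `2k`. -/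
def Periodic (M : Type*) [AddCommGroup M] : Type _ := ℤ →₀ M

variable {M : Type*} [AddCommGroup M]

instance : AddCommGroup (Periodic M) := inferInstanceAs (AddCommGroup (ℤ →₀ M))

instance : CoeFun (Periodic M) (fun _ => ℤ → M) := ⟨fun x => @DFunLike.coe (ℤ →₀ M) _ _ _ x⟩

/-- The shift by `n` of a 2-periodic module: it raises degrees by `2n`. -/
def shift (M : Type*) [AddCommGroup M] : Multiplicative ℤ →* AddMonoid.End (Periodic M) where
  toFun n := (Finsupp.mapDomain.addMonoidHom (fun k => k + n.toAdd) : (ℤ →₀ M) →+ (ℤ →₀ M))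
  map_one' := by
    apply AddMonoidHom.ext
    intro x
    change Finsupp.mapDomain (fun k : ℤ => k + 0) (show ℤ →₀ M from x) = x
    simp only [add_zero]
    exact Finsupp.mapDomain_id
  map_mul' m n := by
    apply AddMonoidHom.ext
    intro x
    change Finsupp.mapDomain (fun k : ℤ => k + (m * n).toAdd) (show ℤ →₀ M from x) =
      Finsupp.mapDomain _ (Finsupp.mapDomain _ (show ℤ →₀ M from x))
    rw [← Finsupp.mapDomain_comp]
    congr 1
    funext k
    simp only [toAdd_mul, Function.comp_apply]
    ring

variable {A : Type*} [CommRing A] [Module A M]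

/-- The action of `A` in each degree. -/
def degreewise (A M : Type*) [CommRing A] [AddCommGroup M] [Module A M] :
    A →+* AddMonoid.End (Periodic M) :=
  Module.toAddMonoidEnd A (ℤ →₀ M)

theorem degreewise_shift (a : A) (n : Multiplicative ℤ) :
    Commute (degreewise A M a) (shift M n) := by
  apply AddMonoidHom.ext
  intro x
  change a • Finsupp.mapDomain _ (show ℤ →₀ M from x) =
    Finsupp.mapDomain _ (a • (show ℤ →₀ M from x))
  rw [Finsupp.mapDomain_smul]

/-- `A` acts degreewise on the 2-periodic version of an `A`-module, and `T` shifts degrees by 2. -/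
instance : Module (LaurentPolynomial A) (Periodic M) :=
  Module.compHom (Periodic M)
    (AddMonoidAlgebra.liftNCRingHom (degreewise A M) (shift M) degreewise_shift)

theorem periodic_smul_apply (a : A) (n : ℤ) (x : Periodic M) (k : ℤ) :
    ((LaurentPolynomial.C a * LaurentPolynomial.T n : LaurentPolynomial A) • x) (k + n) =
      a • x k := by
  have h : (LaurentPolynomial.C a * LaurentPolynomial.T n : LaurentPolynomial A) • x =
      degreewise A M a (shift M (Multiplicative.ofAdd n) x) := by
    rw [← LaurentPolynomial.single_eq_C_mul_T]
    change (AddMonoidAlgebra.liftNCRingHom (degreewise A M) (shift M) degreewise_shift)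
      (AddMonoidAlgebra.single n a) x = _
    have := AddMonoidAlgebra.liftNC_single (degreewise A M : A →+ AddMonoid.End (Periodic M)) (shift M) n a
    exact congrArg (fun g : AddMonoid.End (Periodic M) => g x) this
  rw [h]
  change a • (Finsupp.mapDomain (fun k : ℤ => k + n) (show ℤ →₀ M from x)) (k + n) = a • _
  rw [Finsupp.mapDomain_apply (add_left_injective n)]

end Periodic

end Algebra

section Cousin

open scoped TensorProduct

/-! ### The terms of the Cousin complex -/

variable (W : WeierstrassCurve ℂ)

theorem OO_mono {A B : Set (Dir × ℕ+)} (h : A ⊆ B) : OO W A ≤ OO W B :=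
  fun _ hx => sections_mono h hx

/-- The larger of two of the subrings of `𝒦` as a module over the smaller one. -/
def subMod {A B : Set (Dir × ℕ+)} (h : A ⊆ B) : Submodule (OO W A) (KK W) where
  carrier := OO W B
  zero_mem' := (OO W B).zero_mem
  add_mem' := (OO W B).add_mem
  smul_mem' c _ hx := (OO W B).mul_mem (OO_mono W h c.2) hx

/-- The quotient of `𝒦` by the larger of two of its subrings, as a module over the smaller one. -/
def KQ {A B : Set (Dir × ℕ+)} (h : A ⊆ B) : Type := KK W ⧸ subMod W h

instance {A B : Set (Dir × ℕ+)} (h : A ⊆ B) : AddCommGroup (KQ W h) :=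
  inferInstanceAs (AddCommGroup (KK W ⧸ subMod W h))

instance {A B : Set (Dir × ℕ+)} (h : A ⊆ B) : Module (OO W A) (KQ W h) :=
  inferInstanceAs (Module (OO W A) (KK W ⧸ subMod W h))

/-- The quotient map. -/
def KQ.mk {A B : Set (Dir × ℕ+)} (h : A ⊆ B) : KK W →ₗ[OO W A] KQ W h := (subMod W h).mkQ

theorem offF_subset (F : FinSub) (i : Dir) : offF F ⊆ offD i (nIdx F i) := by
  intro s hs h
  obtain rfl := h
  exact hs rfl

/-- The term `𝒦 / 𝒪_{D_ij}`, the local cohomology at `D_ij`. -/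
abbrev H1 (i : Dir) (j : ℕ+) : Type := KQ W (subset_refl (offD i j))

/-- The stalk at the points of `Xbar F` of the codimension one term of the Cousin complex. -/
abbrev C1 (F : FinSub) : Type := Π₀ i : Dir, KQ W (offF_subset F i)

/-- The image of `𝒦` in the stalk of the codimension one term of the Cousin complex. -/
def diag (F : FinSub) : Submodule (OF W F) (C1 W F) where
  carrier := {x | ∃ f : KK W, ∀ i, x i = KQ.mk W (offF_subset F i) f}
  zero_mem' := ⟨0, fun i => (map_zero _).symm⟩
  add_mem' := by
    rintro x y ⟨f, hf⟩ ⟨g, hg⟩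
    exact ⟨f + g, fun i => by rw [DFinsupp.add_apply, hf, hg, map_add]⟩
  smul_mem' := by
    rintro c x ⟨f, hf⟩
    exact ⟨c • f, fun i => by rw [DFinsupp.smul_apply, hf, map_smul]⟩

/-- The codimension two term of the Cousin complex at `Xbar F`: the cokernel of
`𝒦 → ⨁_i 𝒦 / 𝒪_{D_{i, n_i(F)}}`. -/
def H2 (F : FinSub) : Type := C1 W F ⧸ diag W F

instance (F : FinSub) : AddCommGroup (H2 W F) := inferInstanceAs (AddCommGroup (C1 W F ⧸ diag W F))

instance (F : FinSub) : Module (OF W F) (H2 W F) :=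
  inferInstanceAs (Module (OF W F) (C1 W F ⧸ diag W F))

/-- The quotient map. -/
def H2.mk (F : FinSub) : C1 W F →ₗ[OF W F] H2 W F := (diag W F).mkQ

open Classical in
/-- The component `𝒦 / 𝒪_{D_{i, n_i(F)}} → H2 F` of the Cousin differential `d_1`. -/
def cousinD1 (i : Dir) (F : FinSub) : H1 W i (nIdx F i) →+ H2 W F :=
  QuotientAddGroup.lift (subMod W (subset_refl (offD i (nIdx F i)))).toAddSubgroup
    ((H2.mk W F).toAddMonoidHom.comp ((DFinsupp.singleAddHom (fun i => KQ W (offF_subset F i)) i).comp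
      (KQ.mk W (offF_subset F i)).toAddMonoidHom))
    (by
      intro x hx
      have : KQ.mk W (offF_subset F i) x = 0 := (Submodule.Quotient.mk_eq_zero _).mpr hx
      simp [this])

open Classical in
theorem cousinD1_mk (i : Dir) (F : FinSub) (g : KK W) :
    cousinD1 W i F (KQ.mk W (subset_refl (offD i (nIdx F i))) g) =
      H2.mk W F (DFinsupp.single i (KQ.mk W (offF_subset F i) g)) := rfl

/-! ### Rational cohomology rings of classifying spaces -/

/-- The rational cohomology ring of `B(G/K)`: the symmetric algebra on the rational vector space
spanned by the characters of `G/K`. -/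
abbrev BCoh (K : Subgroup Torus) : Type := SymmetricAlgebra ℚ (ℚ ⊗[ℤ] perp K)

/-- The Euler class of a character of `G/K`. -/
def euler {K : Subgroup Torus} (v : perp K) : BCoh K := SymmetricAlgebra.ι ℚ _ (1 ⊗ₜ v)

/-- The inflation map along `G/K → G/L`. -/
def inflation {K L : Subgroup Torus} (h : K ≤ L) : BCoh L →ₐ[ℚ] BCoh K :=
  SymmetricAlgebra.lift
    ((SymmetricAlgebra.ι ℚ _).comp ((Submodule.inclusion (perp_anti h)).baseChange ℚ))

theorem inflation_euler {K L : Subgroup Torus} (h : K ≤ L) (v : perp L) :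
    inflation h (euler v) = euler ⟨v.1, perp_anti h v.2⟩ := by
  simp [inflation, euler]; rfl

/-- The ring homomorphism from a cohomology ring that sends the Euler classes of a basis of
characters to given elements. -/
def eulerLift {K : Subgroup Torus} {ι R : Type} [CommRing R] [Algebra ℂ R]
    (b : Module.Basis ι ℤ (perp K)) (x : ι → R) : BCoh K →+* R :=
  letI : Algebra ℚ R := ((algebraMap ℂ R).comp (algebraMap ℚ ℂ)).toAlgebra
  (SymmetricAlgebra.lift (LinearMap.liftBaseChange ℚ (b.constr ℤ x))).toRingHom

theorem eulerLift_euler {K : Subgroup Torus} {ι R : Type} [CommRing R] [Algebra ℂ R]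
    (b : Module.Basis ι ℤ (perp K)) (x : ι → R) (k : ι) : eulerLift b x (euler (b k)) = x k := by
  simp [eulerLift, euler]

/-- The ring `𝒪_{ℱ/H_i}`. -/
abbrev OFH (i : Dir) : Type := ∀ j : ℕ+, BCoh (Hsub i j)

/-- The ring `𝒪_ℱ`. -/
abbrev OFin : Type := ∀ F : FinSub, BCoh F.1

/-- The inflation map `𝒪_{ℱ/H_i} → 𝒪_ℱ`: the component at `F` is the inflation map from the factor
of `H_i ^ n_i(F)`, the subgroup generated by `F` and `H_i`. -/
def infl (i : Dir) : OFH i →+* OFin :=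
  RingHom.pi fun F => (inflation (F.le_Hsub i)).toRingHom.comp (Pi.evalRingHom _ (nIdx F i))

/-! ### The modules `T_i` and `N` -/

section PiModule
variable {ι : Type*} {R M : ι → Type*} [∀ i, CommRing (R i)] [∀ i, AddCommGroup (M i)]
  [∀ i, Module (R i) (M i)]

/-- A product of rings acts componentwise on a direct sum of modules. -/
abbrev piModule : Module (∀ i, R i) (Π₀ i, M i) where
  smul a x := x.mapRange (fun i y => a i • y) (fun i => smul_zero (a i))
  one_smul x := DFinsupp.ext fun i => one_smul (R i) (x i)
  mul_smul a b x := DFinsupp.ext fun i => mul_smul (a i) (b i) (x i)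
  smul_zero a := DFinsupp.ext fun i => smul_zero (a i)
  smul_add a x y := DFinsupp.ext fun i => smul_add (a i) (x i) (y i)
  add_smul a b x := DFinsupp.ext fun i => add_smul (a i) (b i) (x i)
  zero_smul x := DFinsupp.ext fun i => zero_smul (R i) (x i)

end PiModule

/-- The torsion module underlying the 2-periodic module at `D_ij`. -/
abbrev V1 (i : Dir) (j : ℕ+) : Type := torsionPart (mD W i j) (H1 W i j)

/-- The torsion module underlying the 2-periodic module at `Xbar F`. -/
abbrev V2 (F : FinSub) : Type := torsionPart (mF W F) (H2 W F)

variable {W} {t : Pt W → ℂ}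

/-- The completed coordinate of `D_ij` in the completion of `𝒪_{D_ij}` at `m_ij`. -/
def hatD (ht : IsCoordinate W t) (f : PowerSeries ℂ) (i : Dir) (j : ℕ+) :
    AdicCompletion (mD W i j) (OD W i j) := evalHat f (tD_mem ht i j)

/-- The completed coordinate of `D_{i, n_i(F)}` in the completion of `𝒪_F` at `m_F`. -/
def hatF (ht : IsCoordinate W t) (f : PowerSeries ℂ) (F : FinSub) (i : Dir) :
    AdicCompletion (mF W F) (OF W F) := evalHat f (tF_mem ht F i)

/-- The action on the 2-periodic module at `D_ij`: the Euler class of `z_i ^ j` acts as the completed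
coordinate, in degree `-2`. -/
def actD (ht : IsCoordinate W t) (f : PowerSeries ℂ) (i : Dir) (j : ℕ+) :
    BCoh (Hsub i j) →+* LaurentPolynomial (AdicCompletion (mD W i j) (OD W i j)) :=
  eulerLift (basisH i j) fun _ => LaurentPolynomial.C (hatD ht f i j) * LaurentPolynomial.T (-1)

/-- The action on the 2-periodic module at `Xbar F`: the Euler classes of `z_A ^ n_A` and `z_B ^ n_B`
act as the completed coordinates, in degree `-2`. -/
def actF (ht : IsCoordinate W t) (f : PowerSeries ℂ) (σ : Splitting) (F : FinSub) :
    BCoh F.1 →+* LaurentPolynomial (AdicCompletion (mF W F) (OF W F)) :=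
  eulerLift (basisF σ F)
    ![LaurentPolynomial.C (hatF ht f F (σ.A F)) * LaurentPolynomial.T (-1),
      LaurentPolynomial.C (hatF ht f F (σ.B F)) * LaurentPolynomial.T (-1)]

/-- The module `T_i`, with the action of the Euler classes defined by the coordinate `t` and
the logarithm `f`. -/
def TMod (_ht : IsCoordinate W t) (_f : PowerSeries ℂ) (i : Dir) : Type :=
  Π₀ j : ℕ+, Periodic (V1 W i j)

/-- The module `N`, with the action of the Euler classes defined by the coordinate `t`,
the logarithm `f` and the splittings `σ`. -/
def NMod (_ht : IsCoordinate W t) (_f : PowerSeries ℂ) (_σ : Splitting) : Type :=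
  Π₀ F : FinSub, Periodic (V2 W F)

variable (ht : IsCoordinate W t) (f : PowerSeries ℂ) (σ : Splitting) (i : Dir)

instance : AddCommGroup (TMod ht f i) :=
  inferInstanceAs (AddCommGroup (Π₀ j : ℕ+, Periodic (V1 W i j)))

instance : AddCommGroup (NMod ht f σ) :=
  inferInstanceAs (AddCommGroup (Π₀ F : FinSub, Periodic (V2 W F)))

instance : CoeFun (TMod ht f i) (fun _ => ∀ j : ℕ+, Periodic (V1 W i j)) :=
  ⟨fun x => @DFunLike.coe (Π₀ j : ℕ+, Periodic (V1 W i j)) _ _ _ x⟩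

instance : CoeFun (NMod ht f σ) (fun _ => ∀ F : FinSub, Periodic (V2 W F)) :=
  ⟨fun x => @DFunLike.coe (Π₀ F : FinSub, Periodic (V2 W F)) _ _ _ x⟩

instance : Module (OFH i) (TMod ht f i) :=
  letI (j : ℕ+) : Module (BCoh (Hsub i j)) (Periodic (V1 W i j)) :=
    Module.compHom _ (actD ht f i j)
  piModule (R := fun j : ℕ+ => BCoh (Hsub i j)) (M := fun j : ℕ+ => Periodic (V1 W i j))

instance : Module OFin (NMod ht f σ) :=
  letI (F : FinSub) : Module (BCoh F.1) (Periodic (V2 W F)) := Module.compHom _ (actF ht f σ F)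
  piModule (R := fun F : FinSub => BCoh F.1) (M := fun F : FinSub => Periodic (V2 W F))

/-- `𝒪_{ℱ/H_i}` acts on `N` through the inflation map. -/
instance : Module (OFH i) (NMod ht f σ) := Module.compHom _ (infl i)

theorem TMod.smul_apply (a : OFH i) (x : TMod ht f i) (j : ℕ+) :
    (a • x) j = actD ht f i j (a j) • x j := rfl

theorem NMod.smul_apply (a : OFH i) (x : NMod ht f σ) (F : FinSub) :
    (a • x) F = actF ht f σ F (inflation (F.le_Hsub i) (a (nIdx F i))) • x F := rfl

end Cousin

end EllCousin

end

open EllCousin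

/-!
Everything is reduced to commutative algebra on affine charts of `C × C`. Normalising homogeneous
coordinates by a linear form on each factor embeds the complement of a divisor as a closed subset
of affine space, so that regular functions are locally quotients of polynomials (`regularAt_iff`)
and Hilbert's Nullstellensatz applies (`exists_chart_eq`).

The torsion of `C` enters through two facts. Multiplication by `j ≠ 0` is not zero, because the
formal group law and its logarithm show that `t ∘ [j]` equals `j t` to first order at the origin
(`exists_nsmul_ne_zero`); as a nonzero function on the curve `C` has finitely many zeros, the
`j`-torsion of `C` is finite (`finite_torsion`). Hence `D_ij`, the locus where the `i`-th
projection has order exactly `j`, is closed, and `Xbar F` is finite. Conversely `C` has points of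
order two and three; hence every torsion point is a pole of some function whose other poles and
whose zeros are torsion points, and the order of the zeros can be chosen to avoid any given number
(`exists_addOrderOf_ne`, `ratioFn`).

*Torsion of the Cousin terms.* By the Nullstellensatz a power of the ideal of the polar divisors
of `g` consists of denominators of `g`; applied to each chart this bounds the order of the pole of
`g` along `D_ij` (`exists_pow_mul_mem_OD`), which is the codimension one statement. In codimension
two, call the divisors `D_{k, m}` with `m ≠ n_k(F)` admissible for `F`, since elements of `𝒪_F`
may have poles there, and let `x` be the class at `i` of a function. At a point outside `Xbar F`
that does not lie both on `D_{i, n_i(F)}` and on another polar divisor `D_{k, n_k(F)}` of the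
function, the poles along one of the two kinds of divisors can be cancelled, which makes `x` zero.
At a point that lies on both, all projections are torsion, one of them has an order different from
the number prescribed by `F`, and so the point lies on an admissible divisor. So away from
finitely many admissible divisors some element of `𝒪_F` not vanishing at the point annihilates `x`
(`exists_annihilating_poly`). The units with poles along admissible divisors (`exists_pole`) are
adjoined to the coordinates of an affine chart in `exists_pow_vanPoly_le`, and the Nullstellensatz
then gives a power of the ideal of `Xbar F` that annihilates `x`.

*The completed coordinates.* At a point `Q` of `Xbar F` all the characters `z_i ^ n_i(F)` vanish.
Pulling back the formal group law along pairs of these characters shows that the logarithm of the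
pulled back coordinate is additive modulo every power of the maximal ideal of `Q`
(`truncSum_locV_zsmul_add`). That a truncation of the asserted relation lies in `m_F ^ n` can be
checked locally (`eq_top_of_locally`): at the points of `Xbar F` by this additivity and elsewhere
because `m_F ^ n` contains a function that does not vanish there.

*The Cousin differential.* If a function with poles along divisors `D_s` has a nonzero component
at `F`, then `F` lies in one of the finite groups `H_i ^ j ∩ H_k ^ m` with `(k, m)` among the `s`
and `k ≠ i`, so there are finitely many such `F` (`finite_cousinD1_ne_zero`). The components are
linear over `𝒪_F`, hence over pairs of elements of the completed rings with common approximations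
in `𝒪_F`. The Euler class of `z_i ^ n_i` inflates to a combination of the two basic Euler classes
of `G/F`, and acts on `N` as the completed coordinate of `i` by the additivity just described;
linearity over the cohomology rings follows (`cousinP_actD`).
-/

namespace EllCousin

open MvPolynomial

variable {W : WeierstrassCurve ℂ}

/-! ### Affine charts of `C × C` -/

/-- The polynomial ring in the homogeneous coordinates of the two factors of `C × C`. -/
abbrev Poly : Type := MvPolynomial (Fin 3 ⊕ Fin 3) ℂ

/-- The value of the linear form with coefficients `l` at the chosen homogeneous coordinates
of `P`. -/
noncomputable def lin (l : Fin 3 → ℂ) (P : Pt W) : ℂ := ∑ k, l k * homCoord P k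

/-- The points of `C × C` at which neither of the two linear forms `l.1`, `l.2` vanishes. -/
def chartDom (W : WeierstrassCurve ℂ) (l : (Fin 3 → ℂ) × (Fin 3 → ℂ)) : Set (Pt W × Pt W) :=
  {Q | lin l.1 Q.1 ≠ 0 ∧ lin l.2 Q.2 ≠ 0}

/-- The homogeneous coordinates of the two components of a point, normalised so that the linear
forms `l.1`, `l.2` take the value `1`. -/
noncomputable def chart (l : (Fin 3 → ℂ) × (Fin 3 → ℂ)) (Q : Pt W × Pt W) : Fin 3 ⊕ Fin 3 → ℂ :=
  Sum.elim ((lin l.1 Q.1)⁻¹ • homCoord Q.1) ((lin l.2 Q.2)⁻¹ • homCoord Q.2)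

/-- A polynomial in the normalised coordinates, as a function on `C × C`. -/
noncomputable def pol (W : WeierstrassCurve ℂ) (l : (Fin 3 → ℂ) × (Fin 3 → ℂ)) :
    Poly →ₐ[ℂ] (Pt W × Pt W → ℂ) :=
  aeval fun k Q => chart l Q k

theorem pol_apply (l : (Fin 3 → ℂ) × (Fin 3 → ℂ)) (p : Poly) (Q : Pt W × Pt W) :
    pol W l p Q = eval (chart l Q) p := by
  induction p using MvPolynomial.induction_on with
  | C a => simp [pol]
  | add p q hp hq => simp [hp, hq]
  | mul_X p k hp => rw [map_mul, Pi.mul_apply, hp, map_mul, eval_X]; simp [pol]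

theorem pol_of_isBihomog (l : (Fin 3 → ℂ) × (Fin 3 → ℂ)) {p : Poly} {d e : ℕ}
    (hp : IsBihomog p d e) (Q : Pt W × Pt W) :
    pol W l p Q = (lin l.1 Q.1)⁻¹ ^ d * (lin l.2 Q.2)⁻¹ ^ e * evalX Q p := by
  rw [pol_apply, chart, hp]; rfl

/-- Regularity at `Q` only depends on the values in a Zariski neighbourhood of `Q`, and a quotient
of regular functions whose denominator does not vanish is regular. -/
theorem RegularAt.of_mul {f g h : Pt W × Pt W → ℂ} {Q : Pt W × Pt W} (hg : RegularAt g Q)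
    (hh : RegularAt h Q) (h0 : h Q ≠ 0) {c : Poly} {m n : ℕ} (hc : IsBihomog c m n)
    (hcQ : evalX Q c ≠ 0) (H : ∀ Q', evalX Q' c ≠ 0 → h Q' * f Q' = g Q') : RegularAt f Q := by
  obtain ⟨d, e, a, b, ha, hb, hbQ, hab⟩ := hg
  obtain ⟨d', e', a', b', ha', hb', hbQ', hab'⟩ := hh
  refine ⟨_, _, a * b' * (c * b'), a' * b * (c * b'), (ha.mul hb').mul (hc.mul hb'), ?_, ?_, ?_⟩
  · have := (ha'.mul hb).mul (hc.mul hb')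
    convert this using 1 <;> ring
  · have h1 : evalX Q a' ≠ 0 := by
      intro h1; apply h0; rw [hab' Q hbQ', h1, zero_div]
    simp only [evalX, map_mul] at *
    exact mul_ne_zero (mul_ne_zero h1 hbQ) (mul_ne_zero hcQ hbQ')
  · intro Q' hQ'
    have e1 : evalX Q' (a' * b * (c * b')) =
      evalX Q' a' * evalX Q' b * (evalX Q' c * evalX Q' b') := by simp [evalX]
    have e2 : evalX Q' (a * b' * (c * b')) =
      evalX Q' a * evalX Q' b' * (evalX Q' c * evalX Q' b') := by simp [evalX]
    rw [e1] at hQ' ⊢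
    rw [e2]
    obtain ⟨⟨h1, h2⟩, h3, h4⟩ : (evalX Q' a' ≠ 0 ∧ evalX Q' b ≠ 0) ∧
        evalX Q' c ≠ 0 ∧ evalX Q' b' ≠ 0 := by
      simpa only [mul_ne_zero_iff] using hQ'
    have := H Q' h3
    rw [hab Q' h2, hab' Q' h4] at this
    field_simp at this ⊢
    linear_combination this

theorem regularAt_coord_fst (l : Fin 3 → ℂ) (k : Fin 3) {Q : Pt W × Pt W} (hQ : lin l Q.1 ≠ 0) :
    RegularAt (fun Q' => (lin l Q'.1)⁻¹ * homCoord Q'.1 k) Q := by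
  refine ⟨1, 0, X (Sum.inl k), ∑ k, C (l k) * X (Sum.inl k), ?_, ?_, ?_, ?_⟩
  · intro u v x y; simp
  · intro u v x y; simp [Finset.mul_sum, mul_left_comm]
  · simpa [evalX, lin] using hQ
  · intro Q' _; simp [evalX, lin]; ring

theorem regularAt_coord_snd (l : Fin 3 → ℂ) (k : Fin 3) {Q : Pt W × Pt W} (hQ : lin l Q.2 ≠ 0) :
    RegularAt (fun Q' => (lin l Q'.2)⁻¹ * homCoord Q'.2 k) Q := by
  refine ⟨0, 1, X (Sum.inr k), ∑ k, C (l k) * X (Sum.inr k), ?_, ?_, ?_, ?_⟩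
  · intro u v x y; simp
  · intro u v x y; simp [Finset.mul_sum, mul_left_comm]
  · simpa [evalX, lin] using hQ
  · intro Q' _; simp [evalX, lin]; ring

theorem regularAt_pol {l : (Fin 3 → ℂ) × (Fin 3 → ℂ)} (p : Poly) {Q : Pt W × Pt W}
    (hQ : Q ∈ chartDom W l) : RegularAt (pol W l p) Q := by
  induction p using MvPolynomial.induction_on with
  | C a =>
    have : pol W l (C a) = fun _ => a := by funext Q'; simp [pol_apply]
    rw [this]; exact regularAt_const a Q
  | add p q hp hq => rw [map_add]; exact hp.add hq
  | mul_X p k hp =>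
    rw [map_mul]
    refine hp.mul ?_
    have : pol W l (X k) = fun Q' => chart l Q' k := by funext Q'; simp [pol_apply]
    rw [this]
    rcases k with k | k
    · exact regularAt_coord_fst _ _ hQ.1
    · exact regularAt_coord_snd _ _ hQ.2

/-- A function is regular at a point of an affine chart if and only if it is a quotient of
polynomials in the affine coordinates. The denominator is chosen so that the equation holds
on the whole chart, also where the denominator vanishes. -/
theorem regularAt_iff {l : (Fin 3 → ℂ) × (Fin 3 → ℂ)} {f : Pt W × Pt W → ℂ} {Q : Pt W × Pt W}
    (hQ : Q ∈ chartDom W l) :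
    RegularAt f Q ↔ ∃ a b : Poly, pol W l b Q ≠ 0 ∧
      ∀ Q' ∈ chartDom W l, pol W l b Q' * f Q' = pol W l a Q' := by
  constructor
  · rintro ⟨d, e, a, b, ha, hb, hbQ, h⟩
    refine ⟨a * b, b * b, ?_, ?_⟩
    · rw [map_mul, Pi.mul_apply, pol_of_isBihomog l hb]
      have := inv_ne_zero hQ.1
      have := inv_ne_zero hQ.2
      positivity
    · intro Q' hQ'
      rw [map_mul, map_mul, Pi.mul_apply, Pi.mul_apply, pol_of_isBihomog l hb,
        pol_of_isBihomog l ha]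
      by_cases h0 : evalX Q' b = 0
      · rw [h0]; ring
      · rw [h Q' h0]; field_simp
  · rintro ⟨a, b, hb, h⟩
    refine (regularAt_pol a hQ).of_mul (regularAt_pol b hQ) hb
      (c := (∑ k, C (l.1 k) * X (Sum.inl k)) * (∑ k, C (l.2 k) * X (Sum.inr k)))
      (m := 1 + 0) (n := 0 + 1) (IsBihomog.mul ?_ ?_) ?_ ?_
    · intro u v x y; simp [Finset.mul_sum, mul_left_comm]
    · intro u v x y; simp [Finset.mul_sum, mul_left_comm]
    · have := mul_ne_zero hQ.1 hQ.2
      simpa [evalX, lin] using this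
    · intro Q' hQ'
      refine h Q' ?_
      have : lin l.1 Q'.1 * lin l.2 Q'.2 ≠ 0 := by simpa [evalX, lin] using hQ'
      exact mul_ne_zero_iff.mp this

/-- A solution of the homogeneous Weierstrass equation at which the linear form `l` takes the
value `1` is a normalised coordinate vector of a point of `C`. -/
theorem exists_point_of_equation [W.IsElliptic] (l x : Fin 3 → ℂ) (hl : ∑ k, l k * x k = 1)
    (hx : WeierstrassCurve.Projective.Equation W x) :
    ∃ P : Pt W, lin l P ≠ 0 ∧ (lin l P)⁻¹ • homCoord P = x := by
  have key : ∀ (P : Pt W) (u : ℂ), x = u • homCoord P →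
      lin l P ≠ 0 ∧ (lin l P)⁻¹ • homCoord P = x := by
    rintro P u rfl
    have h1 : u * lin l P = 1 := by
      rw [← hl, lin, Finset.mul_sum]
      exact Finset.sum_congr rfl fun k _ => by simp; ring
    have h2 : lin l P ≠ 0 := right_ne_zero_of_mul_eq_one h1
    refine ⟨h2, ?_⟩
    congr 1
    exact inv_eq_of_mul_eq_one_left h1
  by_cases hz : x 2 = 0
  · refine ⟨0, key 0 (x 1) ?_⟩
    have := (WeierstrassCurve.Projective.equation_iff x).mp hx
    rw [hz] at this
    have h0 : x 0 = 0 := by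
      have : x 0 ^ 3 = 0 := by linear_combination -this
      exact pow_eq_zero_iff (by norm_num) |>.mp this
    funext k
    fin_cases k
    · change x 0 = x 1 * 0; rw [h0]; ring
    · change x 1 = x 1 * 1; ring
    · change x 2 = x 1 * 0; rw [hz]; ring
  · have h1 := (WeierstrassCurve.Projective.equation_of_Z_ne_zero hz).mp hx
    have h2 := WeierstrassCurve.Affine.equation_iff_nonsingular.mp h1
    refine ⟨.some _ _ h2, key _ (x 2) ?_⟩
    funext k
    fin_cases k
    · change x 0 = x 2 * (x 0 / x 2); field_simp
    · change x 1 = x 2 * (x 1 / x 2); field_simp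
    · change x 2 = x 2 * 1; ring

/-- The image of a chart is a closed subvariety of affine space. -/
theorem exists_chart_eq [W.IsElliptic] (l : (Fin 3 → ℂ) × (Fin 3 → ℂ)) (z : Fin 3 ⊕ Fin 3 → ℂ)
    (hz : ∀ p : Poly, (∀ Q ∈ chartDom W l, pol W l p Q = 0) → eval z p = 0) :
    ∃ Q ∈ chartDom W l, z = chart l Q := by
  let E (s : Fin 3 → Fin 3 ⊕ Fin 3) : Poly :=
    X (s 1) ^ 2 * X (s 2) + C W.a₁ * X (s 0) * X (s 1) * X (s 2) + C W.a₃ * X (s 1) * X (s 2) ^ 2 -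
      (X (s 0) ^ 3 + C W.a₂ * X (s 0) ^ 2 * X (s 2) + C W.a₄ * X (s 0) * X (s 2) ^ 2 +
        C W.a₆ * X (s 2) ^ 3)
  have hE : ∀ s y, eval y (E s) = 0 ↔
      WeierstrassCurve.Projective.Equation W (fun k => y (s k)) := by
    intro s y
    rw [WeierstrassCurve.Projective.equation_iff, ← sub_eq_zero]
    simp [E]
  have hP : ∀ (P : Pt W) (u : ℂ), WeierstrassCurve.Projective.Equation W (u • homCoord P) := by
    intro P u
    have := (homCoord_nonsingular P).1
    rw [WeierstrassCurve.Projective.equation_iff] at this ⊢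
    simp only [Pi.smul_apply, smul_eq_mul]
    linear_combination u ^ 3 * this
  have e1 := hz (∑ k, C (l.1 k) * X (Sum.inl k) - 1) (by
    intro Q hQ
    rw [pol_apply]
    simp only [chart, map_sub, map_sum, map_mul, eval_C, eval_X, Sum.elim_inl, Pi.smul_apply,
      smul_eq_mul, map_one]
    have := hQ.1
    rw [sub_eq_zero, ← mul_inv_cancel₀ this, lin, Finset.sum_mul]
    exact Finset.sum_congr rfl fun k _ => by ring)
  have e2 := hz (∑ k, C (l.2 k) * X (Sum.inr k) - 1) (by
    intro Q hQ
    rw [pol_apply]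
    simp only [chart, map_sub, map_sum, map_mul, eval_C, eval_X, Sum.elim_inr, Pi.smul_apply,
      smul_eq_mul, map_one]
    have := hQ.2
    rw [sub_eq_zero, ← mul_inv_cancel₀ this, lin, Finset.sum_mul]
    exact Finset.sum_congr rfl fun k _ => by ring)
  have e3 := (hE _ z).mp (hz (E Sum.inl) (fun Q _ => by rw [pol_apply, hE]; exact hP _ _))
  have e4 := (hE _ z).mp (hz (E Sum.inr) (fun Q _ => by rw [pol_apply, hE]; exact hP _ _))
  simp only [map_sub, map_sum, map_mul, eval_C, eval_X, map_one, sub_eq_zero] at e1 e2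
  obtain ⟨P, hP, hP'⟩ := exists_point_of_equation _ _ e1 e3
  obtain ⟨R, hR, hR'⟩ := exists_point_of_equation _ _ e2 e4
  refine ⟨(P, R), ⟨hP, hR⟩, ?_⟩
  funext k
  rcases k with k | k
  · exact (congrFun hP' k).symm
  · exact (congrFun hR' k).symm

/-! ### Closed subsets -/

/-- `Z` is Zariski closed: every point outside `Z` is separated from `Z` by a function that is
regular there. -/
def ZClosed (Z : Set (Pt W × Pt W)) : Prop :=
  ∀ Q ∉ Z, ∃ h, RegularAt h Q ∧ h Q ≠ 0 ∧ ∀ Q' ∈ Z, h Q' = 0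

theorem ZClosed.exists_poly {Z : Set (Pt W × Pt W)} (hZ : ZClosed Z)
    {l : (Fin 3 → ℂ) × (Fin 3 → ℂ)} {Q : Pt W × Pt W} (hQ : Q ∈ chartDom W l) (hQZ : Q ∉ Z) :
    ∃ p : Poly, pol W l p Q ≠ 0 ∧ ∀ Q' ∈ chartDom W l, Q' ∈ Z → pol W l p Q' = 0 := by
  obtain ⟨h, hr, h0, hz⟩ := hZ Q hQZ
  obtain ⟨a, b, hb, hab⟩ := (regularAt_iff hQ).mp hr
  refine ⟨a, ?_, fun Q' hQ' hQZ' => ?_⟩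
  · rw [← hab Q hQ]; exact mul_ne_zero hb h0
  · rw [← hab Q' hQ', hz Q' hQZ', mul_zero]

theorem zClosed_empty : ZClosed (∅ : Set (Pt W × Pt W)) := fun Q _ =>
  ⟨fun _ => 1, regularAt_const 1 Q, one_ne_zero, by simp⟩

theorem ZClosed.union {Z Z' : Set (Pt W × Pt W)} (hZ : ZClosed Z) (hZ' : ZClosed Z') :
    ZClosed (Z ∪ Z') := by
  intro Q hQ
  rw [Set.mem_union, not_or] at hQ
  obtain ⟨h, hr, h0, hz⟩ := hZ Q hQ.1
  obtain ⟨h', hr', h0', hz'⟩ := hZ' Q hQ.2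
  refine ⟨h * h', hr.mul hr', mul_ne_zero h0 h0', ?_⟩
  rintro Q' (h1 | h1)
  · rw [Pi.mul_apply, hz Q' h1, zero_mul]
  · rw [Pi.mul_apply, hz' Q' h1, mul_zero]

theorem zClosed_biUnion {ι : Type*} {s : Set ι} (hs : s.Finite) {Z : ι → Set (Pt W × Pt W)}
    (hZ : ∀ i ∈ s, ZClosed (Z i)) : ZClosed (⋃ i ∈ s, Z i) := by
  induction s, hs using Set.Finite.induction_on with
  | empty => simpa using zClosed_empty
  | insert _ _ ih =>
    rw [Set.biUnion_insert]
    exact (hZ _ (Set.mem_insert _ _)).union (ih fun i hi => hZ i (Set.mem_insert_of_mem _ hi))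

/-- A point of `C` is closed: the indicator function of its complement is regular away from it. -/
theorem regularAtC_indicator [DecidableEq (Pt W)] {A P : Pt W} (h : P ≠ A) :
    RegularAtC (fun R => if R = A then 0 else 1) P := by
  obtain ⟨k, l, hkl⟩ := homCoord_minor h
  let p : MvPolynomial (Fin 3) ℂ := C (homCoord A l) * X k + C (-homCoord A k) * X l
  have hp : ∀ R : Pt W, evalC R p =
      homCoord R k * homCoord A l - homCoord R l * homCoord A k := by
    intro R; simp [evalC, p]; ring
  have hh : IsHomog p 1 := by intro u x; simp [p]; ring
  refine ⟨1, p, p, hh, hh, by rwa [hp], fun R hR => ?_⟩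
  have : R ≠ A := by rintro rfl; apply hR; rw [hp]; ring
  simp only [if_neg this, div_self hR]

theorem zClosed_preimage (a b : ℤ) (A : Pt W) :
    ZClosed {Q : Pt W × Pt W | a • Q.1 + b • Q.2 = A} := by
  classical
  intro Q hQ
  refine ⟨fun Q' => if a • Q'.1 + b • Q'.2 = A then 0 else 1,
    RegularAtC.comp_zsmul (t := fun R => if R = A then 0 else 1) a b (regularAtC_indicator hQ),
    ?_, fun Q' hQ' => ?_⟩
  · have : ¬ (a • Q.1 + b • Q.2 = A) := hQ
    simp [this]
  · have : a • Q'.1 + b • Q'.2 = A := hQ'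
    simp [this]

theorem zClosed_singleton (A : Pt W × Pt W) : ZClosed {A} := by
  intro Q hQ
  by_cases h : Q.1 = A.1
  · have h2 : Q.2 ≠ A.2 := fun h2 => hQ (Prod.ext h h2)
    obtain ⟨f, hr, h0, hz⟩ := zClosed_preimage 0 1 A.2 Q (by simpa using h2)
    exact ⟨f, hr, h0, by rintro _ rfl; exact hz _ (by simp)⟩
  · obtain ⟨f, hr, h0, hz⟩ := zClosed_preimage 1 0 A.1 Q (by simpa using h)
    exact ⟨f, hr, h0, by rintro _ rfl; exact hz _ (by simp)⟩

theorem zClosed_of_finite {Z : Set (Pt W × Pt W)} (hZ : Z.Finite) : ZClosed Z := by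
  have := zClosed_biUnion hZ (Z := fun A => {A}) fun A _ => zClosed_singleton A
  rwa [Set.biUnion_of_singleton] at this

/-! ### The logarithm turns the formal group law into addition -/

/-- The power series whose coefficients of total degree less than `n` vanish. -/
def orderIdeal (σ : Type*) (n : ℕ) : Ideal (MvPowerSeries σ ℂ) where
  carrier := {s | (n : ℕ∞) ≤ s.order}
  zero_mem' := by simp
  add_mem' := fun ha hb => (le_min ha hb).trans MvPowerSeries.min_order_le_add
  smul_mem' := fun c s hs => (hs.trans le_add_self).trans MvPowerSeries.le_order_mul

theorem mem_orderIdeal {σ : Type*} {n : ℕ} {s : MvPowerSeries σ ℂ} :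
    s ∈ orderIdeal σ n ↔ ∀ d : σ →₀ ℕ, d.degree < n → MvPowerSeries.coeff d s = 0 :=
  ⟨fun h _ hd => MvPowerSeries.coeff_of_lt_order (lt_of_lt_of_le (by exact_mod_cast hd) h),
    MvPowerSeries.nat_le_order⟩

theorem subst_sub_truncation_mem {σ : Type*} (f : PowerSeries ℂ) {s : MvPowerSeries σ ℂ}
    (hs : s.constantCoeff = 0) (n : ℕ) :
    f.subst s - ∑ k ∈ Finset.range n, MvPowerSeries.C (PowerSeries.coeff k f) * s ^ k ∈
      orderIdeal σ n := by
  have hS : PowerSeries.HasSubst s := PowerSeries.HasSubst.of_constantCoeff_zero hs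
  have e : f.subst s = s ^ n * (PowerSeries.mk fun i => PowerSeries.coeff (i + n) f).subst s +
      ∑ k ∈ Finset.range n, MvPowerSeries.C (PowerSeries.coeff k f) * s ^ k := by
    conv_lhs => rw [f.eq_X_pow_mul_shift_add_trunc n]
    rw [PowerSeries.subst_add hS, PowerSeries.subst_mul hS, PowerSeries.subst_pow hS,
      PowerSeries.subst_X hS, PowerSeries.subst_coe hS]
    congr 1
    exact PowerSeries.eval₂_trunc_eq_sum_range _ _ _ _
  rw [e, add_sub_cancel_right]
  exact Ideal.mul_mem_right _ _ (MvPowerSeries.le_order_pow_of_constantCoeff_eq_zero n hs)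

/-- A polynomial without terms of degree less than `n` takes values in `m ^ n` at elements
of `m`. -/
theorem aeval_mem_pow {σ A : Type*} [CommRing A] [Algebra ℂ A] {m : Ideal A} {x : σ → A}
    (hx : ∀ k, x k ∈ m) {n : ℕ} {p : MvPolynomial σ ℂ}
    (hp : (p : MvPowerSeries σ ℂ) ∈ orderIdeal σ n) : aeval x p ∈ m ^ n := by
  rw [p.as_sum, map_sum]
  refine Ideal.sum_mem _ fun d hd => ?_
  have hn : n ≤ d.degree := by
    by_contra h
    have := mem_orderIdeal.mp hp d (not_le.mp h)
    rw [MvPolynomial.coeff_coe] at this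
    exact (mem_support_iff.mp hd) this
  rw [aeval_monomial]
  refine Ideal.mul_mem_left _ _ (Ideal.pow_le_pow_right hn ?_)
  rw [Finsupp.prod, Finsupp.degree_apply, ← Finset.prod_pow_eq_pow_sum]
  exact Ideal.prod_mem_prod fun k _ => Ideal.pow_mem_pow (hx k) _

/-- The truncation of a formal group law by its exponents in each of the two variables. -/
noncomputable def truncFG (Fg : MvPowerSeries (Fin 2) ℂ) (n : ℕ) : MvPolynomial (Fin 2) ℂ :=
  ∑ a ∈ Finset.range n, ∑ b ∈ Finset.range n,
    C (MvPowerSeries.coeff (Finsupp.single 0 a + Finsupp.single 1 b) Fg) * X 0 ^ a * X 1 ^ b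

theorem sub_truncFG_mem (Fg : MvPowerSeries (Fin 2) ℂ) (n : ℕ) :
    Fg - (truncFG Fg n : MvPowerSeries (Fin 2) ℂ) ∈ orderIdeal (Fin 2) n := by
  rw [mem_orderIdeal]
  intro d hd
  have hd' : d.degree = d 0 + d 1 := by simp [Finsupp.degree_eq_sum]
  have hdd : d = Finsupp.single 0 (d 0) + Finsupp.single 1 (d 1) := by
    ext k; fin_cases k <;> simp
  have hm : ∀ a b : ℕ, (C (MvPowerSeries.coeff (Finsupp.single 0 a + Finsupp.single 1 b) Fg) *
      X 0 ^ a * X 1 ^ b : MvPolynomial (Fin 2) ℂ) =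
      monomial (Finsupp.single 0 a + Finsupp.single 1 b)
        (MvPowerSeries.coeff (Finsupp.single 0 a + Finsupp.single 1 b) Fg) := by
    intro a b
    rw [X_pow_eq_monomial, X_pow_eq_monomial, C_mul_monomial, monomial_mul]
    simp
  have hinj : ∀ a b : ℕ, (Finsupp.single 0 a + Finsupp.single 1 b : Fin 2 →₀ ℕ) = d ↔
      a = d 0 ∧ b = d 1 := by
    intro a b
    constructor
    · intro h
      rw [← h]; simp
    · rintro ⟨rfl, rfl⟩; exact hdd.symm
  rw [map_sub, MvPolynomial.coeff_coe, truncFG, coeff_sum, sub_eq_zero]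
  rw [Finset.sum_eq_single (d 0)]
  · rw [coeff_sum, Finset.sum_eq_single (d 1)]
    · rw [hm, coeff_monomial, if_pos hdd.symm, ← hdd]
    · intro b _ hb
      rw [hm, coeff_monomial, if_neg (fun h => hb ((hinj _ _).mp h).2)]
    · intro h; exact absurd (Finset.mem_range.mpr (by omega)) h
  · intro a _ ha
    rw [coeff_sum]
    refine Finset.sum_eq_zero fun b _ => ?_
    rw [hm, coeff_monomial, if_neg (fun h => ha ((hinj _ _).mp h).1)]
  · intro h; exact absurd (Finset.mem_range.mpr (by omega)) h

theorem IsLogarithm.truncation_mem {Fg : MvPowerSeries (Fin 2) ℂ} {f : PowerSeries ℂ}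
    (hf : IsLogarithm Fg f) (h0 : Fg.constantCoeff = 0) (n : ℕ) :
    ((∑ k ∈ Finset.range n, C (PowerSeries.coeff k f) * (truncFG Fg n ^ k - X 0 ^ k - X 1 ^ k) :
      MvPolynomial (Fin 2) ℂ) : MvPowerSeries (Fin 2) ℂ) ∈ orderIdeal (Fin 2) n := by
  have hs := subst_sub_truncation_mem f h0 n
  have hX (j : Fin 2) := subst_sub_truncation_mem f
    (s := (MvPowerSeries.X j : MvPowerSeries (Fin 2) ℂ)) (by simp) n
  have hT := sub_truncFG_mem Fg n
  rw [← Ideal.Quotient.eq_zero_iff_mem] at *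
  rw [← MvPolynomial.coeToMvPowerSeries.ringHom_apply]
  have hX0 := hX 0
  have hX1 := hX 1
  rw [← Ideal.Quotient.eq_zero_iff_mem] at hX0 hX1
  rw [hf.add] at hs
  simp only [map_sub, map_sum, map_mul, map_add, map_pow,
    MvPolynomial.coeToMvPowerSeries.ringHom_apply, coe_C, coe_X] at *
  rw [sub_eq_zero] at hs hX0 hX1 hT
  rw [← hT]
  simp only [mul_sub, Finset.sum_sub_distrib]
  rw [← hs, ← hX0, ← hX1]
  ring

/-- The values of the truncated logarithm at `x`, `y` and at the formal sum of `x` and `y`. -/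
theorem IsLogarithm.add_sub_mem {Fg : MvPowerSeries (Fin 2) ℂ} {f : PowerSeries ℂ}
    (hf : IsLogarithm Fg f) (h0 : Fg.constantCoeff = 0) {A : Type*} [CommRing A] [Algebra ℂ A]
    {m : Ideal A} {n : ℕ} {x y u : A} (hx : x ∈ m) (hy : y ∈ m)
    (hu : u - aeval ![x, y] (truncFG Fg n) ∈ m ^ n) :
    (∑ k ∈ Finset.range n, algebraMap ℂ A (PowerSeries.coeff k f) * u ^ k) -
      (∑ k ∈ Finset.range n, algebraMap ℂ A (PowerSeries.coeff k f) * x ^ k) -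
      (∑ k ∈ Finset.range n, algebraMap ℂ A (PowerSeries.coeff k f) * y ^ k) ∈ m ^ n := by
  have h1 := aeval_mem_pow (x := ![x, y]) (m := m)
    (by intro k; fin_cases k; exacts [hx, hy]) (hf.truncation_mem h0 n)
  rw [← Ideal.Quotient.eq_zero_iff_mem] at *
  simp only [map_sub, map_sum, map_mul, map_pow, algHom_C, aeval_X] at *
  rw [sub_eq_zero] at hu
  rw [hu, ← h1]
  simp only [mul_sub, Finset.sum_sub_distrib]
  rfl

/-! ### Local rings and pull-backs -/

/-- The maximal ideal of the functions regular at `Q`: those vanishing at `Q`. -/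
noncomputable def maxX (Q : Pt W × Pt W) : Ideal (RegX W Q) :=
  RingHom.ker ((Pi.evalRingHom (fun _ : Pt W × Pt W => ℂ) Q).comp (RegX W Q).val.toRingHom)

theorem mem_maxX {Q : Pt W × Pt W} {f : RegX W Q} : f ∈ maxX Q ↔ (f : Pt W × Pt W → ℂ) Q = 0 :=
  Iff.rfl

theorem RegularAt.comp {φ ψ : Pt W × Pt W → Pt W} {Q : Pt W × Pt W} (hφ : MorphAt φ Q)
    (hψ : MorphAt ψ Q) {f : Pt W × Pt W → ℂ} (hf : RegularAt f (φ Q, ψ Q)) :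
    RegularAt (fun Q' => f (φ Q', ψ Q')) Q := by
  obtain ⟨d, e, X, d', e', c, hX, hc, hcQ, h⟩ := hφ
  obtain ⟨m, n, Y, m', n', c', hY, hc', hcQ', h'⟩ := hψ
  obtain ⟨p, q, a, b, ha, hb, hbQ, hab⟩ := hf
  have key : ∀ (p : Poly) (z : Fin 3 ⊕ Fin 3 → ℂ), eval z (aeval (Sum.elim X Y) p) =
      eval (Sum.elim (fun k => eval z (X k)) (fun k => eval z (Y k))) p := by
    intro p z
    induction p using MvPolynomial.induction_on with
    | C a => simp
    | add p q hp hq => simp only [map_add, hp, hq]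
    | mul_X p k hp =>
      simp only [map_mul, hp, aeval_X, eval_X]
      rcases k with k | k <;> rfl
  have hhom : ∀ r : Poly, IsBihomog r p q →
      IsBihomog (aeval (Sum.elim X Y) r) (d * p + m * q) (e * p + n * q) := by
    intro r hr u v x y
    rw [key, key]
    have e1 : (fun k => eval (Sum.elim (u • x) (v • y)) (X k)) =
        (u ^ d * v ^ e) • (fun k => eval (Sum.elim x y) (X k)) := by
      funext k; simp [hX k u v x y]
    have e2 : (fun k => eval (Sum.elim (u • x) (v • y)) (Y k)) =
        (u ^ m * v ^ n) • (fun k => eval (Sum.elim x y) (Y k)) := by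
      funext k; simp [hY k u v x y]
    rw [e1, e2, hr]; ring
  have hev : ∀ Q', evalX Q' c ≠ 0 → evalX Q' c' ≠ 0 →
      ∃ u : ℂ, u ≠ 0 ∧ (∀ r, IsBihomog r p q → evalX Q' (aeval (Sum.elim X Y) r) =
        u * evalX (φ Q', ψ Q') r) := by
    intro Q' hQ' hQ''
    obtain ⟨u, hu, hu'⟩ := h Q' hQ'
    obtain ⟨v, hv, hv'⟩ := h' Q' hQ''
    refine ⟨u ^ p * v ^ q, mul_ne_zero (pow_ne_zero _ hu) (pow_ne_zero _ hv), fun r hr => ?_⟩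
    have : evalX Q' (aeval (Sum.elim X Y) r) =
        eval (Sum.elim (fun k => evalX Q' (X k)) (fun k => evalX Q' (Y k))) r := key r _
    rw [this, hu', hv', hr]; rfl
  refine ⟨_, _, aeval (Sum.elim X Y) a * (c * c'), aeval (Sum.elim X Y) b * (c * c'),
    (hhom a ha).mul (hc.mul hc'), (hhom b hb).mul (hc.mul hc'), ?_, ?_⟩
  · obtain ⟨u, hu, hp⟩ := hev Q hcQ hcQ'
    have : evalX Q (aeval (Sum.elim X Y) b * (c * c')) =
        (u * evalX (φ Q, ψ Q) b) * (evalX Q c * evalX Q c') := by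
      rw [← hp b hb]; simp [evalX]
    rw [this]
    exact mul_ne_zero (mul_ne_zero hu hbQ) (mul_ne_zero hcQ hcQ')
  · intro Q' hQ'
    have h2 : ∀ r : Poly, evalX Q' (aeval (Sum.elim X Y) r * (c * c')) =
      evalX Q' (aeval (Sum.elim X Y) r) * (evalX Q' c * evalX Q' c') := by intro r; simp [evalX]
    have hc1 : evalX Q' c ≠ 0 := fun h0 => hQ' (by rw [h2, h0]; ring)
    have hc2 : evalX Q' c' ≠ 0 := fun h0 => hQ' (by rw [h2, h0]; ring)
    obtain ⟨u, hu, hp⟩ := hev Q' hc1 hc2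
    have hb' : evalX (φ Q', ψ Q') b ≠ 0 := fun h0 => hQ' (by rw [h2, hp b hb, h0]; ring)
    change f (φ Q', ψ Q') = _
    rw [hab _ hb', h2, h2, hp a ha, hp b hb]
    field_simp

/-- The pull-back of regular functions along a pair of morphisms. -/
noncomputable def pullX {φ ψ : Pt W × Pt W → Pt W} {Q : Pt W × Pt W} (hφ : MorphAt φ Q)
    (hψ : MorphAt ψ Q) : RegX W (φ Q, ψ Q) →+* RegX W Q where
  toFun f := ⟨fun Q' => (f : Pt W × Pt W → ℂ) (φ Q', ψ Q'), RegularAt.comp hφ hψ f.2⟩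
  map_one' := rfl
  map_mul' _ _ := rfl
  map_zero' := rfl
  map_add' _ _ := rfl

theorem map_pow_le {A B : Type*} [CommRing A] [CommRing B] (φ : A →+* B) {I : Ideal A}
    {J : Ideal B} (h : ∀ a ∈ I, φ a ∈ J) {n : ℕ} {a : A} (ha : a ∈ I ^ n) : φ a ∈ J ^ n := by
  have := Ideal.mem_map_of_mem φ ha
  rw [Ideal.map_pow] at this
  exact Ideal.pow_right_mono (Ideal.map_le_iff_le_comap.mpr h) n this

theorem VanishX.comp {φ ψ : Pt W × Pt W → Pt W} {Q : Pt W × Pt W} (hφ : MorphAt φ Q)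
    (hψ : MorphAt ψ Q) {n : ℕ} {f : Pt W × Pt W → ℂ} (hf : VanishX (φ Q, ψ Q) n f) :
    VanishX Q n (fun Q' => f (φ Q', ψ Q')) := by
  obtain ⟨h, hm, rfl⟩ := hf
  exact ⟨pullX hφ hψ h, map_pow_le (pullX hφ hψ) (J := maxX Q) (fun a ha => ha) hm, rfl⟩

/-- The pull-back of the coordinate `t` along a character of `C × C`. -/
noncomputable def pullV (t : Pt W → ℂ) (v : ℤ × ℤ) (Q : Pt W × Pt W) : ℂ :=
  t (v.1 • Q.1 + v.2 • Q.2)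

theorem IsCoordinate.regularAtC_zero {t : Pt W → ℂ} (ht : IsCoordinate W t) : RegularAtC t 0 := by
  obtain ⟨S, hS, h⟩ := ht.regular
  refine h 0 fun n hn h1 => hS ?_
  rw [addOrderOf_zero] at h1
  have : n = 1 := PNat.coe_injective h1.symm
  rwa [← this]

theorem regularAt_pullV {t : Pt W → ℂ} (ht : IsCoordinate W t) {v : ℤ × ℤ} {Q : Pt W × Pt W}
    (hQ : v.1 • Q.1 + v.2 • Q.2 = 0) : RegularAt (pullV t v) Q :=
  RegularAtC.comp_zsmul _ _ (by rw [hQ]; exact ht.regularAtC_zero)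

theorem IsFormalGroupLaw.constantCoeff {t : Pt W → ℂ} (ht : IsCoordinate W t)
    {Fg : MvPowerSeries (Fin 2) ℂ} (hFg : IsFormalGroupLaw W t Fg) : Fg.constantCoeff = 0 := by
  obtain ⟨h, hm, e⟩ := hFg 1
  rw [pow_one] at hm
  have h0 : (h : Pt W × Pt W → ℂ) (0, 0) = 0 := hm
  rw [e] at h0
  simpa [ht.zero] using h0

/-- The truncation `∑_{k < n} α_k x ^ k` of a power series, evaluated at `x`. -/
noncomputable def truncSum {A : Type*} [CommRing A] [Algebra ℂ A] (f : PowerSeries ℂ) (n : ℕ)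
    (x : A) : A :=
  ∑ k ∈ Finset.range n, algebraMap ℂ A (PowerSeries.coeff k f) * x ^ k

theorem map_truncSum {A B : Type*} [CommRing A] [Algebra ℂ A] [CommRing B] [Algebra ℂ B]
    (φ : A →ₐ[ℂ] B) (f : PowerSeries ℂ) (n : ℕ) (x : A) :
    φ (truncSum f n x) = truncSum f n (φ x) := by
  simp [truncSum]

section Additivity

variable {t : Pt W → ℂ} (ht : IsCoordinate W t) {Fg : MvPowerSeries (Fin 2) ℂ}
  (hFg : IsFormalGroupLaw W t Fg) {f : PowerSeries ℂ} (hf : IsLogarithm Fg f)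
  {Q : Pt W × Pt W}

/-- The characters of `C × C` that vanish at `Q`. -/
def annLattice (Q : Pt W × Pt W) : AddSubgroup (ℤ × ℤ) where
  carrier := {v | v.1 • Q.1 + v.2 • Q.2 = 0}
  zero_mem' := by simp
  add_mem' := by
    intro v w hv hw
    have : (v + w).1 • Q.1 + (v + w).2 • Q.2 =
        (v.1 • Q.1 + v.2 • Q.2) + (w.1 • Q.1 + w.2 • Q.2) := by
      simp only [Prod.fst_add, Prod.snd_add, add_zsmul]; abel
    change _ = _
    rw [this, hv, hw, add_zero]
  neg_mem' := by
    intro v hv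
    have : (-v).1 • Q.1 + (-v).2 • Q.2 = -(v.1 • Q.1 + v.2 • Q.2) := by
      simp only [Prod.fst_neg, Prod.snd_neg, neg_zsmul]; abel
    change _ = _
    rw [this, hv, neg_zero]

theorem mem_annLattice {v : ℤ × ℤ} : v ∈ annLattice Q ↔ v.1 • Q.1 + v.2 • Q.2 = 0 := Iff.rfl

/-- The pull-back of the coordinate along a character vanishing at `Q`, in the local ring
at `Q`. -/
noncomputable def locV (v : annLattice Q) : RegX W Q := ⟨pullV t v, regularAt_pullV ht v.2⟩

include hFg hf in
/-- Modulo powers of the maximal ideal at `Q`, the logarithm of the pull-back of the coordinate is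
additive in the character: this is the formal group law, pulled back along the homomorphism
`C × C → C × C` given by the two characters. -/
theorem truncSum_locV_add (n : ℕ) (v w : annLattice Q) :
    truncSum f n (locV ht (v + w)) - truncSum f n (locV ht v) - truncSum f n (locV ht w) ∈
      maxX Q ^ n := by
  refine hf.add_sub_mem (hFg.constantCoeff ht) (m := maxX Q) (x := locV ht v) (y := locV ht w)
    (u := locV ht (v + w)) ?_ ?_ ?_
  · change t _ = 0
    rw [mem_annLattice.mp v.2, ht.zero]
  · change t _ = 0
    rw [mem_annLattice.mp w.2, ht.zero]
  · have h1 := hFg n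
    have e0 : ((0, 0) : Pt W × Pt W) = ((v : ℤ × ℤ).1 • Q.1 + (v : ℤ × ℤ).2 • Q.2,
        (w : ℤ × ℤ).1 • Q.1 + (w : ℤ × ℤ).2 • Q.2) := by
      rw [mem_annLattice.mp v.2, mem_annLattice.mp w.2]
    rw [e0] at h1
    obtain ⟨h, hm, e⟩ := VanishX.comp
      (φ := fun Q' => (v : ℤ × ℤ).1 • Q'.1 + (v : ℤ × ℤ).2 • Q'.2)
      (ψ := fun Q' => (w : ℤ × ℤ).1 • Q'.1 + (w : ℤ × ℤ).2 • Q'.2)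
      (((morphAt_fst Q).zsmul _).add ((morphAt_snd Q).zsmul _))
      (((morphAt_fst Q).zsmul _).add ((morphAt_snd Q).zsmul _)) h1
    have h2 : h = locV ht (v + w) - aeval ![locV ht v, locV ht w] (truncFG Fg n) := by
      apply Subtype.ext
      rw [e]
      have h3 : ((aeval ![locV ht v, locV ht w] (truncFG Fg n) : RegX W Q) : Pt W × Pt W → ℂ) =
          aeval (fun k => ((![locV ht v, locV ht w] k : RegX W Q) : Pt W × Pt W → ℂ))
            (truncFG Fg n) := by
        exact (MvPolynomial.map_aeval _ (RegX W Q).val.toRingHom _)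
      funext Q'
      rw [AddSubgroupClass.coe_sub, Pi.sub_apply, h3]
      congr 1
      · change _ = t _
        congr 1
        simp only [AddSubgroup.coe_add, Prod.fst_add, Prod.snd_add, add_zsmul]; abel
      · simp only [truncFG, map_sum, map_mul, map_pow, aeval_X, algHom_C, Finset.sum_apply,
          Pi.mul_apply, Pi.pow_apply]
        rfl
    rw [← h2]
    exact hm

include hFg hf in
theorem truncSum_locV_zsmul_add (n : ℕ) (v w : annLattice Q) (r s : ℤ) :
    truncSum f n (locV ht (r • v + s • w)) -
      (r • truncSum f n (locV ht v) + s • truncSum f n (locV ht w)) ∈ maxX Q ^ n := by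
  let φ : annLattice Q →+ RegX W Q ⧸ maxX Q ^ n := AddMonoidHom.mk'
    (fun v => Ideal.Quotient.mk _ (truncSum f n (locV ht v))) (by
      intro v w
      have := truncSum_locV_add ht hFg hf n v w
      rw [← Ideal.Quotient.eq_zero_iff_mem, map_sub, map_sub, sub_sub, sub_eq_zero] at this
      exact this)
  have h : φ (r • v + s • w) = r • φ v + s • φ w := by rw [map_add, map_zsmul, map_zsmul]
  rw [← Ideal.Quotient.eq_zero_iff_mem, map_sub, map_add, map_zsmul, map_zsmul, sub_eq_zero]
  exact h

end Additivity

/-! ### Torsion points -/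

/-- The restriction of a regular function to `C × {0}`. -/
theorem RegularAt.restrict {f : Pt W × Pt W → ℂ} {P : Pt W} (hf : RegularAt f (P, 0)) :
    RegularAtC (fun R => f (R, 0)) P := by
  obtain ⟨d, e, a, b, ha, hb, hbQ, h⟩ := hf
  let s : Fin 3 ⊕ Fin 3 → MvPolynomial (Fin 3) ℂ :=
    Sum.elim X (fun k => C (homCoord (0 : Pt W) k))
  have key : ∀ (p : Poly) (x : Fin 3 → ℂ), eval x (aeval s p) =
      eval (Sum.elim x (homCoord (0 : Pt W))) p := by
    intro p x
    induction p using MvPolynomial.induction_on with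
    | C a => simp
    | add p q hp hq => simp only [map_add, hp, hq]
    | mul_X p k hp =>
      simp only [map_mul, hp, aeval_X, eval_X]
      rcases k with k | k <;> simp [s]
  have hev : ∀ (p : Poly) (R : Pt W), evalC R (aeval s p) = evalX (R, 0) p :=
    fun p R => key p _
  have hh : ∀ p : Poly, IsBihomog p d e → IsHomog (aeval s p) d := by
    intro p hp u x
    rw [key, key]
    have := hp u 1 x (homCoord (0 : Pt W))
    rw [one_smul] at this
    rw [this]; ring
  refine ⟨d, aeval s a, aeval s b, hh a ha, hh b hb, by rwa [hev], fun R hR => ?_⟩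
  rw [hev] at hR
  change f (R, 0) = _
  rw [hev, hev, h _ hR]

/-- The restriction to `C × {0}`, as a homomorphism of local rings. -/
noncomputable def restrictX (P : Pt W) : RegX W (P, 0) →+* RegC W P where
  toFun f := ⟨fun R => (f : Pt W × Pt W → ℂ) (R, 0), RegularAt.restrict f.2⟩
  map_one' := rfl
  map_mul' _ _ := rfl
  map_zero' := rfl
  map_add' _ _ := rfl

/-- Multiplication by `j ≠ 0` is not constant on `C`: it multiplies the coordinate by `j`, to first
order. -/
theorem exists_nsmul_ne_zero {t : Pt W → ℂ} (ht : IsCoordinate W t)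
    {Fg : MvPowerSeries (Fin 2) ℂ} (hFg : IsFormalGroupLaw W t Fg) {f : PowerSeries ℂ}
    (hf : IsLogarithm Fg f) {j : ℕ} (hj : j ≠ 0) : ∃ P : Pt W, j • P ≠ 0 := by
  by_contra! hc
  let Q : Pt W × Pt W := (0, 0)
  let v : annLattice Q := ⟨(1, 0), by simp [mem_annLattice, Q]⟩
  have h := truncSum_locV_zsmul_add ht hFg hf 2 v 0 j 0
  have e : ∀ x : RegX W Q, truncSum f 2 x = x := by
    intro x
    rw [truncSum, Finset.sum_range_succ, Finset.sum_range_one, hf.coeff_zero, hf.coeff_one]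
    simp
  rw [e, e, e] at h
  have h0 : locV ht ((j : ℤ) • v + (0 : ℤ) • (0 : annLattice Q)) = 0 := by
    apply Subtype.ext
    funext Q'
    change t _ = 0
    rw [← ht.zero]
    congr 1
    have : (((j : ℤ) • v + (0 : ℤ) • (0 : annLattice Q) : annLattice Q) : ℤ × ℤ) =
        ((j : ℤ), (0 : ℤ)) := by
      simp [v]
    rw [this]
    simp [hc]
  rw [h0, zero_smul, add_zero, zero_sub, neg_mem_iff] at h
  have h1 : locV ht v ∈ maxX Q ^ 2 := by
    have := Ideal.mul_mem_left _ (algebraMap ℂ (RegX W Q) (j : ℂ)⁻¹) h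
    rw [zsmul_eq_mul, ← mul_assoc] at this
    have e2 : algebraMap ℂ (RegX W Q) (j : ℂ)⁻¹ * ((j : ℤ) : RegX W Q) = 1 := by
      have : ((j : ℤ) : RegX W Q) = algebraMap ℂ (RegX W Q) (j : ℂ) := by simp
      rw [this, ← map_mul, inv_mul_cancel₀ (by exact_mod_cast hj), map_one]
    rwa [e2, one_mul] at this
  apply ht.first_order
  refine ⟨restrictX 0 (locV ht v), map_pow_le (restrictX (0 : Pt W))
    (J := RingHom.ker ((Pi.evalRingHom (fun _ : Pt W => ℂ) 0).comp
      (RegC W (0 : Pt W)).val.toRingHom)) (fun a ha => ha) h1, ?_⟩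
  funext R
  change t ((1 : ℤ) • R + (0 : ℤ) • (0 : Pt W)) = t R
  simp

/-- A homogeneous form that does not vanish identically on the affine part of `C` has finitely many
zeros on `C`: their first coordinates are zeros of the norm of the form, a polynomial. -/
theorem finite_zeros {p : MvPolynomial (Fin 3) ℂ} {P₀ : Pt W} (h0 : P₀ ≠ 0)
    (hp : evalC P₀ p ≠ 0) : {P : Pt W | evalC P p = 0}.Finite := by
  let R := WeierstrassCurve.Affine.CoordinateRing W
  let mk := WeierstrassCurve.Affine.CoordinateRing.mk W.toAffine
  let g : R := aeval (R := ℂ)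
    ![mk (Polynomial.C Polynomial.X), mk Polynomial.X, (1 : R)] p
  obtain ⟨α, β, hg⟩ := WeierstrassCurve.Affine.CoordinateRing.exists_smul_basis_eq g
  let N := Algebra.norm (Polynomial ℂ) g
  have hev : ∀ (x y : ℂ) (hxy : W.toAffine.Nonsingular x y),
      ∃ φ : R →+* ℂ, φ g = evalC (.some x y hxy : Pt W) p ∧
        ∀ q : Polynomial ℂ, φ (algebraMap (Polynomial ℂ) R q) = q.eval x := by
    intro x y hxy
    have heq : Polynomial.eval₂ (Polynomial.evalRingHom x) y W.toAffine.polynomial = 0 := by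
      have h2 := hxy.1
      rw [WeierstrassCurve.Affine.Equation, Polynomial.evalEval] at h2
      rw [Polynomial.eval₂_evalRingHom]
      exact h2
    let φ : R →+* ℂ := AdjoinRoot.lift (Polynomial.evalRingHom x) y heq
    have hC : ∀ q : Polynomial ℂ, φ (mk (Polynomial.C q)) = q.eval x := by
      intro q
      exact (AdjoinRoot.lift_of heq).trans rfl
    refine ⟨φ, ?_, hC⟩
    have hc : φ.comp (algebraMap ℂ R) = RingHom.id ℂ := by
      ext c
      have : algebraMap ℂ R c = mk (Polynomial.C (Polynomial.C c)) := rfl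
      rw [RingHom.comp_apply, this, hC, Polynomial.eval_C]; rfl
    change φ (aeval _ p) = eval _ p
    rw [MvPolynomial.map_aeval, hc]
    change eval _ p = eval _ p
    congr 2
    funext k
    fin_cases k
    · exact (hC _).trans Polynomial.eval_X
    · exact AdjoinRoot.lift_root heq
    · exact map_one φ
  have hN : N ≠ 0 := by
    intro hN
    have : Module.Finite (Polynomial ℂ) R :=
      Module.Finite.of_basis (WeierstrassCurve.Affine.CoordinateRing.basis W.toAffine)
    have hg0 : g = 0 := Algebra.norm_eq_zero_iff.mp hN
    rcases P₀ with _ | ⟨x, y, hxy⟩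
    · exact h0 rfl
    · obtain ⟨φ, h1, -⟩ := hev x y hxy
      rw [hg0, map_zero] at h1
      exact hp h1.symm
  have hdvd : g ∣ algebraMap (Polynomial ℂ) R N := by
    have h1 := WeierstrassCurve.Affine.CoordinateRing.coe_norm_smul_basis (W' := W.toAffine) α β
    rw [hg] at h1
    have h2 : mk (Polynomial.C α + Polynomial.C β * Polynomial.X) = g := by
      rw [← hg, WeierstrassCurve.Affine.CoordinateRing.smul,
        WeierstrassCurve.Affine.CoordinateRing.smul, mul_one, map_add, map_mul]
    exact Dvd.intro _ ((congrArg (· * _) h2).symm.trans ((map_mul mk _ _).symm.trans h1.symm))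
  have hroot : ∀ (x y : ℂ) (hxy : W.toAffine.Nonsingular x y),
      evalC (.some x y hxy : Pt W) p = 0 → N.eval x = 0 := by
    intro x y hxy h
    obtain ⟨φ, h1, h2⟩ := hev x y hxy
    obtain ⟨g', hg'⟩ := hdvd
    rw [← h2, hg', map_mul, h1, h, zero_mul]
  have hfin : (⋃ x ∈ (N.roots.toFinset : Set ℂ),
      {P : Pt W | ∃ (y : ℂ) (h : W.toAffine.Nonsingular x y), P = .some x y h}).Finite := by
    refine Set.Finite.biUnion (Finset.finite_toSet _) fun x _ => ?_
    by_cases hne : ∃ (y : ℂ), W.toAffine.Nonsingular x y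
    · obtain ⟨y, hy⟩ := hne
      refine (Set.toFinite {(.some x y hy : Pt W), -(.some x y hy : Pt W)}).subset ?_
      rintro _ ⟨y', hy', rfl⟩
      exact WeierstrassCurve.Affine.Point.X_eq_iff.mp rfl
    · refine Set.finite_empty.subset ?_
      rintro _ ⟨y', hy', rfl⟩
      exact hne ⟨y', hy'⟩
  refine (hfin.union (Set.finite_singleton (0 : Pt W))).subset ?_
  rintro (_ | ⟨x, y, hxy⟩) hP
  · exact Or.inr rfl
  · refine Or.inl ?_
    simp only [Set.mem_iUnion]
    refine ⟨x, ?_, y, hxy, rfl⟩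
    rw [Finset.mem_coe, Multiset.mem_toFinset, Polynomial.mem_roots hN]
    exact hroot x y hxy hP

theorem finite_torsion {t : Pt W → ℂ} (ht : IsCoordinate W t)
    {Fg : MvPowerSeries (Fin 2) ℂ} (hFg : IsFormalGroupLaw W t Fg) {f : PowerSeries ℂ}
    (hf : IsLogarithm Fg f) {j : ℕ} (hj : j ≠ 0) : {P : Pt W | j • P = 0}.Finite := by
  classical
  obtain ⟨P₀, hP₀⟩ := exists_nsmul_ne_zero ht hFg hf hj
  -- The function that is `0` on the `j`-torsion and `1` elsewhere is a quotient `a / b` near `P₀`, so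
  -- `a * b` vanishes at all `j`-torsion points but not at `P₀`.
  have hr : RegularAtC (fun R : Pt W => if R = 0 then (0 : ℂ) else 1)
      ((j : ℤ) • P₀ + (0 : ℤ) • (0 : Pt W)) := by
    apply regularAtC_indicator
    simpa using hP₀
  have h1 := (RegularAtC.comp_zsmul (Q := (P₀, 0)) (j : ℤ) 0 hr).restrict
  obtain ⟨d, a, b, -, -, hb, hab⟩ := h1
  have hz : ∀ R : Pt W, evalC R b ≠ 0 → (if j • R = 0 then (0 : ℂ) else 1) =
      evalC R a / evalC R b := by
    intro R hR
    have := hab R hR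
    simpa using this
  have ha : evalC P₀ a ≠ 0 := by
    intro ha
    have := hz P₀ hb
    rw [if_neg hP₀, ha, zero_div] at this
    exact one_ne_zero this
  refine (finite_zeros (p := a * b) (P₀ := P₀) (by rintro rfl; simp at hP₀) ?_).subset ?_
  · simpa [evalC] using And.intro ha hb
  · intro R hR
    have hR' : j • R = 0 := hR
    change evalC R (a * b) = 0
    have hm : evalC R (a * b) = evalC R a * evalC R b := by simp [evalC]
    rw [hm]
    by_cases h : evalC R b = 0
    · rw [h, mul_zero]
    · have := hz R h
      rw [if_pos hR', eq_comm, div_eq_zero_iff] at this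
      rw [this.resolve_right h, zero_mul]

/-- Every complex number is the first coordinate of a point of the curve. -/
theorem exists_equation (W : WeierstrassCurve ℂ) (x : ℂ) : ∃ y : ℂ, W.toAffine.Equation x y ∧
    (2 * y + W.a₁ * x + W.a₃) ^ 2 = 4 * x ^ 3 + W.b₂ * x ^ 2 + 2 * W.b₄ * x + W.b₆ := by
  obtain ⟨w, hw⟩ := IsAlgClosed.exists_pow_nat_eq
    (4 * x ^ 3 + W.b₂ * x ^ 2 + 2 * W.b₄ * x + W.b₆) (n := 2) (by norm_num)
  let y := (w - W.a₁ * x - W.a₃) / 2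
  have hyw : 2 * y + W.a₁ * x + W.a₃ = w := by simp only [y]; ring
  have h : (2 * y + W.a₁ * x + W.a₃) ^ 2 = 4 * x ^ 3 + W.b₂ * x ^ 2 + 2 * W.b₄ * x + W.b₆ := by
    rw [hyw, hw]
  refine ⟨y, ?_, h⟩
  rw [WeierstrassCurve.Affine.equation_iff]
  simp only [WeierstrassCurve.b₂, WeierstrassCurve.b₄, WeierstrassCurve.b₆] at h
  linear_combination h / 4

theorem exists_addOrderOf_two (W : WeierstrassCurve ℂ) [W.IsElliptic] :
    ∃ P : Pt W, addOrderOf P = 2 := by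
  let p : Polynomial ℂ := Polynomial.C 4 * Polynomial.X ^ 3 + Polynomial.C W.b₂ * Polynomial.X ^ 2 +
    Polynomial.C (2 * W.b₄) * Polynomial.X + Polynomial.C W.b₆
  have hp : p.degree ≠ 0 := by
    have : p.degree = 3 := Polynomial.degree_cubic (by norm_num)
    rw [this]; norm_num
  obtain ⟨x, hx⟩ := IsAlgClosed.exists_root p hp
  obtain ⟨y, hxy, h⟩ := exists_equation W x
  have h0 : 4 * x ^ 3 + W.b₂ * x ^ 2 + 2 * W.b₄ * x + W.b₆ = 0 := by
    simpa [p, Polynomial.IsRoot] using hx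
  rw [h0] at h
  have hy : y = W.toAffine.negY x y := by
    have := pow_eq_zero_iff (two_ne_zero) |>.mp h
    rw [WeierstrassCurve.Affine.negY]
    linear_combination this
  have hns := WeierstrassCurve.Affine.equation_iff_nonsingular.mp hxy
  refine ⟨.some x y hns, addOrderOf_eq_prime ?_ (WeierstrassCurve.Affine.Point.some_ne_zero hns)⟩
  rw [two_nsmul]
  exact WeierstrassCurve.Affine.Point.add_self_of_Y_eq hy

/-- The flexes of the curve, given by the zeros of the third division polynomial, have
order `3`. -/
theorem exists_addOrderOf_three (W : WeierstrassCurve ℂ) [W.IsElliptic] :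
    ∃ P : Pt W, addOrderOf P = 3 := by
  classical
  let p : Polynomial ℂ := Polynomial.C 3 * Polynomial.X ^ 4 + (Polynomial.C W.b₂ * Polynomial.X ^ 3 +
    Polynomial.C (3 * W.b₄) * Polynomial.X ^ 2 + Polynomial.C (3 * W.b₆) * Polynomial.X +
      Polynomial.C W.b₈)
  have hp : p.degree ≠ 0 := by
    have h3 : (Polynomial.C W.b₂ * Polynomial.X ^ 3 + Polynomial.C (3 * W.b₄) * Polynomial.X ^ 2 +
        Polynomial.C (3 * W.b₆) * Polynomial.X + Polynomial.C W.b₈).degree ≤ 3 :=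
      Polynomial.degree_cubic_le
    have h4 : (Polynomial.C (3 : ℂ) * Polynomial.X ^ 4).degree = 4 :=
      Polynomial.degree_C_mul_X_pow 4 (by norm_num)
    have : p.degree = 4 := by
      rw [← h4]
      apply Polynomial.degree_add_eq_left_of_degree_lt
      rw [h4]
      exact lt_of_le_of_lt h3 (by norm_num)
    rw [this]; norm_num
  obtain ⟨x, hx⟩ := IsAlgClosed.exists_root p hp
  have h0 : 3 * x ^ 4 + W.b₂ * x ^ 3 + 3 * W.b₄ * x ^ 2 + 3 * W.b₆ * x + W.b₈ = 0 := by
    have : 3 * x ^ 4 + (W.b₂ * x ^ 3 + 3 * W.b₄ * x ^ 2 + 3 * W.b₆ * x + W.b₈) = 0 := by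
      simpa [p, Polynomial.IsRoot] using hx
    linear_combination this
  obtain ⟨y, hxy, -⟩ := exists_equation W x
  have hns := WeierstrassCurve.Affine.equation_iff_nonsingular.mp hxy
  have heq := (WeierstrassCurve.Affine.equation_iff _ _).mp hxy
  -- The slope of the tangent at `(x, y)` is `N / D`; the vanishing of the division polynomial says
  -- that the first coordinate of the double of the point is `x` again.
  let N := 3 * x ^ 2 + 2 * W.a₂ * x + W.a₄ - W.a₁ * y
  let D := 2 * y + W.a₁ * x + W.a₃
  have hND : N ^ 2 + W.a₁ * N * D - (W.a₂ + 3 * x) * D ^ 2 = 0 := by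
    simp only [WeierstrassCurve.b₂, WeierstrassCurve.b₄, WeierstrassCurve.b₆,
      WeierstrassCurve.b₈] at h0
    simp only [N, D]
    linear_combination (-(W.a₁ ^ 2 + 4 * W.a₂ + 12 * x)) * heq - h0
  have hD : D ≠ 0 := by
    intro hD
    have hN : N = 0 := by
      rw [hD] at hND
      exact pow_eq_zero_iff (two_ne_zero) |>.mp (by linear_combination hND)
    rcases (WeierstrassCurve.Affine.nonsingular_iff' _ _).mp hns |>.2 with h | h
    · apply h
      simp only [N] at hN
      linear_combination -hN
    · exact h hD
  have hY : y ≠ W.toAffine.negY x y := by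
    intro h
    apply hD
    rw [WeierstrassCurve.Affine.negY] at h
    simp only [D]
    linear_combination h
  let P : Pt W := .some x y hns
  have hP : P ≠ 0 := WeierstrassCurve.Affine.Point.some_ne_zero hns
  refine ⟨P, addOrderOf_eq_prime ?_ hP⟩
  have h2 : P + P = _ := WeierstrassCurve.Affine.Point.add_self_of_Y_ne hY
  have hx2 : W.toAffine.addX x x (W.toAffine.slope x x y y) = x := by
    rw [WeierstrassCurve.Affine.slope_of_Y_ne rfl hY, WeierstrassCurve.Affine.addX]
    have e1 : y - W.toAffine.negY x y = D := by
      simp only [D, WeierstrassCurve.Affine.negY]; ring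
    rw [e1]
    change (N / D) ^ 2 + W.a₁ * (N / D) - W.a₂ - x - x = x
    field_simp
    linear_combination hND
  have h3 : P + P = P ∨ P + P = -P := by
    rw [h2]
    exact WeierstrassCurve.Affine.Point.X_eq_iff.mp hx2
  rcases h3 with h3 | h3
  · exact absurd (add_eq_left.mp h3) hP
  · rw [show (3 : ℕ) = 2 + 1 from rfl, add_nsmul, two_nsmul, one_nsmul, h3, neg_add_cancel]

/-! ### Functions on `C` with prescribed zeros and poles -/

/-- A linear form that vanishes on the affine part of `C` at `A` and `-A` only. -/
noncomputable def lineForm : Pt W → MvPolynomial (Fin 3) ℂ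
  | .zero => X 2
  | .some x _ _ => X 0 - C x * X 2

/-- A quadratic form that is, up to a factor independent of `A`, equal to `lineForm A` on `C`, and
vanishes at the origin only for `A = 0`. -/
noncomputable def conicForm : Pt W → MvPolynomial (Fin 3) ℂ
  | .zero => X 0 ^ 2
  | .some x _ _ => X 1 ^ 2 + C W.a₁ * X 0 * X 1 + C W.a₃ * X 1 * X 2 - C W.a₂ * X 0 ^ 2 -
      C W.a₄ * X 0 * X 2 - C W.a₆ * X 2 ^ 2 - C x * X 0 ^ 2

theorem isHomog_lineForm (A : Pt W) : IsHomog (lineForm A) 1 := by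
  intro u x
  rcases A with _ | ⟨a, b, h⟩ <;> simp [lineForm]
  ring

theorem isHomog_conicForm (A : Pt W) : IsHomog (conicForm A) 2 := by
  intro u x
  rcases A with _ | ⟨a, b, h⟩ <;> simp [conicForm] <;> ring

theorem lineForm_mul_conicForm (A B P : Pt W) :
    evalC P (lineForm A) * evalC P (conicForm B) =
      evalC P (lineForm B) * evalC P (conicForm A) := by
  have h := (WeierstrassCurve.Projective.equation_iff _).mp (homCoord_nonsingular P).1
  simp only [evalC]
  generalize homCoord P = x at *
  rcases A with _ | ⟨a, b, hA⟩ <;> rcases B with _ | ⟨c, d, hB⟩ <;>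
    simp only [lineForm, conicForm, map_sub, map_add, map_mul, map_pow, eval_X, eval_C]
  · linear_combination h
  · linear_combination -h
  · linear_combination (a - c) * -h

theorem lineForm_zero (A : Pt W) : evalC (0 : Pt W) (lineForm A) = 0 := by
  change evalC (.zero : Pt W) (lineForm A) = 0
  rcases A with _ | ⟨a, b, hA⟩ <;> simp [lineForm, evalC, homCoord]

theorem lineForm_eq_zero_iff {A P : Pt W} (hP : P ≠ 0) :
    evalC P (lineForm A) = 0 ↔ P = A ∨ P = -A := by
  rcases P with _ | ⟨x, y, h⟩
  · exact absurd rfl hP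
  · rcases A with _ | ⟨a, b, hA⟩
    · simp only [lineForm, evalC, homCoord, eval_X, Matrix.cons_val, one_ne_zero, false_iff]
      change ¬ (_ = (0 : Pt W) ∨ _ = -(0 : Pt W))
      rw [neg_zero, or_self]
      exact hP
    · rw [← WeierstrassCurve.Affine.Point.X_eq_iff]
      simp [lineForm, evalC, homCoord, sub_eq_zero]

theorem conicForm_zero_ne {A : Pt W} (hA : A ≠ 0) : evalC (0 : Pt W) (conicForm A) ≠ 0 := by
  change evalC (.zero : Pt W) (conicForm A) ≠ 0
  rcases A with _ | ⟨a, b, h⟩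
  · exact absurd rfl hA
  · simp [conicForm, evalC, homCoord]

open Classical in
/-- A function on `C` with zeros at `A`, `-A` and poles at `B`, `-B`. -/
noncomputable def ratioFn (A B P : Pt W) : ℂ :=
  if P = 0 then evalC P (conicForm A) / evalC P (conicForm B)
  else evalC P (lineForm A) / evalC P (lineForm B)

theorem regularAtC_ratioFn {A B : Pt W} (h1 : A ≠ B) (h2 : A ≠ -B) {P : Pt W} (hB : P ≠ B)
    (hB' : P ≠ -B) : RegularAtC (ratioFn A B) P := by
  by_cases hP : P = 0
  · subst hP
    refine ⟨2, _, _, isHomog_conicForm A, isHomog_conicForm B, conicForm_zero_ne hB.symm, ?_⟩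
    intro R hR
    rw [ratioFn]
    split_ifs with h0
    · rfl
    · have hL : evalC R (lineForm B) ≠ 0 := by
        intro hL
        have h3 := lineForm_mul_conicForm A B R
        rw [hL, zero_mul] at h3
        have h4 := (mul_eq_zero.mp h3).resolve_right hR
        rw [lineForm_eq_zero_iff h0] at h4 hL
        rcases h4 with rfl | rfl <;> rcases hL with hL | hL
        · exact h1 hL
        · exact h2 hL
        · exact h2 (by rw [← hL, neg_neg])
        · exact h1 (neg_inj.mp hL)
      rw [div_eq_div_iff hL hR, lineForm_mul_conicForm, mul_comm]
  · refine ⟨1, _, _, isHomog_lineForm A, isHomog_lineForm B, ?_, ?_⟩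
    · rw [Ne, lineForm_eq_zero_iff hP, not_or]; exact ⟨hB, hB'⟩
    · intro R hR
      rw [ratioFn, if_neg]
      rintro rfl
      exact hR (lineForm_zero B)

theorem ratioFn_self (A B : Pt W) : ratioFn A B A = 0 := by
  rw [ratioFn]
  split_ifs with h
  · subst h
    have : evalC (0 : Pt W) (conicForm (0 : Pt W)) = 0 := by
      change evalC (.zero : Pt W) (conicForm .zero) = 0
      simp [conicForm, evalC, homCoord]
    rw [this, zero_div]
  · rw [(lineForm_eq_zero_iff h).mpr (Or.inl rfl), zero_div]

theorem ratioFn_mul {A B P : Pt W} (hA : P ≠ A) (hA' : P ≠ -A) (hB : P ≠ B) (hB' : P ≠ -B) :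
    ratioFn A B P * ratioFn B A P = 1 := by
  rw [ratioFn, ratioFn]
  split_ifs with h
  · subst h
    have := conicForm_zero_ne hA.symm
    have := conicForm_zero_ne hB.symm
    field_simp
  · have h1 : evalC P (lineForm A) ≠ 0 := by
      rw [Ne, lineForm_eq_zero_iff h, not_or]; exact ⟨hA, hA'⟩
    have h2 : evalC P (lineForm B) ≠ 0 := by
      rw [Ne, lineForm_eq_zero_iff h, not_or]; exact ⟨hB, hB'⟩
    field_simp

/-- There is a point of order at most `3` whose order is different from two given numbers. -/
theorem exists_addOrderOf_ne [W.IsElliptic] (m n : ℕ) :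
    ∃ B : Pt W, 0 < addOrderOf B ∧ addOrderOf B ≠ m ∧ addOrderOf B ≠ n := by
  obtain ⟨P, hP⟩ := exists_addOrderOf_two W
  obtain ⟨R, hR⟩ := exists_addOrderOf_three W
  by_cases h1 : 1 ≠ m ∧ 1 ≠ n
  · exact ⟨0, by simp, by simpa using h1.1, by simpa using h1.2⟩
  by_cases h2 : 2 ≠ m ∧ 2 ≠ n
  · exact ⟨P, by omega, by rw [hP]; exact h2.1, by rw [hP]; exact h2.2⟩
  · exact ⟨R, by omega, by omega, by omega⟩

/-! ### Directions and finite subgroups -/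

theorem isClosed_Hsub (i : Dir) (j : ℕ+) : IsClosed (Hsub i j : Set Torus) := by
  have h : Continuous (fun z : Torus => z.1 ^ ((j : ℤ) • i.vec).1 * z.2 ^ ((j : ℤ) • i.vec).2) := by
    fun_prop
  exact isClosed_singleton.preimage h

theorem finite_circle_pow_eq_one {n : ℕ} (hn : n ≠ 0) : {x : Circle | x ^ n = 1}.Finite := by
  refine Set.Finite.subset (Set.Finite.preimage
    (Circle.coe_injective.injOn) (Polynomial.nthRootsFinset n (1 : ℂ)).finite_toSet)
    fun x hx => ?_
  rw [Set.mem_preimage, Finset.mem_coe, Polynomial.mem_nthRootsFinset (Nat.pos_of_ne_zero hn)]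
  exact congrArg (fun z : Circle => (z : ℂ)) hx

theorem finiteIndex_Hsub (i : Dir) (m j : ℕ+) : ((Hsub i m).subgroupOf (Hsub i j)).FiniteIndex := by
  let φ : Hsub i j →* Circle := (chi i.vec).comp (Hsub i j).subtype
  have hr : Finite φ.range := by
    refine ((finite_circle_pow_eq_one j.ne_zero).subset ?_).to_subtype
    rintro _ ⟨z, rfl⟩
    exact mem_Hsub.mp z.2
  have h1 : φ.ker.FiniteIndex := ⟨by
    rw [Subgroup.index_ker]; exact Nat.card_pos.ne'⟩
  refine Subgroup.finiteIndex_of_le (H := φ.ker) ?_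
  intro z hz
  have hz' : chi i.vec z = 1 := hz
  rw [Subgroup.mem_subgroupOf, mem_Hsub, hz', one_pow]

/-- The character `z_i` is surjective. -/
theorem exists_chi_eq (i : Dir) (w : Circle) : ∃ z, chi i.vec z = w := by
  obtain ⟨u, v, huv⟩ : IsCoprime i.vec.1 i.vec.2 := i.2.1
  refine ⟨(w ^ u, w ^ v), ?_⟩
  rw [chi_apply, ← zpow_mul, ← zpow_mul, ← zpow_add, huv, zpow_one]

theorem exists_orderOf_circle (j : ℕ+) : ∃ w : Circle, orderOf w = j := by
  refine ⟨Circle.exp (2 * Real.pi * (1 / j)), ?_⟩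
  refine (orderOf_eq_iff j.pos).mpr ⟨?_, ?_⟩
  · rw [← Circle.exp_nsmul]
    have : (j : ℕ) • (2 * Real.pi * (1 / (j : ℝ))) = 2 * Real.pi * ((1 : ℤ) : ℝ) := by
      have : ((j : ℕ) : ℝ) ≠ 0 := by positivity
      rw [nsmul_eq_mul]; field_simp; simp
    rw [this, circle_exp_eq_one_iff]
    exact ⟨1, rfl⟩
  · intro m hm h0 h
    rw [← Circle.exp_nsmul] at h
    have e : m • (2 * Real.pi * (1 / (j : ℝ))) = 2 * Real.pi * ((m : ℝ) / j) := by
      rw [nsmul_eq_mul]; ring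
    rw [e, circle_exp_eq_one_iff] at h
    obtain ⟨n, hn⟩ := h
    have hj : ((j : ℕ) : ℝ) ≠ 0 := by positivity
    rw [div_eq_iff hj] at hn
    have hn' : (m : ℤ) = n * (j : ℕ) := by exact_mod_cast hn
    have hdvd : (j : ℕ) ∣ m := by
      rw [← Int.natCast_dvd_natCast, hn']; exact Dvd.intro_left n rfl
    exact absurd (Nat.le_of_dvd h0 hdvd) (not_le.mpr hm)

/-- The divisor `D_ij` consists of the points whose projection has order exactly `j`. -/
theorem mem_Dset_iff {i : Dir} {j : ℕ+} {Q : Pt W × Pt W} :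
    Q ∈ Dset W (i, j) ↔ addOrderOf (proj i Q) = j := by
  refine ⟨fun hQ => ?_, mem_Dset⟩
  have h0 : (j : ℕ) • proj i Q = 0 := proj_eq_zero le_rfl hQ
  have hdvd := addOrderOf_dvd_of_nsmul_eq_zero h0
  have hpos : 0 < addOrderOf (proj i Q) := Nat.pos_of_dvd_of_pos hdvd j.pos
  by_contra hne
  let m : ℕ+ := ⟨addOrderOf (proj i Q), hpos⟩
  apply hQ.2
  simp only [Set.mem_iUnion]
  refine ⟨Hsub i m, ⟨isClosed_Hsub i m, ?_, finiteIndex_Hsub i m j⟩, ?_⟩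
  · refine lt_of_le_of_ne ?_ ?_
    · intro z hz
      rw [mem_Hsub] at hz ⊢
      obtain ⟨k, hk⟩ := hdvd
      rw [hk, pow_mul]
      change (chi i.vec z ^ (m : ℕ)) ^ k = 1
      rw [hz, one_pow]
    · intro h
      obtain ⟨w, hw⟩ := exists_orderOf_circle j
      obtain ⟨z, rfl⟩ := exists_chi_eq i w
      have hz : z ∈ Hsub i m := by
        rw [h, mem_Hsub]
        rw [← hw, pow_orderOf_eq_one]
      rw [mem_Hsub] at hz
      have h1 := orderOf_dvd_of_pow_eq_one hz
      rw [hw] at h1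
      exact hne (Nat.dvd_antisymm hdvd h1)
  · intro v hv
    obtain ⟨k, rfl⟩ := perp_ker (smul_ne_zero (by positivity) i.vec_ne_zero) hv
    have h1 : ((m : ℕ) : ℤ) • proj i Q = 0 := by
      rw [natCast_zsmul]; exact addOrderOf_nsmul_eq_zero _
    rw [smul_smul, zsmul_vec, mul_zsmul', zsmul_comm, h1, zsmul_zero]

theorem zClosed_Dset (i : Dir) {j : ℕ+} (hfin : {P : Pt W | (j : ℕ) • P = 0}.Finite) :
    ZClosed (Dset W (i, j)) := by
  have : Dset W (i, j) = ⋃ A ∈ {A : Pt W | addOrderOf A = j}, {Q | proj i Q = A} := by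
    ext Q
    rw [mem_Dset_iff]
    simp
  rw [this]
  refine zClosed_biUnion (hfin.subset ?_) fun A _ => zClosed_preimage _ _ A
  intro A hA
  have hA' : addOrderOf A = j := hA
  change (j : ℕ) • A = 0
  rw [← hA']; exact addOrderOf_nsmul_eq_zero A

/-- Two different projections together have finite fibres. -/
theorem finite_proj_inter (hfin : ∀ j : ℕ, j ≠ 0 → {P : Pt W | j • P = 0}.Finite) {i k : Dir}
    (hik : i ≠ k) {S T : Set (Pt W)} (hS : S.Finite) (hT : T.Finite) :
    {Q : Pt W × Pt W | proj i Q ∈ S ∧ proj k Q ∈ T}.Finite := by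
  let d := i.vec.1 * k.vec.2 - i.vec.2 * k.vec.1
  have hd : d.natAbs ≠ 0 := Int.natAbs_ne_zero.mpr (Dir.det_ne_zero hik)
  have hker : {Q : Pt W × Pt W | proj i Q = 0 ∧ proj k Q = 0}.Finite := by
    refine ((hfin _ hd).prod (hfin _ hd)).subset ?_
    rintro ⟨P, P'⟩ ⟨h1, h2⟩
    simp only [proj] at h1 h2
    have e1 : d • P = k.vec.2 • (i.vec.1 • P + i.vec.2 • P') -
        i.vec.2 • (k.vec.1 • P + k.vec.2 • P') := by
      simp only [d]; module
    have e2 : d • P' = i.vec.1 • (k.vec.1 • P + k.vec.2 • P') -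
        k.vec.1 • (i.vec.1 • P + i.vec.2 • P') := by
      simp only [d]; module
    rw [h1, h2, zsmul_zero, zsmul_zero, sub_zero] at e1 e2
    exact ⟨natAbs_nsmul_eq_zero.mpr e1, natAbs_nsmul_eq_zero.mpr e2⟩
  have := (hS.prod hT).preimage' (f := fun Q : Pt W × Pt W => (proj i Q, proj k Q)) ?_
  · exact this
  · rintro ⟨A, B⟩ -
    by_cases hne : ∃ Q₀ : Pt W × Pt W, (proj i Q₀, proj k Q₀) = (A, B)
    · obtain ⟨Q₀, h0⟩ := hne
      refine (hker.image (fun Q => Q + Q₀)).subset ?_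
      intro Q hQ
      have hQ' : (proj i Q, proj k Q) = (proj i Q₀, proj k Q₀) := by rw [h0]; exact hQ
      rw [Prod.mk.injEq] at hQ'
      refine ⟨Q - Q₀, ⟨?_, ?_⟩, sub_add_cancel _ _⟩
      · rw [← sub_eq_zero.mpr hQ'.1]; simp only [proj, Prod.fst_sub, Prod.snd_sub]; module
      · rw [← sub_eq_zero.mpr hQ'.2]; simp only [proj, Prod.fst_sub, Prod.snd_sub]; module
    · refine Set.finite_empty.subset ?_
      intro Q hQ
      exact hne ⟨Q, hQ⟩

theorem finite_Xbar (hfin : ∀ j : ℕ, j ≠ 0 → {P : Pt W | j • P = 0}.Finite) (σ : Splitting)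
    (F : FinSub) : (Xbar W F.1).Finite :=
  (finite_proj_inter hfin (σ.ne F) (hfin _ (nIdx F (σ.A F)).ne_zero)
    (hfin _ (nIdx F (σ.B F)).ne_zero)).subset fun _ hQ =>
      ⟨proj_eq_zero (F.le_Hsub _) hQ, proj_eq_zero (F.le_Hsub _) hQ⟩

/-- Every character is a multiple of the character of a direction. -/
theorem exists_dir (v : ℤ × ℤ) : ∃ (k : Dir) (m : ℤ), v = m • k.vec := by
  by_cases hv : v = 0
  · exact ⟨⟨(1, 0), isCoprime_one_left, Or.inr rfl⟩, 0, by rw [hv, zero_smul]⟩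
  obtain ⟨a, b⟩ := v
  have hg : Int.gcd a b ≠ 0 := by
    rw [Ne, Int.gcd_eq_zero_iff]
    rintro ⟨rfl, rfl⟩; exact hv rfl
  obtain ⟨a', b', hco, ha, hb⟩ := Int.exists_gcd_one (Nat.pos_of_ne_zero hg)
  have hco' : IsCoprime a' b' := Int.isCoprime_iff_gcd_eq_one.mpr hco
  rcases lt_trichotomy b' 0 with h | h | h
  · refine ⟨⟨(-a', -b'), hco'.neg_neg, Or.inl (neg_pos.mpr h)⟩, -(Int.gcd a b : ℤ), ?_⟩
    ext
    · simp [Dir.vec]; linarith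
    · simp [Dir.vec]; linarith
  · subst h
    refine ⟨⟨(1, 0), isCoprime_one_left, Or.inr rfl⟩, a, ?_⟩
    ext
    · simp [Dir.vec]
    · simp [Dir.vec]; linarith
  · refine ⟨⟨(a', b'), hco', Or.inl h⟩, (Int.gcd a b : ℤ), ?_⟩
    ext
    · simp [Dir.vec]; linarith
    · simp [Dir.vec]; linarith

theorem FinSub.isCyclic_map (F : FinSub) (i : Dir) : IsCyclic (F.1.map (chi i.vec)) := by
  have := F.finite_map i
  exact isCyclic_of_injective_ringHom ((Circle.coeHom).comp (F.1.map (chi i.vec)).subtype)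
    (Circle.coe_injective.comp Subtype.val_injective)

/-- The number `n_i(F)` is the least `m ≥ 1` for which `z_i ^ m` is trivial on `F`. -/
theorem zsmul_vec_mem_perp {F : FinSub} {i : Dir} {m : ℤ} :
    m • i.vec ∈ perp F.1 ↔ (nIdx F i : ℤ) ∣ m := by
  constructor
  · intro h
    have := F.finite_map i
    obtain ⟨g, hg⟩ := (F.isCyclic_map i).exists_generator
    have h1 : orderOf g = nIdx F i := orderOf_eq_card_of_forall_mem_zpowers hg
    rw [← h1, orderOf_dvd_iff_zpow_eq_one]
    obtain ⟨z, hz, hzg⟩ := g.2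
    apply Subtype.ext
    rw [Subgroup.coe_zpow, ← hzg, ← chi_smul]
    exact h z hz
  · rintro ⟨k, rfl⟩
    rw [mul_comm, mul_smul]
    exact Submodule.smul_mem _ _ (mem_perp_F F i)

/-- A point all of whose projections have the orders prescribed by `F` is a point of `Xbar F`. -/
theorem mem_Xbar (σ : Splitting) {F : FinSub} {Q : Pt W × Pt W}
    (h : ∀ k, addOrderOf (proj k Q) = nIdx F k) : Q ∈ Xbar W F.1 := by
  have key : ∀ v : ℤ × ℤ, v.1 • Q.1 + v.2 • Q.2 = 0 ↔ v ∈ perp F.1 := by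
    intro v
    obtain ⟨k, m, rfl⟩ := exists_dir v
    rw [zsmul_vec, zsmul_vec_mem_perp, ← h k, addOrderOf_dvd_iff_zsmul_eq_zero]
  refine ⟨fun v hv => (key v).mpr hv, ?_⟩
  simp only [Set.mem_iUnion, not_exists]
  rintro K ⟨-, hlt, -⟩ hQ
  have hKfin : Finite K := by
    have := F.2
    exact Finite.of_injective _ (Subgroup.inclusion_injective hlt.le)
  let K' : FinSub := ⟨K, hKfin⟩
  apply hlt.not_ge
  intro z hz
  have hm : ∀ i : Dir, z ∈ Hsub i (nIdx K' i) := fun i =>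
    (key _).mp (hQ _ (mem_perp_F K' i)) z hz
  have := σ.eq_inf K'
  change K = _ at this
  rw [this]
  exact Subgroup.mem_inf.mpr ⟨hm _, hm _⟩

/-- A torsion point outside `Xbar F` lies on a divisor along which elements of `𝒪_F` may have
poles. -/
theorem exists_offF_of_not_mem_Xbar (σ : Splitting) {F : FinSub} {Q : Pt W × Pt W}
    (hQ : Q ∉ Xbar W F.1) {i k : Dir} (hik : i ≠ k) (hi : 0 < addOrderOf (proj i Q))
    (hk : 0 < addOrderOf (proj k Q)) : ∃ s ∈ offF F, Q ∈ Dset W s := by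
  obtain ⟨l, hl⟩ : ∃ l, addOrderOf (proj l Q) ≠ nIdx F l := by
    by_contra! h; exact hQ (mem_Xbar σ h)
  have hpos : 0 < addOrderOf (proj l Q) := by
    let d := i.vec.1 * k.vec.2 - i.vec.2 * k.vec.1
    have hd : d ≠ 0 := Dir.det_ne_zero hik
    rw [addOrderOf_pos_iff] at hi hk ⊢
    have h1 : IsOfFinAddOrder (d • proj l Q) := by
      have : d • proj l Q = (l.vec.1 * k.vec.2 - l.vec.2 * k.vec.1) • proj i Q +
          (l.vec.2 * i.vec.1 - l.vec.1 * i.vec.2) • proj k Q := by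
        simp only [d, proj]; module
      rw [this]
      exact hi.zsmul.add hk.zsmul
    obtain ⟨n, hn, h2⟩ := isOfFinAddOrder_iff_nsmul_eq_zero.mp h1
    refine isOfFinAddOrder_iff_zsmul_eq_zero.mpr ⟨n * d, mul_ne_zero (by omega) hd, ?_⟩
    rw [mul_smul, natCast_zsmul, h2]
  exact ⟨(l, ⟨_, hpos⟩), fun h => hl (congrArg PNat.val h), mem_Dset rfl⟩

/-! ### The standard charts -/

/-- The linear form `Z` (for `true`), whose only zero on `C` is the origin, or
`2 Y + a₁ X + a₃ Z` (for `false`), whose zeros on `C` are the points of order two. -/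
noncomputable def coordForm (W : WeierstrassCurve ℂ) : Bool → Fin 3 → ℂ
  | true => ![0, 0, 1]
  | false => ![W.a₁, 2, W.a₃]

/-- The order of the points of `C` at which `coordForm` vanishes. -/
def coordOrd : Bool → ℕ+
  | true => 1
  | false => 2

theorem lin_coordForm_eq_zero_iff (c : Bool) (P : Pt W) :
    lin (coordForm W c) P = 0 ↔ addOrderOf P = coordOrd c := by
  cases c
  · have h2 : addOrderOf P = (coordOrd false : ℕ+) ↔ P ≠ 0 ∧ P = -P := by
      change addOrderOf P = 2 ↔ _
      constructor
      · intro h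
        refine ⟨?_, ?_⟩
        · rintro rfl; simp at h
        · rw [eq_neg_iff_add_eq_zero, ← two_nsmul, ← h, addOrderOf_nsmul_eq_zero]
      · rintro ⟨h0, h⟩
        refine addOrderOf_eq_prime ?_ h0
        rw [two_nsmul, ← eq_neg_iff_add_eq_zero]; exact h
    rw [h2]
    rcases P with _ | ⟨x, y, h⟩
    · have : ¬ ((.zero : Pt W) ≠ 0 ∧ (.zero : Pt W) = -.zero) := fun h => h.1 rfl
      simp [lin, coordForm, homCoord, Fin.sum_univ_three, this]
    · rw [WeierstrassCurve.Affine.Point.neg_some, WeierstrassCurve.Affine.Point.some.injEq]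
      simp only [lin, coordForm, homCoord, Fin.sum_univ_three, Matrix.cons_val,
        WeierstrassCurve.Affine.negY, true_and, ne_eq,
        WeierstrassCurve.Affine.Point.some_ne_zero h, not_false_eq_true]
      constructor <;> intro h <;> linear_combination h
  · change _ ↔ addOrderOf P = 1
    rw [AddMonoid.addOrderOf_eq_one_iff]
    rcases P with _ | ⟨x, y, h⟩
    · simp only [lin, coordForm, homCoord, Fin.sum_univ_three, Matrix.cons_val]
      simp only [mul_zero, zero_mul, add_zero, true_iff]; rfl
    · simp [lin, coordForm, homCoord, Fin.sum_univ_three]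

theorem exists_mem_chartDom (Q : Pt W × Pt W) :
    ∃ c d : Bool, Q ∈ chartDom W (coordForm W c, coordForm W d) := by
  have h : ∀ P : Pt W, ∃ c, lin (coordForm W c) P ≠ 0 := by
    intro P
    by_cases h : addOrderOf P = 1
    · refine ⟨false, ?_⟩
      rw [Ne, lin_coordForm_eq_zero_iff, h]
      decide
    · refine ⟨true, ?_⟩
      rw [Ne, lin_coordForm_eq_zero_iff]
      exact h
  obtain ⟨c, hc⟩ := h Q.1
  obtain ⟨d, hd⟩ := h Q.2
  exact ⟨c, d, hc, hd⟩

/-! ### Germs of functions -/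

/-- The germ of a function, in the ring containing `𝒦`. -/
abbrev germ (g : Pt W × Pt W → ℂ) : GermX W := Ideal.Quotient.mk (nullIdeal W) g

theorem germ_eq {g h : Pt W × Pt W → ℂ} {S : Finset (Dir × ℕ+)}
    (H : ∀ Q ∉ Dunion W S, g Q = h Q) : germ g = germ h := by
  rw [germ, germ, Ideal.Quotient.mk_eq_mk_iff_sub_mem]
  exact ⟨S, fun Q hQ => by rw [Pi.sub_apply, H Q hQ, sub_self]⟩

theorem KK.val_injective : Function.Injective (KK.val W) := Subtype.val_injective

theorem KK.exists_rep (x : KK W) : ∃ g S, RegOff g S ∧ germ g = KK.val W x := by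
  obtain ⟨g, S, -, hg, h⟩ := x.2
  exact ⟨g, S, hg, h⟩

theorem mem_Dunion {S : Finset (Dir × ℕ+)} {Q : Pt W × Pt W} :
    Q ∈ Dunion W S ↔ ∃ s ∈ S, Q ∈ Dset W s := by
  simp [Dunion]

theorem zClosed_Dunion (hD : ∀ s : Dir × ℕ+, ZClosed (Dset W s)) (S : Finset (Dir × ℕ+)) :
    ZClosed (Dunion W S) := by
  have := zClosed_biUnion S.finite_toSet (Z := Dset W) fun s _ => hD s
  simpa [Dunion] using this

/-- The polynomials that vanish on `Z` in the chart `l`. -/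
def vanPoly (W : WeierstrassCurve ℂ) (l : (Fin 3 → ℂ) × (Fin 3 → ℂ)) (Z : Set (Pt W × Pt W)) :
    Ideal Poly where
  carrier := {p | ∀ Q ∈ chartDom W l, Q ∈ Z → pol W l p Q = 0}
  zero_mem' := fun Q _ _ => by simp
  add_mem' := fun {p q} hp hq Q hQ hZ => by
    rw [map_add, Pi.add_apply, hp Q hQ hZ, hq Q hQ hZ, add_zero]
  smul_mem' := fun c p hp Q hQ hZ => by
    rw [smul_eq_mul, map_mul, Pi.mul_apply, hp Q hQ hZ, mul_zero]

/-- The polynomials that are denominators of `g` in the chart `l`. -/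
def denIdeal (l : (Fin 3 → ℂ) × (Fin 3 → ℂ)) (g : Pt W × Pt W → ℂ) : Ideal Poly where
  carrier := {b | ∃ a, ∀ Q ∈ chartDom W l, pol W l b Q * g Q = pol W l a Q}
  zero_mem' := ⟨0, fun Q _ => by simp⟩
  add_mem' := by
    rintro b b' ⟨a, h⟩ ⟨a', h'⟩
    exact ⟨a + a', fun Q hQ => by
      rw [map_add, map_add, Pi.add_apply, Pi.add_apply, add_mul, h Q hQ, h' Q hQ]⟩
  smul_mem' := by
    rintro c b ⟨a, h⟩
    exact ⟨c * a, fun Q hQ => by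
      rw [smul_eq_mul, map_mul, map_mul, Pi.mul_apply, Pi.mul_apply, mul_assoc, h Q hQ]⟩

/-- By the Nullstellensatz, high powers of the ideal of the polar divisors of `g` consist of
denominators of `g`. -/
theorem exists_pow_le_denIdeal [W.IsElliptic] (l : (Fin 3 → ℂ) × (Fin 3 → ℂ))
    {g : Pt W × Pt W → ℂ} {S : Finset (Dir × ℕ+)} (hg : RegOff g S) :
    ∃ n, vanPoly W l (Dunion W S) ^ n ≤ denIdeal l g := by
  have h : vanPoly W l (Dunion W S) ≤ (denIdeal l g).radical := by
    intro p hp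
    rw [← vanishingIdeal_zeroLocus_eq_radical (K := ℂ), mem_vanishingIdeal_iff]
    intro z hz
    rw [mem_zeroLocus_iff] at hz
    obtain ⟨Q, hQ, rfl⟩ := exists_chart_eq l z (fun p h0 => hz p ⟨0, fun Q hQ => by
      rw [h0 Q hQ, map_zero]; simp⟩)
    by_cases hS : Q ∈ Dunion W S
    · exact (pol_apply l p Q).symm.trans (hp Q hQ hS)
    · obtain ⟨a, b, hb, hab⟩ := (regularAt_iff hQ).mp (hg Q hS)
      exact absurd ((pol_apply l b Q).trans (hz b ⟨a, hab⟩)) hb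
  obtain ⟨n, hn⟩ := (denIdeal l g).exists_radical_pow_le_of_fg
    (IsNoetherian.noetherian _)
  exact ⟨n, (Ideal.pow_right_mono h n).trans hn⟩

/-- The elements of a power of a vanishing ideal are, away from finitely many of the admissible
polar divisors, locally quotients of polynomials whose numerator lies in the same power of the
vanishing ideal in the chart. -/
theorem exists_rep_of_mem_pow (hD : ∀ s : Dir × ℕ+, ZClosed (Dset W s)) {A : Set (Dir × ℕ+)}
    {Z Z' : Set (Pt W × Pt W)} {T₀ : Finset (Dir × ℕ+)} (hT₀ : ↑T₀ ⊆ A)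
    (hZ : Z' ⊆ Z ∪ Dunion W T₀) {n : ℕ} {r : OO W A} (hr : r ∈ vanIdeal W A Z ^ n) :
    ∃ (h : Pt W × Pt W → ℂ) (T : Finset (Dir × ℕ+)), ↑T ⊆ A ∧ RegOff h T ∧
      germ h = KK.val W r ∧ ∀ l, ∀ Q ∈ chartDom W l, Q ∉ Dunion W T →
        ∃ b : Poly, pol W l b Q ≠ 0 ∧ ∃ a ∈ vanPoly W l Z' ^ n,
          ∀ Q' ∈ chartDom W l, pol W l b Q' * h Q' = pol W l a Q' := by
  classical
  induction n generalizing r with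
  | zero =>
    obtain ⟨h, T, hT, hh, hr'⟩ := r.2
    refine ⟨h, T, hT, hh, hr', fun l Q hQ hQT => ?_⟩
    obtain ⟨a, b, hb, hab⟩ := (regularAt_iff hQ).mp (hh Q hQT)
    exact ⟨b, hb, a, by simp, hab⟩
  | succ n ih =>
    rw [pow_succ] at hr
    refine Submodule.mul_induction_on hr ?_ ?_
    · intro x hx y hy
      obtain ⟨h, T, hT, hh, hx', H⟩ := ih hx
      obtain ⟨h', T', hT', hh', hy', hz⟩ := hy
      refine ⟨h * h', T ∪ (T' ∪ T₀), by simp [hT, hT', hT₀], fun Q hQ =>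
        (hh.mono Finset.subset_union_left Q hQ).mul (hh'.mono (Finset.subset_union_left.trans
          Finset.subset_union_right) Q hQ), ?_, ?_⟩
      · exact (map_mul _ _ _).trans (congrArg₂ (· * ·) hx' hy')
      · intro l Q hQ hQT
        have h1 : Q ∉ Dunion W T := fun h0 => hQT (Dunion_mono Finset.subset_union_left h0)
        have h2 : Q ∉ Dunion W (T' ∪ T₀) := fun h0 =>
          hQT (Dunion_mono Finset.subset_union_right h0)
        have h3 : Q ∉ Dunion W T' := fun h0 => h2 (Dunion_mono Finset.subset_union_left h0)
        obtain ⟨b, hb, a, ha, hab⟩ := H l Q hQ h1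
        obtain ⟨a', b', hb', hab'⟩ := (regularAt_iff hQ).mp (hh' Q h3)
        obtain ⟨e, he, hez⟩ := (zClosed_Dunion hD (T' ∪ T₀)).exists_poly hQ h2
        refine ⟨b * (b' * e), ?_, a * (a' * e), ?_, ?_⟩
        · rw [map_mul, map_mul]; exact mul_ne_zero hb (mul_ne_zero hb' he)
        · rw [pow_succ]
          refine Ideal.mul_mem_mul ha fun Q' hQ' hZQ => ?_
          rw [map_mul, Pi.mul_apply]
          by_cases h4 : Q' ∈ Dunion W (T' ∪ T₀)
          · rw [hez Q' hQ' h4, mul_zero]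
          · have h5 : Q' ∈ Z := (hZ hZQ).resolve_right fun h0 =>
              h4 (Dunion_mono Finset.subset_union_right h0)
            have h6 : Q' ∉ Dunion W T' := fun h0 => h4 (Dunion_mono Finset.subset_union_left h0)
            rw [← hab' Q' hQ', hz Q' h5 h6]; ring
        · intro Q' hQ'
          simp only [map_mul, Pi.mul_apply]
          rw [← hab Q' hQ', ← hab' Q' hQ']; ring
    · rintro x y ⟨h, T, hT, hh, hx, H⟩ ⟨h', T', hT', hh', hy, H'⟩
      refine ⟨h + h', T ∪ T', by simp [hT, hT'], fun Q hQ =>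
        (hh.mono Finset.subset_union_left Q hQ).add (hh'.mono Finset.subset_union_right Q hQ),
        ?_, ?_⟩
      · exact (map_add _ _ _).trans (congrArg₂ (· + ·) hx hy)
      · intro l Q hQ hQT
        obtain ⟨b, hb, a, ha, hab⟩ := H l Q hQ
          fun h0 => hQT (Dunion_mono Finset.subset_union_left h0)
        obtain ⟨b', hb', a', ha', hab'⟩ := H' l Q hQ
          fun h0 => hQT (Dunion_mono Finset.subset_union_right h0)
        refine ⟨b * b', ?_, b' * a + b * a', ?_, ?_⟩
        · rw [map_mul]; exact mul_ne_zero hb hb'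
        · exact Ideal.add_mem _ (Ideal.mul_mem_left _ _ ha) (Ideal.mul_mem_left _ _ ha')
        · intro Q' hQ'
          simp only [map_mul, map_add, Pi.mul_apply, Pi.add_apply]
          rw [← hab Q' hQ', ← hab' Q' hQ']; ring

/-- The order of the pole of an element of `𝒦` along a divisor is bounded. -/
theorem exists_pow_mul_mem_OD [W.IsElliptic] (hD : ∀ s : Dir × ℕ+, ZClosed (Dset W s)) (i : Dir)
    (j : ℕ+) (x : KK W) : ∃ n, ∀ r ∈ mD W i j ^ n, (r : KK W) * x ∈ OD W i j := by
  classical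
  obtain ⟨g, S, hg, hx⟩ := x.exists_rep
  choose N hN using fun c d : Bool =>
    exists_pow_le_denIdeal (W := W) (coordForm W c, coordForm W d) hg
  let n := ∑ c, ∑ d, N c d
  have hn : ∀ c d, N c d ≤ n := fun c d =>
    (Finset.single_le_sum (f := fun d => N c d) (fun _ _ => Nat.zero_le _)
      (Finset.mem_univ d)).trans
    (Finset.single_le_sum (f := fun c => ∑ d, N c d) (fun _ _ => Nat.zero_le _)
      (Finset.mem_univ c))
  refine ⟨n, fun r hr => ?_⟩
  obtain ⟨h, T, hT, hh, hr', H⟩ := exists_rep_of_mem_pow hD (Z' := Dunion W S)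
    (T₀ := S.filter (· ≠ (i, j))) (A := offD i j) (fun s hs => by
      simp only [Finset.coe_filter, Set.mem_ofPred_eq] at hs; exact hs.2) (by
      intro Q hQ
      obtain ⟨s, hs, hQs⟩ := mem_Dunion.mp hQ
      by_cases h : s = (i, j)
      · exact Or.inl (h ▸ hQs)
      · exact Or.inr (mem_Dunion.mpr ⟨s, Finset.mem_filter.mpr ⟨hs, h⟩, hQs⟩)) hr
  refine ⟨h * g, T, hT, fun Q hQ => ?_, ?_⟩
  · obtain ⟨c, d, hQc⟩ := exists_mem_chartDom Q
    obtain ⟨b, hb, a, ha, hab⟩ := H _ Q hQc hQ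
    obtain ⟨a', ha'⟩ := hN c d (Ideal.pow_le_pow_right (hn c d) ha)
    refine (regularAt_iff hQc).mpr ⟨a', b, hb, fun Q' hQ' => ?_⟩
    rw [Pi.mul_apply, ← mul_assoc, hab Q' hQ', ha' Q' hQ']
  · exact (map_mul _ _ _).trans (congrArg₂ (· * ·) hr' hx)

theorem torsionPart_H1_eq_top [W.IsElliptic] (hD : ∀ s : Dir × ℕ+, ZClosed (Dset W s)) (i : Dir)
    (j : ℕ+) : torsionPart (mD W i j) (H1 W i j) = ⊤ := by
  rw [eq_top_iff]
  rintro x -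
  obtain ⟨y, rfl⟩ := Submodule.Quotient.mk_surjective _ x
  obtain ⟨n, hn⟩ := exists_pow_mul_mem_OD hD i j y
  exact ⟨n, fun r hr => (Submodule.Quotient.mk_eq_zero _).mpr (hn r hr)⟩

/-! ### The rings `𝒪_F` and the Nullstellensatz -/

theorem OO.ext_val {A : Set (Dir × ℕ+)} {x y : OO W A} (h : KK.val W x = KK.val W y) : x = y :=
  Subtype.ext (KK.val_injective h)

/-- The element of `𝒪_A` given by a regular function on the complement of divisors in `A`. -/
def OO.ofFun {A : Set (Dir × ℕ+)} {g : Pt W × Pt W → ℂ} {S : Finset (Dir × ℕ+)} (hS : ↑S ⊆ A)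
    (hg : RegOff g S) : OO W A :=
  ⟨⟨germ g, g, S, Set.subset_univ _, hg, rfl⟩, g, S, hS, hg, rfl⟩

/-- The direction of the first projection. -/
def dirFst : Dir := ⟨(1, 0), isCoprime_one_left, Or.inr rfl⟩

/-- The direction of the second projection. -/
def dirSnd : Dir := ⟨(0, 1), isCoprime_one_right, Or.inl one_pos⟩

/-- The choice of a linear form whose zeros on `C` do not have order `n_i(F)`. -/
noncomputable def formF (F : FinSub) (i : Dir) : Bool := decide (nIdx F i ≠ 1)

theorem coordOrd_formF_ne (F : FinSub) (i : Dir) : coordOrd (formF F i) ≠ nIdx F i := by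
  by_cases h : nIdx F i = 1
  · rw [h, formF, h]; decide
  · have : formF F i = true := by simp [formF, h]
    rw [this]; exact Ne.symm h

/-- The chart of `C × C` attached to `F`; its complement consists of two divisors along which
elements of `𝒪_F` may have poles. -/
noncomputable def chartF (W : WeierstrassCurve ℂ) (F : FinSub) : (Fin 3 → ℂ) × (Fin 3 → ℂ) :=
  (coordForm W (formF F dirFst), coordForm W (formF F dirSnd))

open Classical in
/-- The divisors in the complement of the chart attached to `F`. -/
noncomputable def polesF (F : FinSub) : Finset (Dir × ℕ+) :=
  {(dirFst, coordOrd (formF F dirFst)), (dirSnd, coordOrd (formF F dirSnd))}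

theorem polesF_subset (F : FinSub) : ↑(polesF F) ⊆ offF F := by
  intro s hs
  simp only [polesF, Finset.coe_insert, Finset.coe_singleton, Set.mem_insert_iff,
    Set.mem_singleton_iff] at hs
  rcases hs with rfl | rfl <;> exact coordOrd_formF_ne F _

theorem mem_chartDom_iff {F : FinSub} {Q : Pt W × Pt W} :
    Q ∈ chartDom W (chartF W F) ↔ Q ∉ Dunion W (polesF F) := by
  have e1 : proj dirFst Q = Q.1 := by simp [proj, dirFst, Dir.vec]
  have e2 : proj dirSnd Q = Q.2 := by simp [proj, dirSnd, Dir.vec]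
  simp only [chartDom, chartF, Set.mem_ofPred_eq, Ne, lin_coordForm_eq_zero_iff, mem_Dunion, polesF,
    Finset.mem_insert, Finset.mem_singleton, exists_eq_or_imp, exists_eq_left, mem_Dset_iff, e1, e2,
    not_or]

/-- The polynomials in the coordinates of the chart attached to `F`, as elements of `𝒪_F`. -/
noncomputable def polF (W : WeierstrassCurve ℂ) (F : FinSub) : Poly →ₐ[ℂ] OF W F where
  toFun p := OO.ofFun (polesF_subset F) (g := pol W (chartF W F) p)
    fun _ hQ => regularAt_pol p (mem_chartDom_iff.mpr hQ)
  map_one' := OO.ext_val (congrArg germ (map_one (pol W (chartF W F))))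
  map_mul' p q := OO.ext_val (congrArg germ (map_mul (pol W (chartF W F)) p q))
  map_zero' := OO.ext_val (congrArg germ (map_zero (pol W (chartF W F))))
  map_add' p q := OO.ext_val (congrArg germ (map_add (pol W (chartF W F)) p q))
  commutes' c := OO.ext_val (congrArg germ ((pol W (chartF W F)).commutes c))

theorem polF_mul_eq {F : FinSub} {a b : Poly} {c : OF W F} {g : Pt W × Pt W → ℂ}
    (hc : germ g = KK.val W c)
    (h : ∀ Q ∈ chartDom W (chartF W F), pol W (chartF W F) b Q * g Q = pol W (chartF W F) a Q) :
    polF W F b * c = polF W F a := by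
  apply OO.ext_val
  have h1 : germ (pol W (chartF W F) b * g) = germ (pol W (chartF W F) a) :=
    germ_eq fun Q hQ => h Q (mem_chartDom_iff.mpr hQ)
  exact (congrArg₂ (· * ·) rfl hc.symm).trans ((map_mul _ _ _).symm.trans h1)

theorem regularAt_comp_proj {φ : Pt W → ℂ} {i : Dir} {Q : Pt W × Pt W}
    (h : RegularAtC φ (proj i Q)) : RegularAt (fun Q' => φ (proj i Q')) Q :=
  RegularAtC.comp_zsmul _ _ h

theorem regOff_ratioFn {A B : Pt W} (h1 : A ≠ B) (h2 : A ≠ -B) (i : Dir) (hB : 0 < addOrderOf B) :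
    RegOff (fun Q => ratioFn A B (proj i Q)) {(i, ⟨addOrderOf B, hB⟩)} := by
  intro Q hQ
  apply regularAt_comp_proj
  have h : addOrderOf (proj i Q) ≠ addOrderOf B := by
    intro h
    exact hQ (mem_Dunion.mpr ⟨_, Finset.mem_singleton_self _, mem_Dset h⟩)
  refine regularAtC_ratioFn h1 h2 ?_ ?_
  · intro h3; exact h (by rw [h3])
  · intro h3; exact h (by rw [h3, addOrderOf_neg])

/-- Along a fibre of `π_i` over a torsion point whose order is not `n_i(F)`, some element of
`𝒪_F` has a pole and is a unit. -/
theorem exists_pole [W.IsElliptic] (F : FinSub) (i : Dir) {A : Pt W} (h0 : 0 < addOrderOf A)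
    (hA : addOrderOf A ≠ nIdx F i) : ∃ v : OF W F, ∀ Q ∈ chartDom W (chartF W F), proj i Q = A →
      ∃ a b : Poly, pol W (chartF W F) b Q ≠ 0 ∧ pol W (chartF W F) a Q = 0 ∧
        polF W F b = polF W F a * v := by
  classical
  obtain ⟨B, hB0, hBn, hBA⟩ := exists_addOrderOf_ne (W := W) (nIdx F i) (addOrderOf A)
  have h1 : A ≠ B := by rintro rfl; exact hBA rfl
  have h2 : A ≠ -B := by rintro rfl; exact hBA (by rw [addOrderOf_neg])
  have h1' := h1.symm
  have h2' : B ≠ -A := by rintro rfl; exact hBA (by rw [addOrderOf_neg])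
  have hv := regOff_ratioFn h1' h2' i h0
  have hS : (({(i, ⟨addOrderOf A, h0⟩)} : Finset (Dir × ℕ+)) : Set (Dir × ℕ+)) ⊆ offF F := by
    intro s hs
    rw [Finset.coe_singleton, Set.mem_singleton_iff] at hs
    subst hs
    exact fun h => hA (congrArg PNat.val h)
  refine ⟨OO.ofFun hS hv, fun Q hQ hQA => ?_⟩
  have hr : RegularAt (fun Q' => ratioFn A B (proj i Q')) Q :=
    regularAt_comp_proj (by rw [hQA]; exact regularAtC_ratioFn h1 h2 h1 h2)
  obtain ⟨a, b, hb, hab⟩ := (regularAt_iff hQ).mp hr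
  refine ⟨a, b, hb, ?_, ?_⟩
  · rw [← hab Q hQ, hQA, ratioFn_self, mul_zero]
  · apply OO.ext_val
    change germ (pol W (chartF W F) b) = germ (pol W (chartF W F) a *
      fun Q => ratioFn B A (proj i Q))
    refine germ_eq (S := polesF F ∪ {(i, ⟨addOrderOf A, h0⟩), (i, ⟨addOrderOf B, hB0⟩)})
      fun Q' hQ' => ?_
    simp only [mem_Dunion, Finset.mem_union, Finset.mem_insert, Finset.mem_singleton, not_exists,
      not_and] at hQ'
    have hd : Q' ∈ chartDom W (chartF W F) := mem_chartDom_iff.mpr fun h => by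
      obtain ⟨s, hs, h⟩ := mem_Dunion.mp h
      exact hQ' s (Or.inl hs) h
    have hA' := fun h => hQ' _ (Or.inr (Or.inl rfl)) (mem_Dset h)
    have hB' := fun h => hQ' _ (Or.inr (Or.inr rfl)) (mem_Dset h)
    simp only [PNat.mk_coe] at hA' hB'
    rw [Pi.mul_apply, ← hab Q' hd, mul_assoc, ratioFn_mul, mul_one]
    · rintro h; exact hA' (by rw [h])
    · rintro h; exact hA' (by rw [h, addOrderOf_neg])
    · rintro h; exact hB' (by rw [h])
    · rintro h; exact hB' (by rw [h, addOrderOf_neg])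

/-- A form of the Nullstellensatz for the ring `𝒪_F`: if the polynomials in an ideal of `𝒪_F` have
common zeros, away from finitely many of the admissible polar divisors, in `Z` only, then the ideal
contains a power of the ideal of `Z`. The polar divisors are removed by adjoining the units with
poles along them to the coordinates of the chart. -/
theorem exists_pow_vanPoly_le [W.IsElliptic]
    (hfin : ∀ j : ℕ, j ≠ 0 → {P : Pt W | j • P = 0}.Finite) {F : FinSub} {I : Ideal (OF W F)}
    {S : Finset (Dir × ℕ+)} (hS : ↑S ⊆ offF F) {Z : Set (Pt W × Pt W)}
    (H : ∀ Q ∈ chartDom W (chartF W F), Q ∉ Dunion W S → Q ∉ Z →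
      ∃ c : Poly, polF W F c ∈ I ∧ pol W (chartF W F) c Q ≠ 0) :
    ∃ n, ∀ p ∈ vanPoly W (chartF W F) Z ^ n, polF W F p ∈ I := by
  let ι := {x : Dir × Pt W // ∃ s ∈ S, s.1 = x.1 ∧ addOrderOf x.2 = s.2}
  have hι : Finite ι := by
    have : (⋃ s ∈ (S : Set (Dir × ℕ+)), (Prod.mk s.1) '' {P : Pt W | (s.2 : ℕ) • P = 0}).Finite :=
      Set.Finite.biUnion S.finite_toSet fun s _ => (hfin _ s.2.ne_zero).image _
    refine (this.subset ?_).to_subtype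
    rintro ⟨i, P⟩ ⟨s, hs, h1, h2⟩
    simp only [Set.mem_iUnion]
    refine ⟨s, hs, P, ?_, by rw [h1]⟩
    change (s.2 : ℕ) • P = 0
    rw [← h2, addOrderOf_nsmul_eq_zero]
  have hv : ∀ x : ι, ∃ v : OF W F, ∀ Q ∈ chartDom W (chartF W F), proj x.1.1 Q = x.1.2 →
      ∃ a b : Poly, pol W (chartF W F) b Q ≠ 0 ∧ pol W (chartF W F) a Q = 0 ∧
        polF W F b = polF W F a * v := by
    intro x
    obtain ⟨s, hs, h1, h2⟩ := x.2
    refine exists_pole F _ ?_ ?_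
    · rw [h2]; exact s.2.pos
    · rw [h2, ← h1]
      exact fun h => hS hs (PNat.coe_injective h)
  choose v hv using hv
  -- The Nullstellensatz is applied to the subalgebra of `𝒪_F` generated by the coordinates and the
  -- units `v x`: at a common zero of the preimage of `I` the relation `b = a * v x` forces `b = 0`.
  let ψ : MvPolynomial ((Fin 3 ⊕ Fin 3) ⊕ ι) ℂ →ₐ[ℂ] OF W F :=
    aeval (Sum.elim (fun k => polF W F (X k)) v)
  have hψ : ∀ p : Poly, ψ (rename Sum.inl p) = polF W F p := by
    intro p
    rw [aeval_rename, Sum.elim_comp_inl]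
    exact (DFunLike.congr_fun (aeval_unique (polF W F)) p).symm
  have hrad : (vanPoly W (chartF W F) Z).map
      (rename Sum.inl : Poly →ₐ[ℂ] MvPolynomial ((Fin 3 ⊕ Fin 3) ⊕ ι) ℂ).toRingHom ≤
      (I.comap ψ.toRingHom).radical := by
    rw [Ideal.map_le_iff_le_comap]
    intro p hp
    rw [Ideal.mem_comap, ← vanishingIdeal_zeroLocus_eq_radical (K := ℂ), mem_vanishingIdeal_iff]
    intro z hz
    rw [mem_zeroLocus_iff] at hz
    have hz' : ∀ c : Poly, polF W F c ∈ I → eval (z ∘ Sum.inl) c = 0 := by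
      intro c hc
      have h1 := hz (rename Sum.inl c) (by
        rw [Ideal.mem_comap]
        change ψ _ ∈ I
        rwa [hψ])
      rw [aeval_rename] at h1
      exact h1
    obtain ⟨Q, hQ, hzQ⟩ := exists_chart_eq (W := W) (chartF W F) (z ∘ Sum.inl) (by
      intro c hc
      apply hz'
      have : polF W F c = 0 := by
        rw [← mul_one (polF W F c), ← map_zero (polF W F)]
        refine polF_mul_eq (g := 1) (map_one _) fun Q hQ => ?_
        rw [hc Q hQ, zero_mul, map_zero]; rfl
      rw [this]; exact I.zero_mem)
    rw [hzQ] at hz'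
    have hQS : Q ∉ Dunion W S := by
      intro hQS
      obtain ⟨s, hs, hQs⟩ := mem_Dunion.mp hQS
      let x : ι := ⟨(s.1, proj s.1 Q), s, hs, rfl, mem_Dset_iff.mp hQs⟩
      obtain ⟨a, b, hb, ha, hab⟩ := hv x Q hQ rfl
      have h1 := hz (rename Sum.inl b - rename Sum.inl a * X (Sum.inr x)) (by
        rw [Ideal.mem_comap]
        change ψ _ ∈ I
        rw [map_sub, map_mul, hψ, hψ, hab]
        have : ψ (X (Sum.inr x)) = v x := by simp [ψ]
        rw [this, sub_self]; exact I.zero_mem)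
      rw [map_sub, map_mul, aeval_rename, aeval_rename, hzQ] at h1
      have e : ∀ p : Poly, aeval (chart (chartF W F) Q) p = pol W (chartF W F) p Q :=
        fun p => (pol_apply _ _ _).symm
      rw [e, e, ha, zero_mul, sub_zero] at h1
      exact hb h1
    have hQZ : Q ∈ Z := by
      by_contra hQZ
      obtain ⟨c, hc, h0⟩ := H Q hQ hQS hQZ
      apply h0
      rw [pol_apply, hz' c hc]
    change aeval z (rename Sum.inl p) = 0
    rw [aeval_rename, hzQ]
    exact (pol_apply _ _ _).symm.trans (hp Q hQ hQZ)
  obtain ⟨n, hn⟩ := (I.comap ψ.toRingHom).exists_radical_pow_le_of_fg (IsNoetherian.noetherian _)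
  refine ⟨n, fun p hp => ?_⟩
  have h1 := Ideal.mem_map_of_mem
    (rename Sum.inl : Poly →ₐ[ℂ] MvPolynomial ((Fin 3 ⊕ Fin 3) ⊕ ι) ℂ).toRingHom hp
  rw [Ideal.map_pow] at h1
  have h2 := hn (Ideal.pow_right_mono hrad n h1)
  rw [← hψ]
  exact h2

/-- An ideal of `𝒪_F` is the unit ideal if, away from finitely many of the admissible polar divisors,
its polynomials have no common zero. -/
theorem eq_top_of_locally [W.IsElliptic]
    (hfin : ∀ j : ℕ, j ≠ 0 → {P : Pt W | j • P = 0}.Finite) {F : FinSub} {I : Ideal (OF W F)}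
    {S : Finset (Dir × ℕ+)} (hS : ↑S ⊆ offF F)
    (H : ∀ Q ∈ chartDom W (chartF W F), Q ∉ Dunion W S →
      ∃ c : Poly, polF W F c ∈ I ∧ pol W (chartF W F) c Q ≠ 0) : I = ⊤ := by
  obtain ⟨n, hn⟩ := exists_pow_vanPoly_le hfin hS (Z := ∅) fun Q hQ hQS _ => H Q hQ hQS
  have h1 : vanPoly W (chartF W F) ∅ = ⊤ := by
    rw [Ideal.eq_top_iff_one]
    exact fun Q _ h => absurd h (Set.notMem_empty Q)
  rw [Ideal.eq_top_iff_one, ← map_one (polF W F)]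
  exact hn 1 (by rw [h1, Ideal.top_pow]; trivial)

/-! ### Torsion of the codimension two term -/

open Classical in
theorem smul_mk_single (F : FinSub) (i : Dir) (r : OF W F) (x : KK W) :
    r • H2.mk W F (DFinsupp.single i (KQ.mk W (offF_subset F i) x)) =
      H2.mk W F (DFinsupp.single i (KQ.mk W (offF_subset F i) ((r : KK W) * x))) := by
  rw [← map_smul, ← DFinsupp.single_smul, ← map_smul]; rfl

open Classical in
theorem mk_single_eq_zero_of_mem {F : FinSub} {i : Dir} {x : KK W} (hx : x ∈ OD W i (nIdx F i)) :
    H2.mk W F (DFinsupp.single i (KQ.mk W (offF_subset F i) x)) = 0 := by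
  have : KQ.mk W (offF_subset F i) x = 0 := (Submodule.Quotient.mk_eq_zero _).mpr hx
  rw [this, DFinsupp.single_zero, map_zero]

open Classical in
/-- If `x` has no poles along the divisors `D_{k, n_k(F)}` with `k ≠ i`, then its class at `i` is
the image of `x` under the diagonal map. -/
theorem mk_single_eq_zero_of_forall {F : FinSub} {i : Dir} {x : KK W}
    (hx : ∀ k ≠ i, x ∈ OD W k (nIdx F k)) :
    H2.mk W F (DFinsupp.single i (KQ.mk W (offF_subset F i) x)) = 0 := by
  refine (Submodule.Quotient.mk_eq_zero _).mpr ⟨x, fun k => ?_⟩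
  by_cases h : k = i
  · subst h; exact DFinsupp.single_eq_same
  · rw [DFinsupp.single_eq_of_ne h]
    exact ((Submodule.Quotient.mk_eq_zero _).mpr (hx k h)).symm

/-- A power of a polynomial vanishing on `D_{k, n_k(F)}` cancels the pole of `x` there. -/
theorem exists_polF_pow_mul_mem [W.IsElliptic] (hD : ∀ s : Dir × ℕ+, ZClosed (Dset W s))
    (F : FinSub) (k : Dir) (x : KK W) :
    ∃ n, ∀ m, n ≤ m → ∀ p ∈ vanPoly W (chartF W F) (Dset W (k, nIdx F k)),
      ((polF W F (p ^ m) : OF W F) : KK W) * x ∈ OD W k (nIdx F k) := by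
  obtain ⟨n, hn⟩ := exists_pow_mul_mem_OD hD k (nIdx F k) x
  refine ⟨n, fun m hm p hp => ?_⟩
  let q : OD W k (nIdx F k) :=
    ⟨(polF W F p : OF W F), OO_mono W (offF_subset F k) (polF W F p).2⟩
  have hq : q ∈ mD W k (nIdx F k) := ⟨pol W (chartF W F) p, polesF F,
    (polesF_subset F).trans (offF_subset F k),
    fun _ hQ => regularAt_pol p (mem_chartDom_iff.mpr hQ), rfl,
    fun Q hQ hQ' => hp Q (mem_chartDom_iff.mpr hQ') hQ⟩
  have h1 := hn (q ^ m) (Ideal.pow_le_pow_right hm (Ideal.pow_mem_pow hq m))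
  have e : ((polF W F (p ^ m) : OF W F) : KK W) = ((q ^ m : OD W k (nIdx F k)) : KK W) := by
    rw [map_pow, SubmonoidClass.coe_pow, SubmonoidClass.coe_pow]
  rw [e]; exact h1

open Classical in
/-- At a point outside `Xbar F`, and away from finitely many admissible polar divisors, the class
at `i` of an element of `𝒦` is annihilated by a polynomial that does not vanish there: the point
lies on at most one of the relevant divisors. -/
theorem exists_annihilating_poly [W.IsElliptic] (hD : ∀ s : Dir × ℕ+, ZClosed (Dset W s))
    (hfin : ∀ j : ℕ, j ≠ 0 → {P : Pt W | j • P = 0}.Finite) (σ : Splitting) (F : FinSub) (i : Dir)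
    (x : KK W) : ∃ S : Finset (Dir × ℕ+), ↑S ⊆ offF F ∧
      ∀ Q ∈ chartDom W (chartF W F), Q ∉ Dunion W S → Q ∉ Xbar W F.1 →
        ∃ c : Poly, polF W F c • H2.mk W F (DFinsupp.single i (KQ.mk W (offF_subset F i) x)) = 0 ∧
          pol W (chartF W F) c Q ≠ 0 := by
  obtain ⟨g, S, hg, hx⟩ := x.exists_rep
  let K : Finset Dir := (S.image Prod.fst).filter (· ≠ i)
  -- The finitely many points where `D_{i, n_i(F)}` meets one of the other relevant divisors; each of
  -- those outside `Xbar F` lies on an admissible polar divisor.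
  let E : Set (Pt W × Pt W) := {Q | Q ∉ Xbar W F.1 ∧ Q ∈ Dset W (i, nIdx F i) ∧
    ∃ k ∈ K, Q ∈ Dset W (k, nIdx F k)}
  have htors : ∀ (k : Dir) (Q : Pt W × Pt W), Q ∈ Dset W (k, nIdx F k) →
      proj k Q ∈ {P : Pt W | (nIdx F k : ℕ) • P = 0} := by
    intro k Q hQ
    change (nIdx F k : ℕ) • proj k Q = 0
    rw [← mem_Dset_iff.mp hQ, addOrderOf_nsmul_eq_zero]
  have hE : E.Finite := by
    have : (⋃ k ∈ (K : Set Dir), {Q : Pt W × Pt W | proj i Q ∈ {P | (nIdx F i : ℕ) • P = 0} ∧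
        proj k Q ∈ {P | (nIdx F k : ℕ) • P = 0}}).Finite :=
      Set.Finite.biUnion K.finite_toSet fun k hk =>
        finite_proj_inter hfin (Finset.mem_filter.mp hk).2.symm (hfin _ (nIdx F i).ne_zero)
          (hfin _ (nIdx F k).ne_zero)
    refine this.subset ?_
    rintro Q ⟨-, h1, k, hk, h2⟩
    simp only [Set.mem_iUnion]
    exact ⟨k, hk, htors i Q h1, htors k Q h2⟩
  have hcov : ∀ Q ∈ E, ∃ s ∈ offF F, Q ∈ Dset W s := by
    rintro Q ⟨h0, h1, k, hk, h2⟩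
    refine exists_offF_of_not_mem_Xbar σ h0 (Finset.mem_filter.mp hk).2.symm ?_ ?_
    · rw [mem_Dset_iff.mp h1]; exact (nIdx F i).pos
    · rw [mem_Dset_iff.mp h2]; exact (nIdx F k).pos
  have : Nonempty (Dir × ℕ+) := ⟨(i, 1)⟩
  choose! c hc hcQ using hcov
  refine ⟨hE.toFinset.image c, ?_, fun Q hQ hQS hQX => ?_⟩
  · intro s hs
    obtain ⟨Q, hQ, rfl⟩ := Finset.mem_image.mp hs
    exact hc Q (hE.mem_toFinset.mp hQ)
  choose n hn using fun k => exists_polF_pow_mul_mem hD F k x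
  by_cases hQi : Q ∈ Dset W (i, nIdx F i)
  -- Removing the poles along the other divisors turns `x` into an element in the image of the
  -- diagonal, and removing the pole along `D_{i, n_i(F)}` makes its class at `i` zero.
  · have hQK : Q ∉ Dunion W (K.image fun k => (k, nIdx F k)) := by
      intro h
      obtain ⟨s, hs, h⟩ := mem_Dunion.mp h
      obtain ⟨k, hk, rfl⟩ := Finset.mem_image.mp hs
      have hQE : Q ∈ E := ⟨hQX, hQi, k, hk, h⟩
      exact hQS (mem_Dunion.mpr ⟨_, Finset.mem_image_of_mem c (hE.mem_toFinset.mpr hQE), hcQ Q hQE⟩)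
    obtain ⟨p, hp, hpz⟩ := (zClosed_Dunion hD _).exists_poly hQ hQK
    refine ⟨p ^ (∑ k ∈ K, n k), ?_, ?_⟩
    · rw [smul_mk_single]
      refine mk_single_eq_zero_of_forall fun k hki => ?_
      by_cases hk : k ∈ K
      · refine hn k _ (Finset.single_le_sum (f := n) (fun _ _ => Nat.zero_le _) hk) p ?_
        intro Q' hQ' hQk
        exact hpz Q' hQ' (mem_Dunion.mpr ⟨_, Finset.mem_image_of_mem _ hk, hQk⟩)
      · refine (OD W k (nIdx F k)).mul_mem
          (OO_mono W (offF_subset F k) (polF W F _).2) ⟨g, S, ?_, hg, hx⟩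
        rintro s hs rfl
        exact hk (Finset.mem_filter.mpr ⟨Finset.mem_image.mpr ⟨_, hs, rfl⟩, hki⟩)
    · rw [map_pow]; exact pow_ne_zero _ hp
  · obtain ⟨p, hp, hpz⟩ := (hD _).exists_poly hQ hQi
    refine ⟨p ^ n i, ?_, ?_⟩
    · rw [smul_mk_single]
      exact mk_single_eq_zero_of_mem (hn i _ le_rfl p hpz)
    · rw [map_pow]; exact pow_ne_zero _ hp

theorem torsionPart_H2_eq_top [W.IsElliptic] (hD : ∀ s : Dir × ℕ+, ZClosed (Dset W s))
    (hfin : ∀ j : ℕ, j ≠ 0 → {P : Pt W | j • P = 0}.Finite) (σ : Splitting) (F : FinSub) :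
    torsionPart (mF W F) (H2 W F) = ⊤ := by
  classical
  have key : ∀ (i : Dir) (x : KK W), H2.mk W F (DFinsupp.single i
      (KQ.mk W (offF_subset F i) x)) ∈ torsionPart (mF W F) (H2 W F) := by
    intro i x
    obtain ⟨S, hS, H⟩ := exists_annihilating_poly hD hfin σ F i x
    generalize H2.mk W F (DFinsupp.single i (KQ.mk W (offF_subset F i) x)) = y at *
    obtain ⟨n, hn⟩ := exists_pow_vanPoly_le hfin
      (I := LinearMap.ker (LinearMap.toSpanSingleton (OF W F) (H2 W F) y)) hS H
    refine ⟨n, fun r hr => ?_⟩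
    obtain ⟨h, T, hT, -, hr', H'⟩ := exists_rep_of_mem_pow hD (T₀ := ∅) (by simp)
      (Set.subset_union_left) hr
    have htop := eq_top_of_locally hfin
      (I := LinearMap.ker (LinearMap.toSpanSingleton (OF W F) (H2 W F) (r • y))) hT (by
      intro Q hQ hQT
      obtain ⟨b, hb, a, ha, hab⟩ := H' _ Q hQ hQT
      refine ⟨b, ?_, hb⟩
      have h1 : polF W F a • y = 0 := hn a ha
      change polF W F b • r • y = 0
      rw [smul_smul, polF_mul_eq hr' hab, h1])
    have h1 : (1 : OF W F) • r • y = 0 := (Ideal.eq_top_iff_one _).mp htop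
    rwa [one_smul] at h1
  rw [eq_top_iff]
  rintro x -
  obtain ⟨c, rfl⟩ := Submodule.Quotient.mk_surjective _ x
  change H2.mk W F c ∈ _
  induction c using DFinsupp.induction with
  | h0 => rw [map_zero]; exact Submodule.zero_mem _
  | ha i q c _ _ ih =>
    obtain ⟨y, rfl⟩ := Submodule.Quotient.mk_surjective _ q
    rw [map_add]
    exact Submodule.add_mem _ (key i y) ih

/-! ### Additivity of the completed coordinates -/

/-- The functions in a power of the maximal ideal of `Q` are quotients of polynomials whose
numerator lies in the same power of the vanishing ideal of `Z`: multiply by a polynomial that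
vanishes on the rest of `Z`. -/
theorem exists_rep_of_mem_maxX_pow {l : (Fin 3 → ℂ) × (Fin 3 → ℂ)} {Q : Pt W × Pt W}
    (hQ : Q ∈ chartDom W l) {Z : Set (Pt W × Pt W)} (hZ : ZClosed (Z \ {Q})) {n : ℕ}
    {h : RegX W Q} (hh : h ∈ maxX Q ^ n) :
    ∃ b : Poly, pol W l b Q ≠ 0 ∧ ∃ a ∈ vanPoly W l Z ^ n,
      ∀ Q' ∈ chartDom W l, pol W l b Q' * (h : Pt W × Pt W → ℂ) Q' = pol W l a Q' := by
  induction n generalizing h with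
  | zero =>
    obtain ⟨a, b, hb, hab⟩ := (regularAt_iff hQ).mp h.2
    exact ⟨b, hb, a, by simp, hab⟩
  | succ n ih =>
    rw [pow_succ] at hh
    refine Submodule.mul_induction_on hh ?_ ?_
    · intro x hx y hy
      obtain ⟨b, hb, a, ha, hab⟩ := ih hx
      obtain ⟨a', b', hb', hab'⟩ := (regularAt_iff hQ).mp y.2
      obtain ⟨e, he, hez⟩ := hZ.exists_poly hQ (fun h => h.2 rfl)
      refine ⟨b * (b' * e), ?_, a * (a' * e), ?_, ?_⟩
      · rw [map_mul, map_mul]; exact mul_ne_zero hb (mul_ne_zero hb' he)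
      · rw [pow_succ]
        refine Ideal.mul_mem_mul ha fun Q' hQ' hZQ => ?_
        rw [map_mul, Pi.mul_apply]
        by_cases h4 : Q' = Q
        · subst h4
          rw [← hab' Q' hQ', mem_maxX.mp hy]; ring
        · rw [hez Q' hQ' ⟨hZQ, h4⟩, mul_zero]
      · intro Q' hQ'
        simp only [map_mul, Pi.mul_apply, MulMemClass.coe_mul]
        rw [← hab Q' hQ', ← hab' Q' hQ']; ring
    · rintro x y ⟨b, hb, a, ha, hab⟩ ⟨b', hb', a', ha', hab'⟩
      refine ⟨b * b', ?_, b' * a + b * a', ?_, ?_⟩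
      · rw [map_mul]; exact mul_ne_zero hb hb'
      · exact Ideal.add_mem _ (Ideal.mul_mem_left _ _ ha) (Ideal.mul_mem_left _ _ ha')
      · intro Q' hQ'
        simp only [map_mul, map_add, Pi.mul_apply, Pi.add_apply, AddMemClass.coe_add]
        rw [← hab Q' hQ', ← hab' Q' hQ']; ring

theorem polF_mem_mF_pow {F : FinSub} {n : ℕ} {p : Poly}
    (hp : p ∈ vanPoly W (chartF W F) (Xbar W F.1) ^ n) : polF W F p ∈ mF W F ^ n :=
  map_pow_le (polF W F).toRingHom (J := mF W F)
    (fun p (hp : p ∈ vanPoly W (chartF W F) (Xbar W F.1)) =>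
    ⟨pol W (chartF W F) p, polesF F, polesF_subset F,
      fun _ hQ => regularAt_pol p (mem_chartDom_iff.mpr hQ), rfl,
      fun Q hQ hQ' => hp Q (mem_chartDom_iff.mpr hQ') hQ⟩) hp

theorem pullV_nIdx (t : Pt W → ℂ) (F : FinSub) (i : Dir) :
    pullV t ((nIdx F i : ℤ) • i.vec) = pull t i (nIdx F i) := by
  funext Q
  rw [pullV, zsmul_vec, natCast_zsmul, pull]

theorem mem_annLattice_of_mem_Xbar {F : FinSub} {Q : Pt W × Pt W} (hQ : Q ∈ Xbar W F.1) (i : Dir) :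
    (nIdx F i : ℤ) • i.vec ∈ annLattice Q := by
  rw [mem_annLattice, zsmul_vec, natCast_zsmul]
  exact proj_eq_zero (F.le_Hsub i) hQ

/-- The passage from functions to germs, as a map of algebras. -/
noncomputable def germHom (W : WeierstrassCurve ℂ) : (Pt W × Pt W → ℂ) →ₐ[ℂ] GermX W :=
  Ideal.Quotient.mkₐ ℂ (nullIdeal W)

theorem val_truncSum_tF {t : Pt W → ℂ} (ht : IsCoordinate W t) (f : PowerSeries ℂ) (n : ℕ)
    (F : FinSub) (i : Dir) : KK.val W (truncSum f n (tF ht F i) : OF W F) =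
      germHom W (truncSum f n (pull t i (nIdx F i))) := by
  rw [map_truncSum]
  exact map_truncSum ((KK.val W).comp (OF W F).val) f n (tF ht F i)

/-- The relation between the completed coordinates, modulo a power of `m_F`. It is checked locally:
at a point of `Xbar F` it is the additivity of the logarithm, and elsewhere `m_F` contains a
function that does not vanish. -/
theorem truncSum_tF_sub_mem [W.IsElliptic] {t : Pt W → ℂ} (ht : IsCoordinate W t)
    {Fg : MvPowerSeries (Fin 2) ℂ} (hFg : IsFormalGroupLaw W t Fg) {f : PowerSeries ℂ}
    (hf : IsLogarithm Fg f) (hfin : ∀ j : ℕ, j ≠ 0 → {P : Pt W | j • P = 0}.Finite)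
    (σ : Splitting) {F : FinSub} {i A B : Dir} {r s : ℤ}
    (h : (nIdx F i : ℤ) • i.vec = r • (nIdx F A : ℤ) • A.vec + s • (nIdx F B : ℤ) • B.vec) (n : ℕ) :
    truncSum f n (tF ht F i) - (r • truncSum f n (tF ht F A) + s • truncSum f n (tF ht F B)) ∈
      mF W F ^ n := by
  set d := truncSum f n (tF ht F i) -
    (r • truncSum f n (tF ht F A) + s • truncSum f n (tF ht F B)) with hd
  let g : Pt W × Pt W → ℂ := truncSum f n (pull t i (nIdx F i)) -
    (r • truncSum f n (pull t A (nIdx F A)) + s • truncSum f n (pull t B (nIdx F B)))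
  have hg : germ g = KK.val W d := by
    have e1 : KK.val W (d : KK W) = KK.val W (truncSum f n (tF ht F i) : OF W F) -
        (r • KK.val W (truncSum f n (tF ht F A) : OF W F) +
          s • KK.val W (truncSum f n (tF ht F B) : OF W F)) := by
      rw [← map_zsmul, ← map_zsmul, ← map_add, ← map_sub]; rfl
    rw [e1, val_truncSum_tF, val_truncSum_tF, val_truncSum_tF, ← map_zsmul, ← map_zsmul, ← map_add,
      ← map_sub]
    rfl
  have hX := finite_Xbar hfin σ F
  have htop := eq_top_of_locally hfin (F := F) (S := ∅)
    (I := Submodule.comap (LinearMap.toSpanSingleton (OF W F) (OF W F) d) (mF W F ^ n))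
    (by simp) (by
      intro Q hQ _
      by_cases hQX : Q ∈ Xbar W F.1
      · let v (k : Dir) : annLattice Q := ⟨_, mem_annLattice_of_mem_Xbar hQX k⟩
        have hv : v i = r • v A + s • v B := Subtype.ext h
        have h1 := truncSum_locV_zsmul_add ht hFg hf n (v A) (v B) r s
        rw [← hv] at h1
        obtain ⟨b, hb, a, ha, hab⟩ := exists_rep_of_mem_maxX_pow hQ
          (zClosed_of_finite (hX.subset Set.sdiff_subset)) h1
        refine ⟨b, ?_, hb⟩
        change polF W F b * d ∈ mF W F ^ n
        rw [polF_mul_eq hg (a := a)]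
        · exact polF_mem_mF_pow ha
        · intro Q' hQ'
          rw [← hab Q' hQ']
          congr 1
          have e2 : ∀ k, ((truncSum f n (locV ht (v k)) : RegX W Q) : Pt W × Pt W → ℂ) =
              truncSum f n (pull t k (nIdx F k)) := by
            intro k
            rw [← pullV_nIdx]
            exact map_truncSum (RegX W Q).val f n (locV ht (v k))
          simp only [g, ← e2]
          rfl
      · obtain ⟨p, hp, hpz⟩ := (zClosed_of_finite hX).exists_poly hQ hQX
        refine ⟨p ^ n, ?_, by rw [map_pow]; exact pow_ne_zero _ hp⟩
        have hpv : p ∈ vanPoly W (chartF W F) (Xbar W F.1) := hpz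
        exact Ideal.mul_mem_right _ _ (polF_mem_mF_pow (Ideal.pow_mem_pow hpv n)))
  have h1 : (1 : OF W F) * d ∈ mF W F ^ n := (Ideal.eq_top_iff_one _).mp htop
  rwa [one_mul] at h1

theorem evalₐ_evalHat {R : Type*} [CommRing R] [Algebra ℂ R] {I : Ideal R} (f : PowerSeries ℂ)
    {t : R} (ht : t ∈ I) (n : ℕ) :
    AdicCompletion.evalₐ I n (evalHat f ht) = Ideal.Quotient.mk (I ^ n) (truncSum f n t) :=
  AdicCompletion.evalₐ_mk _ _ _

theorem hatF_eq [W.IsElliptic] {t : Pt W → ℂ} (ht : IsCoordinate W t)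
    {Fg : MvPowerSeries (Fin 2) ℂ} (hFg : IsFormalGroupLaw W t Fg) {f : PowerSeries ℂ}
    (hf : IsLogarithm Fg f) (hfin : ∀ j : ℕ, j ≠ 0 → {P : Pt W | j • P = 0}.Finite)
    (σ : Splitting) {F : FinSub} {i A B : Dir} {r s : ℤ}
    (h : (nIdx F i : ℤ) • i.vec = r • (nIdx F A : ℤ) • A.vec + s • (nIdx F B : ℤ) • B.vec) :
    hatF ht f F i = r • hatF ht f F A + s • hatF ht f F B := by
  refine AdicCompletion.ext_evalₐ fun n => ?_
  have h1 := truncSum_tF_sub_mem ht hFg hf hfin σ h n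
  rw [← Ideal.Quotient.eq_zero_iff_mem, map_sub, map_add, map_zsmul, map_zsmul, sub_eq_zero] at h1
  rw [map_add, map_zsmul, map_zsmul, hatF, hatF, hatF, evalₐ_evalHat, evalₐ_evalHat, evalₐ_evalHat]
  exact h1

/-- The characters `z_A ^ n_A` and `z_B ^ n_B` form a basis of the characters trivial on `F`. -/
theorem existsUnique_coeff (σ : Splitting) (F : FinSub) (i : Dir) :
    ∃! p : ℤ × ℤ, (nIdx F i : ℤ) • i.vec = p.1 • (nIdx F (σ.A F) : ℤ) • (σ.A F).vec +
        p.2 • (nIdx F (σ.B F) : ℤ) • (σ.B F).vec := by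
  have hd := σ.det F
  have hu := mem_perp_F F i
  rw [σ.eq_inf F] at hu
  obtain ⟨k, l, h⟩ := perp_inf hd hu
  refine ⟨(k, l), h, ?_⟩
  rintro ⟨k', l'⟩ h'
  have h2 := h.symm.trans h'
  revert h2 hd
  generalize ((nIdx F (σ.A F) : ℕ+) : ℤ) • (σ.A F).vec = v
  generalize ((nIdx F (σ.B F) : ℕ+) : ℤ) • (σ.B F).vec = w
  intro hd h2
  have e1 := congrArg Prod.fst h2
  have e2 := congrArg Prod.snd h2
  simp only [Prod.fst_add, Prod.snd_add, Prod.smul_fst, Prod.smul_snd, smul_eq_mul] at e1 e2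
  refine Prod.ext (mul_right_cancel₀ hd ?_) (mul_right_cancel₀ hd ?_)
  · linear_combination w.1 * e2 - w.2 * e1
  · linear_combination v.2 * e1 - v.1 * e2

/-! ### Finiteness of the Cousin differential -/

theorem finite_Hsub_inf {i k : Dir} (hik : i ≠ k) (j m : ℕ+) :
    ((Hsub i j ⊓ Hsub k m : Subgroup Torus) : Set Torus).Finite := by
  -- The lattice spanned by the two characters contains `(d, 0)` and `(0, d)`.
  set v := (j : ℤ) • i.vec with hv
  set w := (m : ℤ) • k.vec with hw
  let d := v.1 * w.2 - v.2 * w.1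
  have hd : d.natAbs ≠ 0 := by
    rw [Int.natAbs_ne_zero]
    have : d = (j : ℤ) * (m : ℤ) * (i.vec.1 * k.vec.2 - i.vec.2 * k.vec.1) := by
      simp only [d, hv, hw, Prod.smul_fst, Prod.smul_snd, smul_eq_mul]; ring
    rw [this]
    exact mul_ne_zero (by positivity) (Dir.det_ne_zero hik)
  have hpow : ∀ x : Circle, x ^ d = 1 → x ^ d.natAbs = 1 := fun x hx => by
    rcases Int.natAbs_eq d with h | h
    · rw [h, zpow_natCast] at hx; exact hx
    · rw [h, zpow_neg, inv_eq_one, zpow_natCast] at hx; exact hx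
  refine ((finite_circle_pow_eq_one hd).prod (finite_circle_pow_eq_one hd)).subset ?_
  rintro z ⟨h1, h2⟩
  have h1' : chi v z = 1 := h1
  have h2' : chi w z = 1 := h2
  constructor
  · have h3 : chi (w.2 • v + (-v.2) • w) z = z.1 ^ d := by
      rw [chi_apply]
      have e1 : (w.2 • v + (-v.2) • w).1 = d := by simp [d]; ring
      have e2 : (w.2 • v + (-v.2) • w).2 = 0 := by simp; ring
      rw [e1, e2, zpow_zero, mul_one]
    rw [chi_add, chi_smul _ v, chi_smul _ w, h1', h2', one_zpow, one_zpow, one_mul] at h3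
    exact hpow _ h3.symm
  · have h3 : chi ((-w.1) • v + v.1 • w) z = z.2 ^ d := by
      rw [chi_apply]
      have e1 : ((-w.1) • v + v.1 • w).1 = 0 := by simp; ring
      have e2 : ((-w.1) • v + v.1 • w).2 = d := by simp [d]; ring
      rw [e1, e2, zpow_zero, one_mul]
    rw [chi_add, chi_smul _ v, chi_smul _ w, h1', h2', one_zpow, one_zpow, one_mul] at h3
    exact hpow _ h3.symm

theorem finite_finSub_le {K : Subgroup Torus} (hK : (K : Set Torus).Finite) :
    {F : FinSub | F.1 ≤ K}.Finite :=
  hK.finite_subsets.preimage (f := fun F : FinSub => (F.1 : Set Torus))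
    fun _ _ _ _ h => Subtype.ext (SetLike.coe_injective h)

/-- The Cousin differential of a class at `D_ij` has only finitely many components: if the
component at `F` is not zero then `F` is contained in the finite intersection of `H_i ^ j` with a
subgroup `H_k ^ m` such that the given function has a pole along `D_km`. -/
theorem finite_cousinD1_ne_zero (i : Dir) (j : ℕ+) (y : ∀ m, H1 W i m) :
    {F : FinSub | nIdx F i = j ∧ cousinD1 W i F (y (nIdx F i)) ≠ 0}.Finite := by
  classical
  obtain ⟨g, hg⟩ := Submodule.Quotient.mk_surjective _ (y j)
  obtain ⟨φ, S, hφ, hgφ⟩ := g.exists_rep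
  have hfin : (⋃ s ∈ ((S.filter fun s => s.1 ≠ i : Finset (Dir × ℕ+)) : Set (Dir × ℕ+)),
      {F : FinSub | F.1 ≤ Hsub i j ⊓ Hsub s.1 s.2}).Finite :=
    Set.Finite.biUnion (Finset.finite_toSet _) fun s hs =>
      finite_finSub_le (finite_Hsub_inf (Finset.mem_filter.mp hs).2.symm _ _)
  refine hfin.subset ?_
  rintro F ⟨rfl, hF⟩
  by_contra hcon
  simp only [Set.mem_iUnion, Finset.coe_filter, Set.mem_ofPred_eq, not_exists] at hcon
  apply hF
  rw [← hg]
  refine (cousinD1_mk W i F g).trans (mk_single_eq_zero_of_forall fun k hk => ?_)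
  refine ⟨φ, S, ?_, hφ, hgφ⟩
  rintro s hs rfl
  exact hcon (k, nIdx F k) ⟨hs, hk⟩ (le_inf (F.le_Hsub i) (F.le_Hsub k))

/-! ### The Cousin differential and the completed rings -/

/-- The inclusion of `𝒪_F` into `𝒪_{D_{i, n_i(F)}}`. -/
noncomputable def inclOF (W : WeierstrassCurve ℂ) (F : FinSub) (i : Dir) :
    OF W F →ₐ[ℂ] OD W i (nIdx F i) :=
  Subalgebra.inclusion (OO_mono W (offF_subset F i))

theorem cousinD1_smul (i : Dir) (F : FinSub) (r : OF W F) (y : H1 W i (nIdx F i)) :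
    cousinD1 W i F (inclOF W F i r • y) = r • cousinD1 W i F y := by
  classical
  obtain ⟨g, rfl⟩ := Submodule.Quotient.mk_surjective _ y
  exact (smul_mk_single F i r g).symm

/-- The component at `F` of the Cousin differential, on the torsion modules. -/
noncomputable def cousinV (hF : ∀ F : FinSub, torsionPart (mF W F) (H2 W F) = ⊤) (i : Dir)
    (F : FinSub) :
    V1 W i (nIdx F i) →+ V2 W F where
  toFun y := ⟨cousinD1 W i F y, by rw [hF]; trivial⟩
  map_zero' := Subtype.ext (map_zero _)
  map_add' _ _ := Subtype.ext (map_add _ _ _)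

/-- The Cousin differential is linear for pairs of elements of the completed rings that have common
approximations in `𝒪_F`. -/
theorem cousinV_smul (hF : ∀ F : FinSub, torsionPart (mF W F) (H2 W F) = ⊤) {i : Dir} {F : FinSub}
    {α : AdicCompletion (mD W i (nIdx F i)) (OD W i (nIdx F i))}
    {β : AdicCompletion (mF W F) (OF W F)}
    (h : ∀ n, ∃ r : OF W F,
      Ideal.Quotient.mk (mD W i (nIdx F i) ^ n) (inclOF W F i r) = AdicCompletion.evalₐ _ n α ∧
      Ideal.Quotient.mk (mF W F ^ n) r = AdicCompletion.evalₐ _ n β)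
    (y : V1 W i (nIdx F i)) : cousinV hF i F (α • y) = β • cousinV hF i F y := by
  obtain ⟨n, hn⟩ := y.2
  obtain ⟨m, hm⟩ := (cousinV hF i F y).2
  obtain ⟨r, h1, h2⟩ := h (n + m)
  have e1 : α • y = inclOF W F i r • y :=
    hatSMul_eq α y (fun s hs => hn s (Ideal.pow_le_pow_right (Nat.le_add_right n m) hs)) h1
  have e2 : β • cousinV hF i F y = r • cousinV hF i F y :=
    hatSMul_eq β _ (fun s hs => hm s (Ideal.pow_le_pow_right (Nat.le_add_left m n) hs)) h2
  rw [e1, e2]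
  exact Subtype.ext (cousinD1_smul i F r y)

/-- The component at `F` of the Cousin differential, on the 2-periodic modules. -/
noncomputable def cousinP (hF : ∀ F : FinSub, torsionPart (mF W F) (H2 W F) = ⊤) (i : Dir)
    (F : FinSub) :
    Periodic (V1 W i (nIdx F i)) →+ Periodic (V2 W F) :=
  Finsupp.mapRange.addMonoidHom (cousinV hF i F)

theorem cousinP_apply (hF : ∀ F : FinSub, torsionPart (mF W F) (H2 W F) = ⊤) (i : Dir) (F : FinSub)
    (x : Periodic (V1 W i (nIdx F i))) (k : ℤ) : cousinP hF i F x k = cousinV hF i F (x k) := rfl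

theorem cousinP_smul (hF : ∀ F : FinSub, torsionPart (mF W F) (H2 W F) = ⊤) {i : Dir} {F : FinSub}
    {α : AdicCompletion (mD W i (nIdx F i)) (OD W i (nIdx F i))}
    {β : AdicCompletion (mF W F) (OF W F)}
    (h : ∀ n, ∃ r : OF W F,
      Ideal.Quotient.mk (mD W i (nIdx F i) ^ n) (inclOF W F i r) = AdicCompletion.evalₐ _ n α ∧
      Ideal.Quotient.mk (mF W F ^ n) r = AdicCompletion.evalₐ _ n β) (m : ℤ)
    (x : Periodic (V1 W i (nIdx F i))) :
    cousinP hF i F ((LaurentPolynomial.C α * LaurentPolynomial.T m :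
      LaurentPolynomial (AdicCompletion (mD W i (nIdx F i)) (OD W i (nIdx F i)))) • x) =
      (LaurentPolynomial.C β * LaurentPolynomial.T m :
        LaurentPolynomial (AdicCompletion (mF W F) (OF W F))) • cousinP hF i F x := by
  refine Finsupp.ext fun k => ?_
  have hk : k = (k - m) + m := by ring
  rw [hk]
  refine (cousinP_apply hF i F _ _).trans ?_
  refine Eq.trans ?_ (periodic_smul_apply _ _ _ _).symm
  rw [periodic_smul_apply, cousinV_smul hF h]
  rfl

theorem eulerLift_algebraMap {K : Subgroup Torus} {ι R : Type} [CommRing R] [Algebra ℂ R]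
    (b : Module.Basis ι ℤ (perp K)) (x : ι → R) (q : ℚ) :
    eulerLift b x (algebraMap ℚ _ q) = algebraMap ℂ R q := by
  let _ : Algebra ℚ R := ((algebraMap ℂ R).comp (algebraMap ℚ ℂ)).toAlgebra
  exact AlgHom.commutes (SymmetricAlgebra.lift (LinearMap.liftBaseChange ℚ (b.constr ℤ x))) q

theorem euler_add_zsmul {K : Subgroup Torus} (v w : perp K) (r s : ℤ) :
    euler (r • v + s • w) = r • euler v + s • euler w := by
  rw [euler, TensorProduct.tmul_add, TensorProduct.tmul_smul, TensorProduct.tmul_smul, map_add,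
    map_zsmul, map_zsmul]
  rfl

variable {t : Pt W → ℂ} (ht : IsCoordinate W t) {f : PowerSeries ℂ}

theorem actF_euler (σ : Splitting) (hadd : ∀ (F : FinSub) (i : Dir) (r s : ℤ),
      (nIdx F i : ℤ) • i.vec = r • (nIdx F (σ.A F) : ℤ) • (σ.A F).vec +
          s • (nIdx F (σ.B F) : ℤ) • (σ.B F).vec →
        hatF ht f F i = r • hatF ht f F (σ.A F) + s • hatF ht f F (σ.B F))
    (F : FinSub) (i : Dir) : actF ht f σ F (euler ⟨_, mem_perp_F F i⟩) =
      LaurentPolynomial.C (hatF ht f F i) * LaurentPolynomial.T (-1) := by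
  obtain ⟨⟨r, s⟩, h, -⟩ := existsUnique_coeff σ F i
  have e : (⟨_, mem_perp_F F i⟩ : perp F.1) = r • basisF σ F 0 + s • basisF σ F 1 := by
    apply Subtype.ext
    rw [basisF, Module.Basis.mk_apply, Module.Basis.mk_apply]
    exact h
  rw [e, euler_add_zsmul, map_add, map_zsmul, map_zsmul, actF, eulerLift_euler, eulerLift_euler,
    hadd F i r s h, map_add, map_zsmul, map_zsmul, add_mul, smul_mul_assoc, smul_mul_assoc]
  rfl

/-- The Cousin differential is linear over the cohomology ring of `B(G/H_i^n)`: it suffices to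
check this on scalars and on the Euler class. -/
theorem cousinP_actD (hF : ∀ F : FinSub, torsionPart (mF W F) (H2 W F) = ⊤) (σ : Splitting)
    (hadd : ∀ (F : FinSub) (i : Dir) (r s : ℤ),
      (nIdx F i : ℤ) • i.vec = r • (nIdx F (σ.A F) : ℤ) • (σ.A F).vec +
          s • (nIdx F (σ.B F) : ℤ) • (σ.B F).vec →
        hatF ht f F i = r • hatF ht f F (σ.A F) + s • hatF ht f F (σ.B F))
    (i : Dir) (F : FinSub) (a : BCoh (Hsub i (nIdx F i))) (x : Periodic (V1 W i (nIdx F i))) :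
    cousinP hF i F (actD ht f i (nIdx F i) a • x) =
      actF ht f σ F (inflation (F.le_Hsub i) a) • cousinP hF i F x := by
  let IsLin (a : BCoh (Hsub i (nIdx F i))) : Prop := ∀ x : Periodic (V1 W i (nIdx F i)),
    cousinP hF i F (actD ht f i (nIdx F i) a • x) =
      actF ht f σ F (inflation (F.le_Hsub i) a) • cousinP hF i F x
  have hmul : ∀ a b, IsLin a → IsLin b → IsLin (a * b) := by
    intro a b ha hb x
    rw [map_mul, map_mul, map_mul, mul_smul, mul_smul, ha, hb]
  have hadd' : ∀ a b, IsLin a → IsLin b → IsLin (a + b) := by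
    intro a b ha hb x
    rw [map_add, map_add, map_add, add_smul, add_smul, map_add, ha, hb]
  have hscal : ∀ q : ℚ, IsLin (algebraMap ℚ _ q) := by
    intro q x
    rw [AlgHom.commutes, actD, actF, eulerLift_algebraMap, eulerLift_algebraMap]
    have := cousinP_smul hF (i := i) (F := F) (α := algebraMap ℂ _ (q : ℂ))
      (β := algebraMap ℂ _ (q : ℂ)) (fun n => ⟨algebraMap ℂ _ (q : ℂ), rfl, rfl⟩) 0 x
    rw [LaurentPolynomial.T_zero, LaurentPolynomial.T_zero, mul_one, mul_one] at this
    exact this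
  have heul : IsLin (euler (basisH i (nIdx F i) 0)) := by
    intro x
    have e : inflation (F.le_Hsub i) (euler (basisH i (nIdx F i) 0)) =
        euler ⟨_, mem_perp_F F i⟩ := by
      rw [inflation_euler]
      congr 1
      apply Subtype.ext
      change ((basisH i (nIdx F i) 0 : perp _) : ℤ × ℤ) = _
      rw [basisH, Module.Basis.mk_apply]
    rw [e, actF_euler ht σ hadd, actD, eulerLift_euler]
    refine cousinP_smul hF (fun n => ⟨truncSum f n (tF ht F i), ?_, ?_⟩) (-1) x
    · rw [hatD, evalₐ_evalHat, map_truncSum]; rfl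
    · rw [hatF, evalₐ_evalHat]
  have hι : ∀ v, IsLin (SymmetricAlgebra.ι ℚ _ v) := by
    intro v
    induction v using TensorProduct.induction_on with
    | zero => intro x; simp
    | add v w hv hw => rw [map_add]; exact hadd' _ _ hv hw
    | tmul q v =>
      have e : SymmetricAlgebra.ι ℚ _ (q ⊗ₜ[ℤ] v) =
          algebraMap ℚ (BCoh (Hsub i (nIdx F i))) (q * ((basisH i (nIdx F i)).repr v 0 : ℚ)) *
            euler (basisH i (nIdx F i) 0) := by
        have hv := (basisH i (nIdx F i)).sum_repr v
        rw [Fin.sum_univ_one] at hv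
        conv_lhs => rw [← hv]
        rw [TensorProduct.tmul_smul, ← Algebra.smul_def, euler, ← map_smul]
        congr 1
        rw [TensorProduct.smul_tmul', TensorProduct.smul_tmul']
        congr 1
        simp [mul_comm]
      rw [e]
      exact hmul _ _ (hscal _) heul
  induction a using SymmetricAlgebra.induction generalizing x with
  | algebraMap q => exact hscal q x
  | ι v => exact hι v x
  | mul a b ha hb => exact hmul a b ha hb x
  | add a b ha hb => exact hadd' a b ha hb x

/-- The `i`-th component `T_i → N` of the Cousin differential. -/
theorem exists_cousin_linearMap (hF : ∀ F : FinSub, torsionPart (mF W F) (H2 W F) = ⊤)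
    (σ : Splitting) (hadd : ∀ (F : FinSub) (i : Dir) (r s : ℤ),
      (nIdx F i : ℤ) • i.vec = r • (nIdx F (σ.A F) : ℤ) • (σ.A F).vec +
          s • (nIdx F (σ.B F) : ℤ) • (σ.B F).vec →
        hatF ht f F i = r • hatF ht f F (σ.A F) + s • hatF ht f F (σ.B F))
    (i : Dir) : ∃ d : TMod ht f i →ₗ[OFH i] NMod ht f σ,
      ∀ (x : TMod ht f i) (F : FinSub) (k : ℤ),
        (d x F k : H2 W F) = cousinD1 W i F (x (nIdx F i) k) := by
  classical
  have hfin : ∀ x : TMod ht f i, {F : FinSub | cousinP hF i F (x (nIdx F i)) ≠ 0}.Finite := by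
    intro x
    let x' : Π₀ j : ℕ+, Periodic (V1 W i j) := x
    have h1 : (⋃ j ∈ (x'.support : Set ℕ+), ⋃ k ∈ ((show ℤ →₀ V1 W i j from x j).support : Set ℤ),
        {F : FinSub | nIdx F i = j ∧ cousinD1 W i F (x (nIdx F i) k) ≠ 0}).Finite :=
      Set.Finite.biUnion (Finset.finite_toSet _) fun j _ =>
        Set.Finite.biUnion (Finset.finite_toSet _) fun k _ =>
          finite_cousinD1_ne_zero i j fun m => (x m k : H1 W i m)
    refine h1.subset fun F hF0 => ?_
    obtain ⟨k, hk⟩ := Finsupp.ne_iff.mp hF0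
    have hk' : cousinD1 W i F (x (nIdx F i) k) ≠ 0 := fun h => hk (Subtype.ext h)
    have hxk : x (nIdx F i) k ≠ 0 := fun h => hk' (by rw [h]; exact map_zero _)
    simp only [Set.mem_iUnion]
    refine ⟨nIdx F i, ?_, k, ?_, rfl, hk'⟩
    · rw [Finset.mem_coe, DFinsupp.mem_support_iff]
      intro h
      exact hxk (DFunLike.congr_fun (F := ℤ →₀ V1 W i (nIdx F i)) h k)
    · exact Finsupp.mem_support_iff.mpr hxk
  let D (x : TMod ht f i) : NMod ht f σ :=
    DFinsupp.mk (β := fun F => Periodic (V2 W F)) (hfin x).toFinset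
      fun F => cousinP hF i F.1 (x (nIdx F.1 i))
  have hD : ∀ (x : TMod ht f i) (F : FinSub), D x F = cousinP hF i F (x (nIdx F i)) := by
    intro x F
    refine (DFinsupp.mk_apply).trans ?_
    split_ifs with h
    · rfl
    · rw [Set.Finite.mem_toFinset] at h
      exact (not_not.mp h).symm
  refine ⟨{ toFun := D, map_add' := fun x y => ?_, map_smul' := fun a x => ?_ }, fun x F k => ?_⟩
  · refine DFinsupp.ext fun F => (hD _ F).trans ?_
    refine (map_add (cousinP hF i F) (x (nIdx F i)) (y (nIdx F i))).trans ?_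
    rw [← hD, ← hD]; rfl
  · refine DFinsupp.ext fun F => (hD _ F).trans ?_
    refine Eq.trans ?_ (NMod.smul_apply ht f σ i a (D x) F).symm
    rw [TMod.smul_apply, cousinP_actD ht hF σ hadd, hD]
  · change (D x F k : H2 W F) = _
    rw [hD]; rfl

end EllCousin

theorem mainTheorem6 (W : WeierstrassCurve ℂ) [W.IsElliptic] (t : Pt W → ℂ)
    (ht : IsCoordinate W t) (Fg : MvPowerSeries (Fin 2) ℂ) (hFg : IsFormalGroupLaw W t Fg)
    (f : PowerSeries ℂ) (hf : IsLogarithm Fg f) (σ : Splitting) :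
    (∀ (i : Dir) (j : ℕ+), torsionPart (mD W i j) (H1 W i j) = ⊤) ∧
    (∀ F : FinSub, torsionPart (mF W F) (H2 W F) = ⊤) ∧
    (∀ i : Dir, ∃ d : TMod ht f i →ₗ[OFH i] NMod ht f σ,
      ∀ (x : TMod ht f i) (F : FinSub) (k : ℤ),
        (d x F k : H2 W F) = cousinD1 W i F (x (nIdx F i) k)) ∧
    (∀ (F : FinSub) (i : Dir),
      (∃! p : ℤ × ℤ, (nIdx F i : ℤ) • i.vec = p.1 • (nIdx F (σ.A F) : ℤ) • (σ.A F).vec +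
        p.2 • (nIdx F (σ.B F) : ℤ) • (σ.B F).vec) ∧
      ∀ r s : ℤ, (nIdx F i : ℤ) • i.vec = r • (nIdx F (σ.A F) : ℤ) • (σ.A F).vec +
          s • (nIdx F (σ.B F) : ℤ) • (σ.B F).vec →
        hatF ht f F i = r • hatF ht f F (σ.A F) + s • hatF ht f F (σ.B F)) := by
  have hfin : ∀ j : ℕ, j ≠ 0 → {P : Pt W | j • P = 0}.Finite :=
    fun j hj => finite_torsion ht hFg hf hj
  have hD : ∀ s : Dir × ℕ+, ZClosed (Dset W s) := fun s => zClosed_Dset s.1 (hfin _ s.2.ne_zero)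
  have hF := fun F => torsionPart_H2_eq_top hD hfin σ F
  have hadd := fun (F : FinSub) (i : Dir) (r s : ℤ) => hatF_eq ht hFg hf hfin σ (F := F) (i := i)
    (A := σ.A F) (B := σ.B F) (r := r) (s := s)
  exact ⟨torsionPart_H1_eq_top hD, hF, exists_cousin_linearMap ht hF σ hadd,
    fun F i => ⟨existsUnique_coeff σ F i, hadd F i⟩⟩
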